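/- **Setting.** Let $k\ge 1$ and $0=m_0<m_1<\dots<m_k<1$. For $\alpha=(n_1,\dots,n_k)\in\mathbb N^k$ write $\alpha^l=(n_1,\dots,n_l)$, and let $\alpha\wedge\beta=\min\{l\ge 1:\alpha_l\neq\beta_l\}$ if $\alpha\ne\beta$ and $\alpha\wedge\alpha=k+1$. *Cascade.* For each $1\le l\le k$ and each $p\in\mathbb N^{l-1}$ let $(u_{pn})_{n\ge1}$ be a decreasing enumeration of a Poisson point process on $(0,\infty)$ with intensity $x^{-1-m_l}\,dx$, all these processes being independent. Put $v_\alpha=\prod_{l=1}^k u_{\alpha^l}$ and $w_\alpha=v_\alpha/\sum_\gamma v_\gamma$. *Tree process.* Let $\mathcal X_1,\dots,\mathcal X_k$ be complete separable metric spaces with their Borel $\sigma$-algebras, and for $1\le l\le k$ let $\nu_l(\cdot\mid x)$ be a probability kernel from $\mathcal X_1\times\dots\times\mathcal X_{l-1}$ to $\mathcal X_l$ (so $\nu_1$ is a probability measure on $\mathcal X_1$). Independently of all the $u$'s, generate random variables $z_{n_1\dots n_l}\in\mathcal X_l$ recursively in $l$: given all the variables of the levels before $l$, the variables of level $l$ are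 independent, and $z_{n_1\dots n_l}$ has law $\nu_l(\cdot\mid z_{n_1},\dots,z_{n_1\dots n_{l-1}})$. Put $Z_{\alpha}=(z_{\alpha^1},\dots,z_{\alpha^k})$. *Weights.* Let $X:\mathcal X_1\times\dots\times\mathcal X_k\to\mathbb R$ be measurable with $\mathbb E\exp X(Z_\alpha)<\infty$. Let $X_\alpha=X_{\alpha^k}=X(Z_\alpha)$ and, for $l=k,\dots,1$, $$X_{\alpha^{l-1}}=\frac1{m_l}\log\mathbb E_l\exp (m_lX_{\alpha^l}),\qquad W_{\alpha^l}=\exp\bigl( m_l(X_{\alpha^l}-X_{\alpha^{l-1}})\bigr),$$ where $\mathbb E_l$ integrates $z_{\alpha^l}$ with respect to $\nu_l(\cdot\mid z_{\alpha^1},\dots,z_{\alpha^{l-1}})$. **Theorem.** Let $Y$ be a measurable real function on $(\mathcal X_1\times\dots\times\mathcal X_k)^2$ with $\mathbb E\,Y(Z_\gamma,Z_\delta)^2<\infty$ for all $\gamma,\delta\in\mathbb N^k$, and write $Y_{\gamma,\delta}=Y(Z_\gamma,Z_\delta)$. Let $1\le r\le k$ and fix any $\alpha,\beta\in\mathbb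 N^k$ with $\alpha\wedge\beta=r$. Then: 1. Almost surely $0<\sum_\gamma v_\gamma<\infty$ and $0<\sum_\gamma v_\gamma\exp X_\gamma<\infty$, and $$\mathbb E\sum_{\gamma\wedge\delta=r}w_\gamma w_\delta=m_r-m_{r-1}.$$ 2. As an identity in $[0,\infty]$, $$\mathbb E\,\frac{\sum_{\gamma\wedge\delta=r}v_\gamma v_\delta\exp(X_\gamma+X_\delta)\,|Y_{\gamma,\delta}|}{\bigl(\sum_\gamma v_\gamma\exp X_\gamma\bigr)^2}=(m_r-m_{r-1})\,\mathbb E\prod_{l<r}W_{\alpha^l}\prod_{l\ge r}W_{\alpha^l}W_{\beta^l}\,|Y_{\alpha,\beta}|.$$ 3. If the right-hand side in 2 is finite, so that $$M_r=\mathbb E\prod_{l<r}W_{\alpha^l}\prod_{l\ge r}W_{\alpha^l}W_{\beta^l}\,Y_{\alpha,\beta}$$ exists, then the sum over $\gamma\wedge\delta=r$ below converges absolutely almost surely, the quotient is integrable, and $$\mathbb E\,\frac{\sum_{\gamma\wedge\delta=r}v_\gamma v_\delta\exp(X_\gamma+X_\delta)\,Y_{\gamma,\delta}}{\bigl(\sum_\gamma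 v_\gamma\exp X_\gamma\bigr)^2}=(m_r-m_{r-1})\,M_r .$$ -/

import Mathlib

open MeasureTheory ProbabilityTheory

namespace Cascade

noncomputable section

/-! Levels are numbered from `0` in the code: level `l : Fin k` is the level `l + 1` of the usual
numbering `1, …, k`. The vertices at level `l` are pairs `(p, n)`, where `p : Set.Iio l → ℕ` is the
parent vertex and `n : ℕ` numbers the children of `p`. The leaves are `α : Fin k → ℕ`. The
parameters are `m : Fin (k + 1) → ℝ`, numbered as usual, so that the parameter of level `l` is
`m l.succ` and the preceding one is `m l.castSucc`. -/

/-- The number of points of the sequence `u` that lie in `A`. -/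
def pointCount {Ω : Type*} (u : ℕ → Ω → ℝ) (A : Set ℝ) (ω : Ω) : ℕ∞ :=
  {n : ℕ | u n ω ∈ A}.encard

/-- The sequence `u` is a decreasing enumeration of a Poisson point process on `ℝ` with intensity
measure `μ`: the number of points in a measurable set of finite measure is Poisson, in a set of
infinite measure it is a.s. infinite, and the numbers of points in disjoint sets are independent. -/
structure IsDecreasingPoisson {Ω : Type*} [MeasurableSpace Ω] (P : Measure Ω) (μ : Measure ℝ)
    (u : ℕ → Ω → ℝ) : Prop where
  measurable : ∀ n, Measurable (u n)
  antitone : ∀ᵐ ω ∂P, Antitone fun n => u n ω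
  law_of_finite : ∀ A : Set ℝ, MeasurableSet A → μ A ≠ ⊤ → ∀ j : ℕ,
    P {ω | pointCount u A ω = (j : ℕ∞)} = poissonMeasure (μ A).toNNReal {j}
  law_of_infinite : ∀ A : Set ℝ, MeasurableSet A → μ A = ⊤ → ∀ᵐ ω ∂P, pointCount u A ω = ⊤
  indep : ∀ (d : ℕ) (A : Fin d → Set ℝ), (∀ i, MeasurableSet (A i)) →
    Pairwise (fun i j => Disjoint (A i) (A j)) → iIndepFun (fun i => pointCount u (A i)) P

/-- The measure `x ^ (-1 - s) dx` on `(0, ∞)`. -/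
def stableIntensity (s : ℝ) : Measure ℝ :=
  (volume.restrict (Set.Ioi 0)).withDensity fun x => ENNReal.ofReal (x ^ (-1 - s))

/-- The independent Poisson processes from which the Derrida–Ruelle cascade with parameters
`m 1, …, m k` is built: `(u l p n)_n` are the points attached to the children of `p`. -/
structure IsCascade {Ω : Type*} [MeasurableSpace Ω] (P : Measure Ω) {k : ℕ} (m : Fin (k + 1) → ℝ)
    (u : (l : Fin k) → (Set.Iio l → ℕ) → ℕ → Ω → ℝ) : Prop where
  poisson : ∀ l p, IsDecreasingPoisson P (stableIntensity (m l.succ)) (u l p)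
  indep : iIndepFun
    (fun (v : (l : Fin k) × (Set.Iio l → ℕ)) (ω : Ω) (n : ℕ) => u v.1 v.2 n ω) P

/-- `v_α`, the product of the points `u` along the path from the root to the leaf `α`. -/
def leafPoint {Ω : Type*} {k : ℕ} (u : (l : Fin k) → (Set.Iio l → ℕ) → ℕ → Ω → ℝ)
    (α : Fin k → ℕ) (ω : Ω) : ℝ :=
  ∏ l : Fin k, u l (fun i => α i) (α l) ω

/-- `w_α = v_α / ∑_γ v_γ`. -/
def leafWeight {Ω : Type*} {k : ℕ} (u : (l : Fin k) → (Set.Iio l → ℕ) → ℕ → Ω → ℝ)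
    (α : Fin k → ℕ) (ω : Ω) : ℝ :=
  leafPoint u α ω / ∑' γ : Fin k → ℕ, leafPoint u γ ω

/-- `Z_α`: the variables `z` along the path from the root to the leaf `α`. -/
def leafPath {Ω : Type*} {k : ℕ} {𝒳 : Fin k → Type*}
    (z : (l : Fin k) → (Set.Iio l → ℕ) → ℕ → Ω → 𝒳 l) (α : Fin k → ℕ) (ω : Ω) : ∀ l, 𝒳 l :=
  fun l => z l (fun i => α i) (α l) ω

/-- `Z_p` for an inner vertex `p`: the variables `z` along the path from the root to `p`. -/
def innerPath {Ω : Type*} {k : ℕ} {𝒳 : Fin k → Type*}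
    (z : (l : Fin k) → (Set.Iio l → ℕ) → ℕ → Ω → 𝒳 l) {l : Fin k} (p : Set.Iio l → ℕ) (ω : Ω) :
    (i : Set.Iio l) → 𝒳 i :=
  fun i => z i (fun j => p ⟨j, lt_trans (Set.mem_Iio.1 j.2) (Set.mem_Iio.1 i.2)⟩) (p i) ω

/-- The σ-algebra generated by all variables `z` at levels before `l`. -/
abbrev pastSigma {Ω : Type*} {k : ℕ} {𝒳 : Fin k → Type*} [∀ l, MeasurableSpace (𝒳 l)]
    (z : (l : Fin k) → (Set.Iio l → ℕ) → ℕ → Ω → 𝒳 l) (l : Fin k) : MeasurableSpace Ω :=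
  ⨆ (j : Fin k) (_ : j < l) (p : Set.Iio j → ℕ) (n : ℕ),
    MeasurableSpace.comap (z j p n) inferInstance

/-- The variables `z` are generated recursively: given all variables at levels before `l`, the
variables at level `l` are independent, and the children of `p` have law `ν l (· | Z_p)`. For
`l = 0` there is no past, and `ν 0` is a single probability measure on the first space. -/
structure IsTreeProcess {Ω : Type*} [MeasurableSpace Ω] (P : Measure Ω) {k : ℕ}
    {𝒳 : Fin k → Type*} [∀ l, MeasurableSpace (𝒳 l)]
    (ν : (l : Fin k) → Kernel ((i : Set.Iio l) → 𝒳 i) (𝒳 l))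
    (z : (l : Fin k) → (Set.Iio l → ℕ) → ℕ → Ω → 𝒳 l) : Prop where
  measurable : ∀ l p n, Measurable (z l p n)
  condLaw : ∀ (l : Fin k) (S : Finset ((Set.Iio l → ℕ) × ℕ))
    (B : (Set.Iio l → ℕ) × ℕ → Set (𝒳 l)), (∀ q, MeasurableSet (B q)) →
    ∀ G : Set Ω, MeasurableSet[pastSigma z l] G →
      P (G ∩ ⋂ q ∈ S, z l q.1 q.2 ⁻¹' B q)
        = ∫⁻ ω in G, ∏ q ∈ S, ν l (innerPath z q.1 ω) (B q) ∂P

/-- The functions `X_k = X` and `X_{l-1} = (1 / m_l) log E_l exp (m_l X_l)`, where `E_l` integrates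
out the `l`-th coordinate. They are written as functions of a complete path; `X_l` only depends on
the first `l` coordinates. -/
def levelFun {k : ℕ} {𝒳 : Fin k → Type*} [∀ l, MeasurableSpace (𝒳 l)] (m : Fin (k + 1) → ℝ)
    (ν : (l : Fin k) → Kernel ((i : Set.Iio l) → 𝒳 i) (𝒳 l)) (X : (∀ l, 𝒳 l) → ℝ) :
    Fin (k + 1) → (∀ l, 𝒳 l) → ℝ :=
  Fin.reverseInduction (motive := fun _ => (∀ l, 𝒳 l) → ℝ) X fun l F x =>
    1 / m l.succ *
      Real.log (∫ y, Real.exp (m l.succ * F (Function.update x l y)) ∂ν l (fun i => x i))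

/-- `W_l = exp (m_l (X_l - X_{l-1}))`. -/
def density {k : ℕ} {𝒳 : Fin k → Type*} [∀ l, MeasurableSpace (𝒳 l)] (m : Fin (k + 1) → ℝ)
    (ν : (l : Fin k) → Kernel ((i : Set.Iio l) → 𝒳 i) (𝒳 l)) (X : (∀ l, 𝒳 l) → ℝ)
    (l : Fin k) (x : ∀ l, 𝒳 l) : ℝ :=
  Real.exp (m l.succ * (levelFun m ν X l.succ x - levelFun m ν X l.castSucc x))

/-- `∏_{l < r} W_l(x) ∏_{l ≥ r} W_l(x) W_l(y)`. -/
def pairDensity {k : ℕ} {𝒳 : Fin k → Type*} [∀ l, MeasurableSpace (𝒳 l)] (m : Fin (k + 1) → ℝ)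
    (ν : (l : Fin k) → Kernel ((i : Set.Iio l) → 𝒳 i) (𝒳 l)) (X : (∀ l, 𝒳 l) → ℝ)
    (r : Fin k) (x y : ∀ l, 𝒳 l) : ℝ :=
  (∏ l ∈ Finset.univ.filter (fun l => l < r), density m ν X l x) *
    ∏ l ∈ Finset.univ.filter (fun l => r ≤ l), density m ν X l x * density m ν X l y

open Classical in
/-- `α ∧ β`, in the usual numbering: the first `l ∈ {1, …, k}` at which `α` and `β` differ, and
`k + 1` if `α = β`. -/
def wedge {k : ℕ} (α β : Fin k → ℕ) : ℕ :=
  if α = β then k + 1 else sInf {l : ℕ | ∃ i : Fin k, l = (i : ℕ) + 1 ∧ α i ≠ β i}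

/-- The pairs of leaves `(α, β)` with `α ∧ β = r` (level `r : Fin k` has the number `r + 1`). -/
abbrev PairsAt {k : ℕ} (r : Fin k) : Type :=
  {p : (Fin k → ℕ) × (Fin k → ℕ) // wedge p.1 p.2 = (r : ℕ) + 1}

end

end Cascade

namespace Cascade

set_option linter.unusedSectionVars false
open scoped ENNReal NNReal Topology
open Filter

/-! The levels of the tree are integrated out one at a time, from the leaves to the root. Put `θ_j =
m_{j+1}` for `j < k` and `θ_k = 1`, and give a vertex at the end of `j` levels the weight `(product
of its points) ^ θ_j * exp (θ_j X_j)`; at the leaves this is `v_γ exp X_γ`. Let `a_i` be the weights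
of one level and `S` their sum. The denominators are removed by `S⁻¹ = ∫ e^{-tS} dt` and `(S ^ 2)⁻¹
= ∫ t e^{-tS} dt` over `t > 0`. Given the earlier levels, the points of the current level with their
marks form a Poisson process, and Mecke's formulas evaluate one-point and two-point sums weighted by
`e^{-tS}`.

Since the intensity is a power of `x`, only Gamma integrals occur. With `ρ < 1` the ratio of the
parent's exponent to the child's, the factor `c` of a child enters only as `c ^ ρ`, and `c ^ ρ` is
the weight of the parent times the density `W_l`, which has conditional mean `1`. Integrating over
`t` gives a quotient of the same kind one level closer to the root, with each test function `f`
replaced by `E_l (W_l f)` (`tilt`). There are three rules: `∑ a f / S` keeps its form, with constant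
`1` (`lintegral_div`); `∑ a² f / S²` becomes a first-order quotient, with constant `1 - ρ`
(`lintegral_sq_div`); `∑_{i ≠ j} a_i f_i a_j f'_j / S²` becomes a sum over pairs of parents, with
constant `ρ` (`lintegral_pairs_div`).

A pair of leaves that separates at level `r` stays a pair of distinct vertices down to level `r`,
where the two vertices are siblings and collapse into a diagonal sum over their common parent. The
ratios `ρ` telescope to `m_r`, the second rule contributes `1 - m_{r-1} / m_r`, and the first rule
then leads to the root, which is a single vertex. The product of the constants is `m_r - m_{r-1}`.
The tree variables on the right-hand side are integrated out by the same operators `F ↦ E_l (W_l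
F)`, so both sides obey one recursion (`lintegral_pairSum`).

Everything is computed in `[0, ∞]`, so no integrability is needed in advance. The first rule with `f
= 1` even yields `0 < S < ∞` almost surely, because it gives `E (S / S) = 1` while `0 / 0 = ∞ / ∞ =
0`. Product test functions determine the finite measures on pairs of paths, which gives the identity
for every nonnegative function of the pair; a signed `Y` is split into positive and negative parts,
and the statements about `w` are the case `X = 0`, `Y = 1`. -/

/-! ### The exponential `exp (-x)` on `[0, ∞]` -/

/-- The function `x ↦ exp (-x)` on `[0, ∞]`, with values in `[0, 1]`. -/
noncomputable def expNeg (x : ℝ≥0∞) : ℝ≥0∞ := EReal.exp (-(x : EReal))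

@[simp] lemma expNeg_zero : expNeg 0 = 1 := by simp [expNeg]

@[simp] lemma expNeg_top : expNeg ⊤ = 0 := by simp [expNeg]

lemma expNeg_ofReal {x : ℝ} (hx : 0 ≤ x) : expNeg (ENNReal.ofReal x) = ENNReal.ofReal (Real.exp (-x)) := by
  rw [expNeg, EReal.coe_ennreal_ofReal, max_eq_left hx, ← EReal.coe_neg, EReal.exp_coe]

lemma expNeg_add (x y : ℝ≥0∞) : expNeg (x + y) = expNeg x * expNeg y := by
  rw [expNeg, EReal.coe_ennreal_add, EReal.neg_add, sub_eq_add_neg, EReal.exp_add]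
  · rfl
  · left; simp
  · right; simp

lemma continuous_expNeg : Continuous expNeg :=
  ENNReal.continuous_exp.comp (continuous_neg.comp continuous_coe_ennreal_ereal)

lemma measurable_expNeg : Measurable expNeg := continuous_expNeg.measurable

@[fun_prop]
lemma _root_.Measurable.expNeg {α : Type*} [MeasurableSpace α] {f : α → ℝ≥0∞} (hf : Measurable f) :
    Measurable fun x => expNeg (f x) := measurable_expNeg.comp hf

lemma antitone_expNeg : Antitone expNeg := fun x y h =>
  EReal.exp_monotone (EReal.neg_le_neg_iff.2 (by exact_mod_cast h))

lemma expNeg_le_one (x : ℝ≥0∞) : expNeg x ≤ 1 := by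
  simpa using antitone_expNeg (zero_le (a := x))

lemma expNeg_ne_top (x : ℝ≥0∞) : expNeg x ≠ ⊤ := ((expNeg_le_one x).trans_lt ENNReal.one_lt_top).ne

@[simp] lemma expNeg_eq_zero {x : ℝ≥0∞} : expNeg x = 0 ↔ x = ⊤ := by
  simp [expNeg, EReal.neg_eq_bot_iff]

lemma expNeg_sum {ι : Type*} (s : Finset ι) (f : ι → ℝ≥0∞) :
    expNeg (∑ i ∈ s, f i) = ∏ i ∈ s, expNeg (f i) := by
  classical
  induction s using Finset.induction_on with
  | empty => simp
  | insert a s ha ih => rw [Finset.sum_insert ha, Finset.prod_insert ha, expNeg_add, ih]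

/-- The inverse `φ ↦ -log φ` of `expNeg` on `[0, 1]`. -/
noncomputable def negLog (x : ℝ≥0∞) : ℝ≥0∞ := (-(ENNReal.log x)).toENNReal

lemma measurable_negLog : Measurable negLog := by unfold negLog; fun_prop

lemma expNeg_negLog {x : ℝ≥0∞} (hx : x ≤ 1) : expNeg (negLog x) = x := by
  rw [expNeg, negLog, EReal.coe_toENNReal, neg_neg, ENNReal.exp_log]
  rw [EReal.le_neg, neg_zero]
  exact ENNReal.log_le_zero_iff.2 hx

lemma one_sub_expNeg_le (x : ℝ≥0∞) : 1 - expNeg x ≤ x := by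
  by_cases h : x = ⊤
  · simp [h]
  lift x to ℝ≥0 using h
  rw [← ENNReal.ofReal_coe_nnreal, expNeg_ofReal x.coe_nonneg, ← ENNReal.ofReal_one,
    ← ENNReal.ofReal_sub _ (Real.exp_pos _).le]
  apply ENNReal.ofReal_le_ofReal
  linarith [Real.add_one_le_exp (-(x : ℝ))]

/-- Splits the exponent of a Laplace functional at a perturbed function into the unperturbed
exponent and an increment. -/
lemma one_sub_expNeg_add (x y : ℝ≥0∞) :
    1 - expNeg (x + y) = (1 - expNeg x) + expNeg x * (1 - expNeg y) := by
  rw [expNeg_add, ENNReal.mul_sub (fun _ _ => expNeg_ne_top _), mul_one,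
    tsub_add_tsub_cancel (expNeg_le_one x)]
  exact mul_le_of_le_one_right' (expNeg_le_one y)

/-- This is `x / (1 + x) ≤ 1 - e^{-x}`, from `1 + x ≤ e^x`. Written with inverses it remains
meaningful at `0` and `∞` and passes to limits in `[0, ∞]`. -/
lemma le_one_sub_expNeg (x : ℝ≥0∞) : (x⁻¹ + 1)⁻¹ ≤ 1 - expNeg x := by
  by_cases h : x = ⊤
  · simp [h]
  lift x to ℝ≥0 using h
  rcases eq_or_ne x 0 with rfl | hx
  · simp
  have hx' : (0 : ℝ) < x := by positivity
  rw [← ENNReal.ofReal_coe_nnreal, expNeg_ofReal x.coe_nonneg, ← ENNReal.ofReal_one,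
    ← ENNReal.ofReal_sub _ (Real.exp_pos _).le, ← ENNReal.ofReal_inv_of_pos hx',
    ← ENNReal.ofReal_add (by positivity) zero_le_one, ← ENNReal.ofReal_inv_of_pos (by positivity)]
  apply ENNReal.ofReal_le_ofReal
  have h1 : Real.exp (-(x : ℝ)) ≤ ((x : ℝ) + 1)⁻¹ := by
    rw [Real.exp_neg]
    exact inv_anti₀ (by positivity) (Real.add_one_le_exp _)
  have h2 : (((x : ℝ))⁻¹ + 1)⁻¹ = 1 - ((x : ℝ) + 1)⁻¹ := by field_simp; ring
  linarith

/-- The difference quotients of `expNeg` at `0` along a sequence `y n` with `n * y n → c`. -/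
lemma tendsto_mul_one_sub_expNeg {y : ℕ → ℝ≥0∞} {c : ℝ≥0∞}
    (h : Tendsto (fun n : ℕ => (n : ℝ≥0∞) * y n) atTop (𝓝 c)) :
    Tendsto (fun n : ℕ => (n : ℝ≥0∞) * (1 - expNeg (y n))) atTop (𝓝 c) := by
  have hinv : Tendsto (fun n : ℕ => ((n : ℝ≥0∞))⁻¹) atTop (𝓝 0) :=
    ENNReal.tendsto_inv_nat_nhds_zero
  have hlow : Tendsto (fun n : ℕ => (((n : ℝ≥0∞) * y n)⁻¹ + (n : ℝ≥0∞)⁻¹)⁻¹) atTop (𝓝 c) := by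
    simpa using (h.inv.add hinv).inv
  refine tendsto_of_tendsto_of_tendsto_of_le_of_le' hlow h ?_ ?_
  · filter_upwards [eventually_gt_atTop 0] with n hn
    have hn0 : (n : ℝ≥0∞) ≠ 0 := by exact_mod_cast hn.ne'
    have : (((n : ℝ≥0∞) * y n)⁻¹ + (n : ℝ≥0∞)⁻¹)⁻¹ = n * ((y n)⁻¹ + 1)⁻¹ := by
      rw [ENNReal.mul_inv (Or.inl hn0) (Or.inl (ENNReal.natCast_ne_top n))]
      conv_lhs => rw [← mul_one ((n : ℝ≥0∞)⁻¹), mul_assoc, one_mul, ← mul_add]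
      rw [ENNReal.mul_inv (Or.inl (by simp)) (Or.inl (by simpa using hn0)), inv_inv]
    rw [this]
    gcongr
    exact le_one_sub_expNeg _
  · exact Eventually.of_forall fun n => by gcongr; exact one_sub_expNeg_le _

/-! ### Gamma integrals on the half-line -/

lemma ofReal_rpow_mul_expNeg {p q b x : ℝ} (hx : 0 < x) (hb : 0 ≤ b) :
    ENNReal.ofReal x ^ q * expNeg (ENNReal.ofReal x ^ p * ENNReal.ofReal b)
      = ENNReal.ofReal (x ^ q * Real.exp (-b * x ^ p)) := by
  rw [ENNReal.ofReal_rpow_of_pos hx, ENNReal.ofReal_rpow_of_pos hx,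
    ← ENNReal.ofReal_mul (by positivity), expNeg_ofReal (by positivity),
    ← ENNReal.ofReal_mul (by positivity)]
  congr 3; ring

/-- Negative powers of `0` and `∞` are `∞` and `0`, which makes the Gamma integral correct for every
`S`. Hence sums need not be known to be positive or finite when it is applied. -/
lemma lintegral_rpow_mul_expNeg {p q : ℝ} (hp : 0 < p) (hq : -1 < q) (S : ℝ≥0∞) :
    ∫⁻ x in Set.Ioi (0 : ℝ), ENNReal.ofReal x ^ q * expNeg (ENNReal.ofReal x ^ p * S)
      = ENNReal.ofReal (1 / p * Real.Gamma ((q + 1) / p)) * S ^ (-(q + 1) / p) := by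
  have hG : 0 < Real.Gamma ((q + 1) / p) := Real.Gamma_pos_of_pos (div_pos (by linarith) hp)
  have hneg : -(q + 1) / p < 0 := div_neg_of_neg_of_pos (by linarith) hp
  by_cases hS : S = ⊤
  · subst hS
    rw [ENNReal.top_rpow_of_neg hneg, mul_zero]
    rw [setLIntegral_congr_fun measurableSet_Ioi (g := fun _ => 0), lintegral_zero]
    intro x hx
    have : ENNReal.ofReal x ^ p ≠ 0 := by
      rw [ENNReal.ofReal_rpow_of_pos hx]
      simpa using Real.rpow_pos_of_pos hx p
    simp [ENNReal.mul_top this]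
  by_cases hS0 : S = 0
  · subst hS0
    rw [ENNReal.zero_rpow_of_neg hneg, ENNReal.mul_top (by simpa using by positivity)]
    -- No power is integrable on all of `(0, ∞)`, so the integral at `S = 0` is infinite.
    by_contra h
    refine not_integrableOn_Ioi_rpow q ?_
    have hm : AEStronglyMeasurable (fun x : ℝ => x ^ q) (volume.restrict (Set.Ioi 0)) :=
      (by fun_prop : Measurable fun x : ℝ => x ^ q).aestronglyMeasurable
    refine ⟨hm, ?_⟩
    rw [hasFiniteIntegral_iff_ofReal]
    · refine lt_of_le_of_lt (le_of_eq ?_) (lt_top_iff_ne_top.2 h)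
      refine setLIntegral_congr_fun measurableSet_Ioi fun x hx => ?_
      simp [ENNReal.ofReal_rpow_of_pos (show 0 < x from hx)]
    · filter_upwards [self_mem_ae_restrict measurableSet_Ioi] with x hx
      exact Real.rpow_nonneg (le_of_lt hx) _
  obtain ⟨b, hb, rfl⟩ : ∃ b : ℝ, 0 < b ∧ S = ENNReal.ofReal b :=
    ⟨S.toReal, ENNReal.toReal_pos hS0 hS, (ENNReal.ofReal_toReal hS).symm⟩
  have hI := integral_rpow_mul_exp_neg_mul_rpow hp hq hb
  have hpos : 0 < b ^ (-(q + 1) / p) * (1 / p) * Real.Gamma ((q + 1) / p) := by positivity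
  rw [setLIntegral_congr_fun measurableSet_Ioi
    (g := fun x => ENNReal.ofReal (x ^ q * Real.exp (-b * x ^ p)))
    (fun x hx => ofReal_rpow_mul_expNeg hx hb.le), ← ofReal_integral_eq_lintegral_ofReal]
  · rw [hI, ENNReal.ofReal_rpow_of_pos hb, ← ENNReal.ofReal_mul (by positivity)]
    congr 1; ring
  -- A non-integrable function has Bochner integral `0`, which contradicts the positive Gamma value.
  · by_contra h
    rw [integral_undef h] at hI
    exact hpos.ne hI
  · filter_upwards [self_mem_ae_restrict measurableSet_Ioi] with x hx
    have := Real.rpow_nonneg (le_of_lt hx) q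
    positivity

/-- This and the next formula trade the denominators `S` and `S ^ 2` for exponentials, whose
expectations are explicit for a Poisson process. -/
lemma lintegral_expNeg_mul (S : ℝ≥0∞) :
    ∫⁻ t in Set.Ioi (0 : ℝ), expNeg (ENNReal.ofReal t * S) = S⁻¹ := by
  have := lintegral_rpow_mul_expNeg zero_lt_one (neg_one_lt_zero) S
  simpa [ENNReal.rpow_neg_one] using this

lemma lintegral_mul_expNeg_mul (S : ℝ≥0∞) :
    ∫⁻ t in Set.Ioi (0 : ℝ), ENNReal.ofReal t * expNeg (ENNReal.ofReal t * S) = (S ^ 2)⁻¹ := by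
  have := lintegral_rpow_mul_expNeg zero_lt_one (show (-1 : ℝ) < 1 by norm_num) S
  norm_num [ENNReal.rpow_neg] at this
  rw [this]

lemma lintegral_stableIntensity (s : ℝ) {f : ℝ → ℝ≥0∞} (hf : Measurable f) :
    ∫⁻ x, f x ∂stableIntensity s
      = ∫⁻ x in Set.Ioi (0 : ℝ), ENNReal.ofReal x ^ (-1 - s) * f x := by
  rw [stableIntensity, lintegral_withDensity_eq_lintegral_mul _ (by fun_prop) hf]
  refine setLIntegral_congr_fun measurableSet_Ioi fun x hx => ?_
  simp [ENNReal.ofReal_rpow_of_pos (show 0 < x from hx)]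

instance (s : ℝ) : SFinite (stableIntensity s) := by unfold stableIntensity; infer_instance

/-- The fundamental theorem of calculus, in a form that lets Tonelli reduce the Laplace exponent to
a first-order integral. -/
lemma one_sub_expNeg_eq_lintegral {t : ℝ} (ht : 0 ≤ t) {y : ℝ≥0∞} (hy : y ≠ ⊤) :
    1 - expNeg (ENNReal.ofReal t * y)
      = ∫⁻ τ in Set.Ioc 0 t, y * expNeg (ENNReal.ofReal τ * y) := by
  lift y to ℝ≥0 using hy
  have hd : ∀ τ ∈ Set.uIcc 0 t, HasDerivAt (fun τ : ℝ => -Real.exp (-(τ * y)))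
      (y * Real.exp (-(τ * y))) τ := by
    intro τ _
    have := ((((hasDerivAt_id τ).mul_const (y : ℝ)).neg).exp).neg
    refine this.congr_deriv ?_
    simp only [Pi.neg_apply, id_eq]; ring_nf
  have hint : IntervalIntegrable (fun τ : ℝ => (y : ℝ) * Real.exp (-(τ * y))) volume 0 t :=
    Continuous.intervalIntegrable (by fun_prop) _ _
  have h := intervalIntegral.integral_eq_sub_of_hasDerivAt hd hint
  rw [intervalIntegral.integral_of_le ht] at h
  rw [← ENNReal.ofReal_coe_nnreal, ← ENNReal.ofReal_mul ht, expNeg_ofReal (by positivity),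
    ← ENNReal.ofReal_one, ← ENNReal.ofReal_sub _ (Real.exp_pos _).le]
  rw [show 1 - Real.exp (-(t * y)) = -Real.exp (-(t * y)) - -Real.exp (-(0 * (y : ℝ))) by
    simp; ring, ← h, ofReal_integral_eq_lintegral_ofReal]
  · refine setLIntegral_congr_fun measurableSet_Ioc fun τ hτ => ?_
    have : 0 ≤ τ := hτ.1.le
    rw [ENNReal.ofReal_mul y.coe_nonneg, ← ENNReal.ofReal_mul this,
      expNeg_ofReal (by positivity)]
  · exact (intervalIntegrable_iff_integrableOn_Ioc_of_le ht).1 hint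
  · exact Eventually.of_forall fun τ => by positivity

lemma setLIntegral_rpow_sub_one {ρ t : ℝ} (hρ : 0 < ρ) (ht : 0 ≤ t) :
    ∫⁻ τ in Set.Ioc 0 t, ENNReal.ofReal τ ^ (ρ - 1)
      = ENNReal.ofReal (1 / ρ) * ENNReal.ofReal t ^ ρ := by
  have h : ∫ τ in (0 : ℝ)..t, τ ^ (ρ - 1) = t ^ ρ / ρ := by
    rw [integral_rpow (Or.inl (by linarith)), sub_add_cancel, Real.zero_rpow hρ.ne', sub_zero]
  have hint : IntervalIntegrable (fun τ : ℝ => τ ^ (ρ - 1)) volume 0 t :=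
    intervalIntegral.intervalIntegrable_rpow' (by linarith)
  rw [intervalIntegral.integral_of_le ht] at h
  rw [ENNReal.ofReal_rpow_of_nonneg ht hρ.le, ← ENNReal.ofReal_mul (by positivity),
    one_div_mul_eq_div, ← h, ofReal_integral_eq_lintegral_ofReal]
  · exact setLIntegral_congr_fun measurableSet_Ioc fun τ hτ => ENNReal.ofReal_rpow_of_pos hτ.1
  · exact (intervalIntegrable_iff_integrableOn_Ioc_of_le ht).1 hint
  · filter_upwards [self_mem_ae_restrict measurableSet_Ioc] with τ hτ
    exact Real.rpow_nonneg hτ.1.le _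

/-! ### Laplace integrals of the stable intensity -/

section stable

variable {s θ : ℝ}

/-- For `c ≠ 0` the map `x ↦ x ^ θ * c` carries the intensity of index `s` to a multiple of the
intensity of index `s / θ`, the multiple being proportional to `c ^ (s / θ)`. So `c` survives only
through this power, and a Gamma integral remains; it converges at `0` because `s / θ < 1 ≤ n`. -/
lemma lintegral_stable_pow (hs : 0 < s) (hsθ : s < θ) {n : ℕ} (hn : n ≠ 0) {c : ℝ≥0∞} (hc : c ≠ ⊤)
    {t : ℝ} (ht : 0 < t) :
    ∫⁻ x, (ENNReal.ofReal x ^ θ * c) ^ n * expNeg (ENNReal.ofReal t * (ENNReal.ofReal x ^ θ * c))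
        ∂stableIntensity s
      = ENNReal.ofReal (Real.Gamma (n - s / θ) / θ) * ENNReal.ofReal t ^ (s / θ - n)
          * c ^ (s / θ) := by
  have hθ : 0 < θ := hs.trans hsθ
  rw [lintegral_stableIntensity _ (by fun_prop)]
  have hρ : 0 < s / θ := by positivity
  by_cases hc0 : c = 0
  · subst hc0; simp [hρ, hn]
  have hn1 : (1 : ℝ) ≤ n := by exact_mod_cast Nat.one_le_iff_ne_zero.2 hn
  have hT0 : ENNReal.ofReal t ≠ 0 := by simpa using ht
  have hT : ENNReal.ofReal t ≠ ⊤ := ENNReal.ofReal_ne_top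
  have key := lintegral_rpow_mul_expNeg (p := θ) (q := n * θ - 1 - s) hθ (by nlinarith)
    (ENNReal.ofReal t * c)
  have h1 : (n * θ - 1 - s + 1) / θ = n - s / θ := by field_simp; ring
  have h2 : -(n * θ - 1 - s + 1) / θ = s / θ - n := by field_simp; ring
  rw [h1, h2, ENNReal.mul_rpow_of_ne_zero hT0 hc0] at key
  have h3 : c ^ n * c ^ (s / θ - n) = c ^ (s / θ) := by
    rw [← ENNReal.rpow_natCast, ← ENNReal.rpow_add _ _ hc0 hc]; congr 1; ring
  calc _ = ∫⁻ x in Set.Ioi (0 : ℝ), c ^ n * (ENNReal.ofReal x ^ (n * θ - 1 - s) *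
            expNeg (ENNReal.ofReal x ^ θ * (ENNReal.ofReal t * c))) := by
        refine setLIntegral_congr_fun measurableSet_Ioi fun x hx => ?_
        have hx0 : ENNReal.ofReal x ≠ 0 := by simpa using hx
        have : ENNReal.ofReal x ^ (n * θ - 1 - s)
            = ENNReal.ofReal x ^ (-1 - s) * (ENNReal.ofReal x ^ θ) ^ n := by
          rw [← ENNReal.rpow_natCast, ← ENNReal.rpow_mul,
            ← ENNReal.rpow_add _ _ hx0 ENNReal.ofReal_ne_top]
          congr 1; ring
        simp only [this, mul_pow]
        rw [mul_left_comm (ENNReal.ofReal t)]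
        ring
    _ = _ := by
        rw [lintegral_const_mul _ (by fun_prop), key, ← h3]
        rw [show 1 / θ * Real.Gamma (n - s / θ) = Real.Gamma (n - s / θ) / θ by ring]
        ring

/-- The case `n = 1` of the preceding formula, integrated in the parameter from `0` to `t`; the
antiderivative contributes `θ / s`, which turns `Γ / θ` into `Γ / s`. -/
lemma lintegral_stable_one_sub_expNeg (hs : 0 < s) (hsθ : s < θ) {c : ℝ≥0∞} (hc : c ≠ ⊤)
    {t : ℝ} (ht : 0 < t) :
    ∫⁻ x, 1 - expNeg (ENNReal.ofReal t * (ENNReal.ofReal x ^ θ * c)) ∂stableIntensity s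
      = ENNReal.ofReal (Real.Gamma (1 - s / θ) / s) * ENNReal.ofReal t ^ (s / θ)
          * c ^ (s / θ) := by
  have hθ : 0 < θ := hs.trans hsθ
  have hρ : 0 < s / θ := by positivity
  have hG : 0 < Real.Gamma (1 - s / θ) :=
    Real.Gamma_pos_of_pos (by rw [sub_pos, div_lt_one hθ]; exact hsθ)
  have hfin : ∀ x : ℝ, ENNReal.ofReal x ^ θ * c ≠ ⊤ := fun x =>
    ENNReal.mul_ne_top (ENNReal.rpow_ne_top_of_nonneg hθ.le ENNReal.ofReal_ne_top) hc
  simp_rw [fun x => one_sub_expNeg_eq_lintegral ht.le (hfin x)]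
  rw [lintegral_lintegral_swap (by fun_prop)]
  have : ∀ τ ∈ Set.Ioc 0 t, ∫⁻ x, ENNReal.ofReal x ^ θ * c *
      expNeg (ENNReal.ofReal τ * (ENNReal.ofReal x ^ θ * c)) ∂stableIntensity s
      = (ENNReal.ofReal (Real.Gamma (1 - s / θ) / θ) * c ^ (s / θ)) *
        ENNReal.ofReal τ ^ (s / θ - 1) := by
    intro τ hτ
    have := lintegral_stable_pow hs hsθ one_ne_zero hc hτ.1
    simp only [pow_one, Nat.cast_one] at this
    rw [this]; ring
  rw [setLIntegral_congr_fun measurableSet_Ioc this, lintegral_const_mul _ (by fun_prop),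
    setLIntegral_rpow_sub_one hρ ht.le]
  have h2 : ENNReal.ofReal (Real.Gamma (1 - s / θ) / s)
      = ENNReal.ofReal (Real.Gamma (1 - s / θ) / θ) * ENNReal.ofReal (1 / (s / θ)) := by
    rw [← ENNReal.ofReal_mul (by positivity)]
    congr 1; field_simp
  rw [h2]; ring

/-- Integration in `t` of the first-order term in the Laplace transform of a stable sum. -/
lemma lintegral_stable_first {ρ D : ℝ} (hρ : 0 < ρ) (hD : 0 < D) (S : ℝ≥0∞) :
    ∫⁻ t in Set.Ioi (0 : ℝ), ENNReal.ofReal (D * ρ) * ENNReal.ofReal t ^ (ρ - 1) *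
        expNeg (ENNReal.ofReal D * ENNReal.ofReal t ^ ρ * S) = S⁻¹ := by
  have key := lintegral_rpow_mul_expNeg (q := ρ - 1) hρ (by linarith) (ENNReal.ofReal D * S)
  have hD0 : ENNReal.ofReal D ≠ 0 := by simpa using hD
  rw [sub_add_cancel, div_self hρ.ne', neg_div, div_self hρ.ne', Real.Gamma_one, mul_one,
    ENNReal.rpow_neg_one, ENNReal.mul_inv (Or.inl hD0) (Or.inl ENNReal.ofReal_ne_top)] at key
  calc _ = ENNReal.ofReal (D * ρ) * ∫⁻ t in Set.Ioi (0 : ℝ), ENNReal.ofReal t ^ (ρ - 1) *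
        expNeg (ENNReal.ofReal t ^ ρ * (ENNReal.ofReal D * S)) := by
        rw [← lintegral_const_mul _ (by fun_prop)]
        congr 1; ext t
        rw [mul_left_comm (_ ^ ρ), mul_assoc (ENNReal.ofReal D), mul_assoc]
    _ = _ := by
        rw [key, ← mul_assoc, ← mul_assoc, ← ENNReal.ofReal_mul (by positivity),
          ← ENNReal.ofReal_inv_of_pos hD, ← ENNReal.ofReal_mul (by positivity)]
        rw [show D * ρ * (1 / ρ) * D⁻¹ = 1 by field_simp]
        simp

/-- With `τ = D t ^ ρ` one has `t (D ρ t ^ (ρ - 1)) ^ 2 dt = ρ τ dτ`. The factor `ρ` of the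
recursion for pairs originates here. -/
lemma lintegral_stable_second {ρ D : ℝ} (hρ : 0 < ρ) (hD : 0 < D) (S : ℝ≥0∞) :
    ∫⁻ t in Set.Ioi (0 : ℝ), ENNReal.ofReal t * (ENNReal.ofReal (D * ρ) *
        ENNReal.ofReal t ^ (ρ - 1)) ^ 2 * expNeg (ENNReal.ofReal D * ENNReal.ofReal t ^ ρ * S)
      = ENNReal.ofReal ρ * (S ^ 2)⁻¹ := by
  have key := lintegral_rpow_mul_expNeg (q := 2 * ρ - 1) hρ (by linarith) (ENNReal.ofReal D * S)
  have hD0 : ENNReal.ofReal D ≠ 0 := by simpa using hD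
  rw [sub_add_cancel, neg_div, mul_div_assoc, div_self hρ.ne', mul_one, Real.Gamma_two, mul_one,
    ENNReal.rpow_neg, ENNReal.rpow_two, mul_pow,
    ENNReal.mul_inv (Or.inl (pow_ne_zero _ hD0)) (Or.inl (ENNReal.pow_ne_top ENNReal.ofReal_ne_top)),
    ← ENNReal.ofReal_pow hD.le, ← ENNReal.ofReal_inv_of_pos (pow_pos hD _)] at key
  calc _ = ENNReal.ofReal ((D * ρ) ^ 2) * ∫⁻ t in Set.Ioi (0 : ℝ), ENNReal.ofReal t ^ (2 * ρ - 1) *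
        expNeg (ENNReal.ofReal t ^ ρ * (ENNReal.ofReal D * S)) := by
        rw [← lintegral_const_mul _ (by fun_prop)]
        refine setLIntegral_congr_fun measurableSet_Ioi fun t ht => ?_
        have ht0 : ENNReal.ofReal t ≠ 0 := by simpa using ht
        have : ENNReal.ofReal t ^ (2 * ρ - 1)
            = ENNReal.ofReal t * (ENNReal.ofReal t ^ (ρ - 1)) ^ 2 := by
          rw [← ENNReal.rpow_natCast, ← ENNReal.rpow_mul]
          nth_rewrite 2 [← ENNReal.rpow_one (ENNReal.ofReal t)]
          rw [← ENNReal.rpow_add _ _ ht0 ENNReal.ofReal_ne_top]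
          congr 1; push_cast; ring
        simp only [this]
        rw [mul_left_comm (_ ^ ρ), mul_assoc (ENNReal.ofReal D), mul_pow,
          ENNReal.ofReal_pow (by positivity)]
        ring
    _ = _ := by
        rw [key, ← mul_assoc, ← mul_assoc, ← ENNReal.ofReal_mul (by positivity),
          ← ENNReal.ofReal_mul (by positivity)]
        congr 2
        field_simp

end stable

/-! ### The Laplace functional of a Poisson process -/

section poisson

variable {Ω : Type*} [MeasurableSpace Ω] {P : Measure Ω} {μ : Measure ℝ} {u : ℕ → Ω → ℝ}

lemma toENNReal_pointCount (u : ℕ → Ω → ℝ) (A : Set ℝ) (ω : Ω) :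
    (pointCount u A ω : ℝ≥0∞) = ∑' n, A.indicator 1 (u n ω) := by
  rw [pointCount, ← ENNReal.tsum_set_one, tsum_subtype _ fun _ => (1 : ℝ≥0∞)]
  rfl

lemma measurable_pointCount (hu : ∀ n, Measurable (u n)) {A : Set ℝ} (hA : MeasurableSet A) :
    Measurable (pointCount u A) := by
  have h : Measurable fun ω => (pointCount u A ω : ℝ≥0∞) := by
    simp_rw [toENNReal_pointCount]
    exact Measurable.tsum fun n => (measurable_one.indicator hA).comp (hu n)
  refine measurable_to_countable' fun j => ?_
  have : pointCount u A ⁻¹' {j} = (fun ω => (pointCount u A ω : ℝ≥0∞)) ⁻¹' {(j : ℝ≥0∞)} := by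
    ext ω; simp
  rw [this]
  exact h (measurableSet_singleton _)

lemma expNeg_mul_natCast (c : ℝ≥0∞) (n : ℕ) : expNeg (c * n) = expNeg c ^ n := by
  have := expNeg_sum (Finset.range n) fun _ => c
  simpa [mul_comm] using this

/-- The generating function of the Poisson law at `e^{-c}`, including `c = ∞`. -/
lemma tsum_expNeg_mul_poissonMeasure (c : ℝ≥0∞) (r : ℝ≥0) :
    ∑' n : ℕ, expNeg (c * n) * poissonMeasure r {n} = expNeg ((1 - expNeg c) * r) := by
  obtain ⟨e, he0, he1, he⟩ : ∃ e : ℝ, 0 ≤ e ∧ e ≤ 1 ∧ expNeg c = ENNReal.ofReal e :=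
    ⟨(expNeg c).toReal, ENNReal.toReal_nonneg,
      by simpa using ENNReal.toReal_mono ENNReal.one_ne_top (expNeg_le_one c),
      (ENNReal.ofReal_toReal (expNeg_ne_top c)).symm⟩
  simp_rw [expNeg_mul_natCast, he, poissonMeasure_singleton]
  have hs : HasSum (fun n : ℕ => Real.exp (-r) * ((e * r) ^ n / n.factorial))
      (Real.exp (-r) * Real.exp (e * r)) := by
    have := NormedSpace.expSeries_div_hasSum_exp (e * r)
    rw [← Real.exp_eq_exp_ℝ] at this
    exact this.mul_left _
  rw [← ENNReal.ofReal_one, ← ENNReal.ofReal_sub _ he0, ← ENNReal.ofReal_coe_nnreal,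
    ← ENNReal.ofReal_mul (by linarith),
    expNeg_ofReal (mul_nonneg (by linarith) r.coe_nonneg),
    show -((1 - e) * (r : ℝ)) = -r + e * r by ring, Real.exp_add, ← hs.tsum_eq,
    ENNReal.ofReal_tsum_of_nonneg (fun n => by positivity) hs.summable]
  refine tsum_congr fun n => ?_
  rw [← ENNReal.ofReal_pow he0, ← ENNReal.ofReal_mul (by positivity)]
  congr 1; rw [mul_pow]; ring

/-- If `μ A` is finite, this is the Poisson generating function; if `μ A` is infinite and `c ≠ 0`,
both sides vanish. -/
lemma IsDecreasingPoisson.lintegral_expNeg_mul_pointCount [IsProbabilityMeasure P]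
    (hu : IsDecreasingPoisson P μ u) (c : ℝ≥0∞) {A : Set ℝ} (hA : MeasurableSet A) :
    ∫⁻ ω, expNeg (c * pointCount u A ω) ∂P = expNeg ((1 - expNeg c) * μ A) := by
  rcases eq_or_ne c 0 with rfl | hc
  · simp
  have hN := measurable_pointCount hu.measurable hA
  by_cases hμ : μ A = ⊤
  · have h1 : (1 - expNeg c) * μ A = ⊤ := by
      rw [hμ]; refine ENNReal.mul_top ?_
      intro h
      have := (le_one_sub_expNeg c).trans h.le
      simp [hc] at this
    rw [h1, expNeg_top]
    refine lintegral_eq_zero_of_ae_eq_zero ?_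
    filter_upwards [hu.law_of_infinite A hA hμ] with ω hω
    simp [hω, hc]
  · have hF : Measurable fun j : ℕ∞ => expNeg (c * (j : ℝ≥0∞)) := measurable_from_top
    rw [← lintegral_map (f := fun j : ℕ∞ => expNeg (c * (j : ℝ≥0∞))) hF hN,
      lintegral_countable', ← ENNReal.coe_toNNReal hμ, ← tsum_expNeg_mul_poissonMeasure]
    have hinj : Function.Injective (Nat.cast : ℕ → ℕ∞) := Nat.cast_injective
    -- The sum over `ℕ∞` reduces to `ℕ`, since the value `⊤` contributes `expNeg ⊤ = 0` when `c ≠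
    -- 0`.
    rw [← hinj.tsum_eq]
    · refine tsum_congr fun n => ?_
      rw [Measure.map_apply hN (measurableSet_singleton _), ← hu.law_of_finite A hA hμ n]
      simp; rfl
    · intro j hj
      induction j using ENat.recTopCoe with
      | top => simp [hc] at hj
      | coe n => exact ⟨n, rfl⟩

lemma tsum_simpleFunc_eq (g : SimpleFunc ℝ ℝ≥0∞) (ω : Ω) :
    ∑' n, g (u n ω) = ∑ c ∈ g.range, c * pointCount u (g ⁻¹' {c}) ω := by
  simp_rw [toENNReal_pointCount, ← ENNReal.tsum_mul_left]
  rw [← Summable.tsum_finsetSum (fun _ _ => ENNReal.summable)]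
  refine tsum_congr fun n => ?_
  rw [Finset.sum_eq_single (g (u n ω))]
  · simp
  · intro c _ hc
    simp [hc.symm]
  · intro h
    simp at h

/-- The level sets of a simple function are disjoint, so their counts are independent and the
expectation factorizes. -/
lemma IsDecreasingPoisson.lintegral_expNeg_simpleFunc [IsProbabilityMeasure P]
    (hu : IsDecreasingPoisson P μ u) (g : SimpleFunc ℝ ℝ≥0∞) :
    ∫⁻ ω, expNeg (∑' n, g (u n ω)) ∂P = expNeg (∫⁻ x, 1 - expNeg (g x) ∂μ) := by
  have hR : ∫⁻ x, 1 - expNeg (g x) ∂μ = ∑ c ∈ g.range, (1 - expNeg c) * μ (g ⁻¹' {c}) := by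
    have := SimpleFunc.map_lintegral (μ := μ) (fun c => 1 - expNeg c) g
    rw [← this, ← SimpleFunc.lintegral_eq_lintegral]
    simp
  simp_rw [tsum_simpleFunc_eq, hR, expNeg_sum]
  -- Independence of the counts is given for families indexed by `Fin d`, so the range has to be
  -- enumerated.
  rw [← Finset.prod_coe_sort, ← g.range.equivFin.symm.prod_comp]
  simp_rw [← Finset.prod_coe_sort g.range, ← g.range.equivFin.symm.prod_comp (fun c : g.range =>
    expNeg ((c : ℝ≥0∞) * _))]
  have hA : ∀ i, MeasurableSet (g ⁻¹' {((g.range.equivFin.symm i : g.range) : ℝ≥0∞)}) :=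
    fun i => g.measurableSet_preimage _
  have hind := hu.indep _ (fun i => g ⁻¹' {((g.range.equivFin.symm i : g.range) : ℝ≥0∞)}) hA
    (fun i j hij => by
      refine Disjoint.preimage _ ?_
      simpa using fun h => hij (g.range.equivFin.symm.injective (Subtype.ext h)))
  have hind' := hind.comp (fun i => fun j : ℕ∞ =>
    expNeg (((g.range.equivFin.symm i : g.range) : ℝ≥0∞) * (j : ℝ≥0∞)))
    (fun i => measurable_from_top)
  have := lintegral_prod_eq_prod_lintegral_of_indepFun Finset.univ _ hind'
    (fun i => measurable_from_top.comp (measurable_pointCount hu.measurable (hA i)))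
  simp only [Function.comp_def] at this
  rw [this]
  exact Finset.prod_congr rfl fun i _ => hu.lintegral_expNeg_mul_pointCount _ (hA i)

/-- The Laplace functional of a Poisson process. -/
lemma IsDecreasingPoisson.lintegral_expNeg [IsProbabilityMeasure P]
    (hu : IsDecreasingPoisson P μ u) {g : ℝ → ℝ≥0∞} (hg : Measurable g) :
    ∫⁻ ω, expNeg (∑' n, g (u n ω)) ∂P = expNeg (∫⁻ x, 1 - expNeg (g x) ∂μ) := by
  have hmono : ∀ x, Monotone fun i => SimpleFunc.eapprox g i x :=
    fun x i j hij => SimpleFunc.monotone_eapprox g hij x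
  have htend : ∀ x, Tendsto (fun i => SimpleFunc.eapprox g i x) atTop (𝓝 (g x)) := by
    intro x
    rw [← SimpleFunc.iSup_eapprox_apply hg x]
    exact tendsto_atTop_iSup (hmono x)
  have hL : Tendsto (fun i => ∫⁻ ω, expNeg (∑' n, SimpleFunc.eapprox g i (u n ω)) ∂P) atTop
      (𝓝 (∫⁻ ω, expNeg (∑' n, g (u n ω)) ∂P)) := by
    -- The integrands lie in `[0, 1]`. For fixed `ω` the sums converge monotonically, being
    -- integrals against counting measure.
    refine tendsto_lintegral_of_dominated_convergence (fun _ => 1) (fun i => ?_) (fun i => ?_)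
      (by simp) (Eventually.of_forall fun ω => ?_)
    · exact (Measurable.tsum fun n =>
        (SimpleFunc.measurable _).comp (hu.measurable n)).expNeg
    · exact Eventually.of_forall fun ω => expNeg_le_one _
    · refine (continuous_expNeg.tendsto _).comp ?_
      simp_rw [← lintegral_count]
      exact lintegral_tendsto_of_tendsto_of_monotone (fun i => measurable_from_top.aemeasurable)
        (Eventually.of_forall fun n => hmono _) (Eventually.of_forall fun n => htend _)
  have hR : Tendsto (fun i => expNeg (∫⁻ x, 1 - expNeg (SimpleFunc.eapprox g i x) ∂μ)) atTop
      (𝓝 (expNeg (∫⁻ x, 1 - expNeg (g x) ∂μ))) := by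
    refine (continuous_expNeg.tendsto _).comp ?_
    refine lintegral_tendsto_of_tendsto_of_monotone (fun i => ?_)
      (Eventually.of_forall fun x i j hij => ?_) (Eventually.of_forall fun x => ?_)
    · exact (measurable_const.sub (SimpleFunc.measurable _).expNeg).aemeasurable
    · exact tsub_le_tsub_left (antitone_expNeg (hmono x hij)) _
    · exact ENNReal.Tendsto.sub tendsto_const_nhds
        ((continuous_expNeg.tendsto _).comp (htend x)) (Or.inl ENNReal.one_ne_top)
  refine tendsto_nhds_unique hL ?_
  simpa only [hu.lintegral_expNeg_simpleFunc] using hR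

end poisson

/-! ### Conditionally independent marks and the marking theorem -/

section marks

variable {Ω 𝕎 𝒴 J I : Type*} [MeasurableSpace Ω] [MeasurableSpace 𝕎] [MeasurableSpace 𝒴]
  {P : Measure Ω} {W : Ω → 𝕎} {κ : J → Kernel 𝕎 𝒴} {z : J → Ω → 𝒴}

/-- Given `W`, the marks `z i` are independent with laws `κ i (W)`. -/
structure HasCondMarks (P : Measure Ω) (W : Ω → 𝕎) (κ : J → Kernel 𝕎 𝒴) (z : J → Ω → 𝒴) :
    Prop where
  measurable_background : Measurable W
  measurable_mark : ∀ i, Measurable (z i)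
  condLaw : ∀ (S : Finset J) (B : J → Set 𝒴), (∀ i, MeasurableSet (B i)) →
    ∀ G : Set 𝕎, MeasurableSet G →
      P (W ⁻¹' G ∩ ⋂ i ∈ S, z i ⁻¹' B i) = ∫⁻ ω in W ⁻¹' G, ∏ i ∈ S, κ i (W ω) (B i) ∂P

/-- The product of finitely many Markov kernels with the same source. -/
noncomputable def kernelPi (κ : J → Kernel 𝕎 𝒴) [∀ i, IsMarkovKernel (κ i)] (S : Finset J) :
    Kernel 𝕎 (S → 𝒴) where
  toFun w := Measure.pi fun i : S => κ i w
  measurable' := by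
    refine Measurable.measure_of_isPiSystem_of_isProbabilityMeasure generateFrom_pi.symm
      isPiSystem_pi ?_
    rintro _ ⟨B, hB, rfl⟩
    simp_rw [Measure.pi_pi]
    exact Finset.measurable_prod _ fun i _ => (κ i).measurable_coe (hB i (Set.mem_univ i))

lemma kernelPi_apply (κ : J → Kernel 𝕎 𝒴) [∀ i, IsMarkovKernel (κ i)] (S : Finset J) (w : 𝕎) :
    kernelPi κ S w = Measure.pi fun i : S => κ i w := rfl

instance (κ : J → Kernel 𝕎 𝒴) [∀ i, IsMarkovKernel (κ i)] (S : Finset J) :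
    IsMarkovKernel (kernelPi κ S) := ⟨fun w => by rw [kernelPi_apply]; infer_instance⟩

lemma lintegral_kernelPi_prod (κ : J → Kernel 𝕎 𝒴) [∀ i, IsMarkovKernel (κ i)] (S : Finset J)
    (w : 𝕎) {φ : S → 𝒴 → ℝ≥0∞} (hφ : ∀ i, Measurable (φ i)) :
    ∫⁻ y, ∏ i : S, φ i (y i) ∂kernelPi κ S w = ∏ i : S, ∫⁻ y, φ i y ∂κ i w := by
  rw [kernelPi_apply]
  have hind := iIndepFun_pi (μ := fun i : S => κ i w) (X := φ) (fun i => (hφ i).aemeasurable)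
  rw [lintegral_prod_eq_prod_lintegral_of_indepFun _ _ hind
    (fun i => (hφ i).comp (measurable_pi_apply i))]
  refine Finset.prod_congr rfl fun i _ => ?_
  exact (measurePreserving_eval (fun i : S => κ i w) i).lintegral_comp (hφ i)

/-- Both sides are finite measures that agree on products of a background set and a box of marks,
which is exactly what the conditional law prescribes. -/
lemma HasCondMarks.map_eq [IsProbabilityMeasure P] [∀ i, IsMarkovKernel (κ i)]
    (h : HasCondMarks P W κ z) (S : Finset J) :
    P.map (fun ω => (W ω, fun i : S => z i ω)) = (P.map W) ⊗ₘ kernelPi κ S := by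
  have hm : Measurable fun ω => (W ω, fun i : S => z i ω) :=
    h.measurable_background.prodMk (measurable_pi_lambda _ fun i => h.measurable_mark i)
  refine ext_of_generate_finite _
    (generateFrom_eq_prod (C := {s | MeasurableSet s})
      (D := Set.pi Set.univ '' Set.pi Set.univ fun _ : S => {s : Set 𝒴 | MeasurableSet s})
      MeasurableSpace.generateFrom_measurableSet generateFrom_pi isCountablySpanning_measurableSet
      ⟨fun _ => Set.univ, fun _ => ⟨fun _ => Set.univ, by simp, by simp⟩,
        Set.iUnion_const _⟩).symm
    (MeasurableSpace.isPiSystem_measurableSet.prod isPiSystem_pi) ?_ ?_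
  · have := h.measurable_background
    rintro _ ⟨G, hG, _, ⟨B, hB, rfl⟩, rfl⟩
    have hB' : ∀ i, MeasurableSet (B i) := fun i => hB i (Set.mem_univ i)
    classical
    rw [Measure.map_apply hm (hG.prod (MeasurableSet.univ_pi hB')),
      Measure.compProd_apply_prod hG (MeasurableSet.univ_pi hB')]
    simp_rw [kernelPi_apply, Measure.pi_pi]
    rw [setLIntegral_map hG (Finset.measurable_prod _ fun (i : S) _ => (κ i).measurable_coe (hB' i)) this]
    have := h.condLaw S (fun i => if hi : i ∈ S then B ⟨i, hi⟩ else Set.univ)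
      (fun i => by split_ifs <;> simp [hB']) G hG
    convert this using 2
    · ext ω
      simp only [Set.mem_preimage, Set.mem_prod, Set.mem_pi, Set.mem_univ, forall_true_left,
        Set.mem_inter_iff, Set.mem_iInter, Subtype.forall]
      refine and_congr_right fun _ => forall₂_congr fun i hi => ?_
      simp [hi]
    · ext ω
      rw [← Finset.prod_coe_sort S]
      simp
  · rw [Measure.map_apply hm .univ]
    have : IsProbabilityMeasure (P.map W) :=
      Measure.isProbabilityMeasure_map h.measurable_background.aemeasurable
    simp

lemma HasCondMarks.lintegral_prod [IsProbabilityMeasure P] [∀ i, IsMarkovKernel (κ i)]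
    (h : HasCondMarks P W κ z) (S : Finset J) {g : 𝕎 → ℝ≥0∞} (hg : Measurable g)
    {φ : J → 𝕎 → 𝒴 → ℝ≥0∞} (hφ : ∀ i, Measurable (Function.uncurry (φ i))) :
    ∫⁻ ω, g (W ω) * ∏ i ∈ S, φ i (W ω) (z i ω) ∂P
      = ∫⁻ ω, g (W ω) * ∏ i ∈ S, ∫⁻ y, φ i (W ω) y ∂κ i (W ω) ∂P := by
  have hW := h.measurable_background
  have hz := h.measurable_mark
  have hF : Measurable fun p : 𝕎 × (S → 𝒴) => g p.1 * ∏ i : S, φ i p.1 (p.2 i) := by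
    refine (hg.comp measurable_fst).mul (Finset.measurable_prod _ fun i _ => ?_)
    exact (hφ i).comp (measurable_fst.prodMk ((measurable_pi_apply i).comp measurable_snd))
  have h1 := lintegral_map (μ := P) (g := fun ω => (W ω, fun i : S => z i ω)) hF (by fun_prop)
  rw [h.map_eq S, Measure.lintegral_compProd hF, lintegral_map (hF.lintegral_kernel_prod_right') hW]
    at h1
  simp_rw [← Finset.prod_coe_sort S]
  rw [← h1]
  refine lintegral_congr fun ω => ?_
  simp only
  rw [lintegral_const_mul]
  · rw [lintegral_kernelPi_prod κ S (W ω) (φ := fun i => φ i (W ω))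
      fun i => (hφ i).comp measurable_prodMk_left]
  · exact Finset.measurable_prod _ fun i _ =>
      (hφ i).comp (measurable_const.prodMk (measurable_pi_apply i))

lemma tendsto_lintegral_expNeg_sum [IsFiniteMeasure P] [Countable J] {f : J → Ω → ℝ≥0∞}
    (hf : ∀ i, Measurable (f i)) :
    Tendsto (fun S : Finset J => ∫⁻ ω, expNeg (∑ i ∈ S, f i ω) ∂P) atTop
      (𝓝 (∫⁻ ω, expNeg (∑' i, f i ω) ∂P)) := by
  refine tendsto_lintegral_filter_of_dominated_convergence (fun _ => 1)
    (Eventually.of_forall fun S => ?_) (Eventually.of_forall fun S => ?_) (by simp)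
    (Eventually.of_forall fun ω => ?_)
  · exact (Finset.measurable_sum _ fun i _ => hf i).expNeg
  · exact Eventually.of_forall fun ω => expNeg_le_one _
  · exact (continuous_expNeg.tendsto _).comp ENNReal.summable.hasSum

/-- Given the background the marks are averaged separately. `negLog` turns the resulting product of
factors in `[0, 1]` back into the exponential of a sum, so a Laplace functional of the points can be
applied next. -/
lemma HasCondMarks.lintegral_expNeg [IsProbabilityMeasure P] [∀ i, IsMarkovKernel (κ i)]
    [Countable J] (h : HasCondMarks P W κ z)
    {f : J → 𝕎 → 𝒴 → ℝ≥0∞} (hf : ∀ i, Measurable (Function.uncurry (f i))) :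
    ∫⁻ ω, expNeg (∑' i, f i (W ω) (z i ω)) ∂P
      = ∫⁻ ω, expNeg (∑' i, negLog (∫⁻ y, expNeg (f i (W ω) y) ∂κ i (W ω))) ∂P := by
  have hW := h.measurable_background
  have hz := h.measurable_mark
  have hK : ∀ i, Measurable fun w => ∫⁻ y, expNeg (f i w y) ∂κ i w :=
    fun i => (hf i).expNeg.lintegral_kernel_prod_right'
  have hle : ∀ i w, ∫⁻ y, expNeg (f i w y) ∂κ i w ≤ 1 := fun i w =>
    (lintegral_mono fun y => expNeg_le_one _).trans (by simp)
  refine tendsto_nhds_unique (tendsto_lintegral_expNeg_sum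
    fun i => (hf i).comp (hW.prodMk (hz i))) ?_
  refine (tendsto_lintegral_expNeg_sum
    fun i => measurable_negLog.comp ((hK i).comp hW)).congr fun S => ?_
  have := h.lintegral_prod S (g := fun _ => 1) measurable_const
    (φ := fun i w y => expNeg (f i w y)) fun i => (hf i).expNeg
  simp only [one_mul] at this
  simp only [expNeg_sum, this, Function.comp_apply, expNeg_negLog (hle _ _)]

/-- Independence allows the background to be frozen at a value `w`; the independent processes then
contribute a product of Laplace functionals. -/
lemma lintegral_expNeg_of_indep [IsProbabilityMeasure P] [Countable I] {μ : Measure ℝ} [SFinite μ]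
    {u : I → ℕ → Ω → ℝ} (hu : ∀ q, IsDecreasingPoisson P μ (u q))
    (hind : iIndepFun (fun q ω n => u q n ω) P) (hW : Measurable W)
    (hWu : IndepFun W (fun ω q n => u q n ω) P)
    {g : I → 𝕎 → ℝ → ℝ≥0∞} (hg : ∀ q, Measurable (Function.uncurry (g q))) :
    ∫⁻ ω, expNeg (∑' q, ∑' n, g q (W ω) (u q n ω)) ∂P
      = ∫⁻ ω, expNeg (∑' q, ∫⁻ x, 1 - expNeg (g q (W ω) x) ∂μ) ∂P := by
  have hum : ∀ q n, Measurable (u q n) := fun q => (hu q).measurable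
  have hU : Measurable fun ω => fun q n => u q n ω := by fun_prop
  have hfix : ∀ w, ∫⁻ ω, expNeg (∑' q, ∑' n, g q w (u q n ω)) ∂P
      = expNeg (∑' q, ∫⁻ x, 1 - expNeg (g q w x) ∂μ) := by
    intro w
    have hgm : ∀ q, Measurable (g q w) := fun q => (hg q).comp measurable_prodMk_left
    refine tendsto_nhds_unique (tendsto_lintegral_expNeg_sum
      fun q => Measurable.tsum fun n => (hgm q).comp (hum q n)) ?_
    refine ((continuous_expNeg.tendsto _).comp ENNReal.summable.hasSum).congr fun S => ?_
    simp only [expNeg_sum, Function.comp_apply]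
    have hm : ∀ q, Measurable fun x : ℕ → ℝ => expNeg (∑' n, g q w (x n)) := fun q =>
      (Measurable.tsum fun n => (hgm q).comp (measurable_pi_apply n)).expNeg
    have := lintegral_prod_eq_prod_lintegral_of_indepFun S _
      (hind.comp (fun q x => expNeg (∑' n, g q w (x n))) hm)
      (fun q => (hm q).comp (by fun_prop))
    simp only [Function.comp_def] at this
    rw [this]
    exact Finset.prod_congr rfl fun q _ => ((hu q).lintegral_expNeg (hgm q)).symm
  have hF : Measurable fun p : 𝕎 × (I → ℕ → ℝ) => expNeg (∑' q, ∑' n, g q p.1 (p.2 q n)) :=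
    (Measurable.tsum fun q => Measurable.tsum fun n => (hg q).comp
      (measurable_fst.prodMk ((measurable_pi_apply n).comp
        ((measurable_pi_apply q).comp measurable_snd)))).expNeg
  have h1 := lintegral_map (μ := P) hF (hW.prodMk hU)
  rw [(indepFun_iff_map_prod_eq_prod_map_map hW.aemeasurable hU.aemeasurable).1 hWu,
    MeasureTheory.lintegral_prod _ hF.aemeasurable, lintegral_map hF.lintegral_prod_right' hW] at h1
  rw [← h1]
  refine lintegral_congr fun ω => ?_
  exact (lintegral_map (hF.comp measurable_prodMk_left) hU).trans (hfix (W ω))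

/-- A level of a cascade with marks: given the background `W`, the points `u q` are independent
Poisson processes and the marks `z q n` are independent with laws `κ q (W)`. -/
structure IsMarkedLevel (P : Measure Ω) (μ : Measure ℝ) (W : Ω → 𝕎) (κ : I → Kernel 𝕎 𝒴)
    (u : I → ℕ → Ω → ℝ) (z : I → ℕ → Ω → 𝒴) : Prop where
  poisson : ∀ q, IsDecreasingPoisson P μ (u q)
  indep : iIndepFun (fun q ω n => u q n ω) P
  indep_background : IndepFun W (fun ω q n => u q n ω) P
  marks : HasCondMarks P (fun ω => (W ω, fun q n => u q n ω))
    (fun i : I × ℕ => (κ i.1).prodMkRight (I → ℕ → ℝ)) (fun i => z i.1 i.2)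

lemma IsMarkedLevel.measurable_background {μ : Measure ℝ} {κ : I → Kernel 𝕎 𝒴}
    {u : I → ℕ → Ω → ℝ} {z : I → ℕ → Ω → 𝒴} (h : IsMarkedLevel P μ W κ u z) : Measurable W :=
  h.marks.measurable_background.fst

/-- The intensity measure of the points of a marked level, given the background. -/
noncomputable def levelIntensity [MeasurableSpace I] [Countable I] (μ : Measure ℝ) (κ : I → Kernel 𝕎 𝒴) :
    Kernel 𝕎 (I × ℝ × 𝒴) :=
  Kernel.sum fun q => (Kernel.const 𝕎 μ ×ₖ κ q).map (Prod.mk q)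

instance [MeasurableSpace I] [Countable I] (μ : Measure ℝ) [SFinite μ] (κ : I → Kernel 𝕎 𝒴)
    [∀ i, IsMarkovKernel (κ i)] : IsSFiniteKernel (levelIntensity μ κ) := by
  unfold levelIntensity; infer_instance

lemma lintegral_levelIntensity [MeasurableSpace I] [Countable I] (μ : Measure ℝ) [SFinite μ]
    (κ : I → Kernel 𝕎 𝒴) [∀ i, IsMarkovKernel (κ i)] (w : 𝕎) {f : I × ℝ × 𝒴 → ℝ≥0∞}
    (hf : Measurable f) :
    ∫⁻ p, f p ∂levelIntensity μ κ w = ∑' q, ∫⁻ y, ∫⁻ x, f (q, x, y) ∂μ ∂κ q w := by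
  rw [levelIntensity, Kernel.sum_apply, lintegral_sum_measure]
  refine tsum_congr fun q => ?_
  rw [Kernel.map_apply _ measurable_prodMk_left, lintegral_map hf measurable_prodMk_left,
    Kernel.prod_apply, Kernel.const_apply]
  exact lintegral_prod_symm' _ (hf.comp measurable_prodMk_left)

/-- The points `ξ i` form, given `W`, a Poisson process with intensity `η (W)`, in the sense that
they have the right Laplace functional. -/
structure HasPoissonLaplace {E : Type*} [MeasurableSpace E] (P : Measure Ω) (W : Ω → 𝕎)
    (η : Kernel 𝕎 E) (ξ : J → Ω → E) : Prop where
  measurable_background : Measurable W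
  measurable_point : ∀ i, Measurable (ξ i)
  laplace : ∀ f : 𝕎 → E → ℝ≥0∞, Measurable (Function.uncurry f) →
    ∫⁻ ω, expNeg (∑' i, f (W ω) (ξ i ω)) ∂P
      = ∫⁻ ω, expNeg (∫⁻ p, 1 - expNeg (f (W ω) p) ∂η (W ω)) ∂P

/-- The marking theorem: averaging first over the marks and then over the points leaves `1 - e^{-f}`
integrated against the product of the point intensity and the mark laws. The parent is kept as a
coordinate so that all families of siblings form one process. -/
lemma IsMarkedLevel.hasPoissonLaplace [IsProbabilityMeasure P] [MeasurableSpace I] [Countable I]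
    [MeasurableSingletonClass I]
    {μ : Measure ℝ} [SFinite μ] {κ : I → Kernel 𝕎 𝒴} [∀ i, IsMarkovKernel (κ i)]
    {u : I → ℕ → Ω → ℝ} {z : I → ℕ → Ω → 𝒴} (h : IsMarkedLevel P μ W κ u z) :
    HasPoissonLaplace P W (levelIntensity μ κ)
      (fun (i : I × ℕ) ω => (i.1, u i.1 i.2 ω, z i.1 i.2 ω)) where
  measurable_background := h.measurable_background
  measurable_point i := by
    have := (h.poisson i.1).measurable i.2
    have := h.marks.measurable_mark i
    fun_prop
  laplace f hf := by
    have hfq : ∀ q, Measurable fun p : (𝕎 × ℝ) × 𝒴 => f p.1.1 (q, p.1.2, p.2) := fun q =>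
      hf.comp (by fun_prop : Measurable fun p : (𝕎 × ℝ) × 𝒴 => (p.1.1, (q, p.1.2, p.2)))
    have h1 := h.marks.lintegral_expNeg (f := fun i w y => f w.1 (i.1, w.2 i.1 i.2, y))
      (fun i => (hfq i.1).comp (by fun_prop :
        Measurable fun p : (𝕎 × (I → ℕ → ℝ)) × 𝒴 => ((p.1.1, p.1.2 i.1 i.2), p.2)))
    simp only [Kernel.prodMkRight_apply] at h1
    rw [h1]
    have hle : ∀ q w x, ∫⁻ y, expNeg (f w (q, x, y)) ∂κ q w ≤ 1 := fun q w x =>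
      (lintegral_mono fun y => expNeg_le_one _).trans (by simp)
    have hK : ∀ q, Measurable fun p : 𝕎 × ℝ => ∫⁻ y, expNeg (f p.1 (q, p.2, y)) ∂κ q p.1 :=
      fun q => (hfq q).expNeg.lintegral_kernel_prod_right' (κ := (κ q).prodMkRight ℝ)
    have h2 := lintegral_expNeg_of_indep h.poisson h.indep h.measurable_background
      h.indep_background (g := fun q w x => negLog (∫⁻ y, expNeg (f w (q, x, y)) ∂κ q w))
      (fun q => measurable_negLog.comp (hK q))
    simp_rw [ENNReal.tsum_prod', h2]
    refine lintegral_congr fun ω => ?_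
    have hm0 : Measurable fun p => 1 - expNeg (f (W ω) p) :=
      measurable_const.sub (hf.comp measurable_prodMk_left).expNeg
    rw [lintegral_levelIntensity μ κ _ hm0]
    congr 1
    refine tsum_congr fun q => ?_
    have hm : Measurable fun p : ℝ × 𝒴 => 1 - expNeg (f (W ω) (q, p.1, p.2)) :=
      measurable_const.sub ((hfq q).comp
        (by fun_prop : Measurable fun p : ℝ × 𝒴 => ((W ω, p.1), p.2))).expNeg
    rw [lintegral_lintegral_swap (f := fun y x => 1 - expNeg (f (W ω) (q, x, y)))
      (hm.comp measurable_swap).aemeasurable]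
    refine lintegral_congr fun x => ?_
    rw [expNeg_negLog (hle q _ x), lintegral_sub]
    · simp
    · exact ((hfq q).comp (by fun_prop : Measurable fun y : 𝒴 => ((W ω, x), y))).expNeg
    · exact ((hle q (W ω) x).trans_lt ENNReal.one_lt_top).ne
    · exact Eventually.of_forall fun y => expNeg_le_one _

end marks

/-! ### Mecke formulas by differentiating Laplace functionals -/

section mecke

lemma tendsto_lintegral_of_le {α : Type*} [MeasurableSpace α] {μ : Measure α}
    {F : ℕ → α → ℝ≥0∞} {G : α → ℝ≥0∞} (hF : ∀ n, Measurable (F n)) (hle : ∀ n a, F n a ≤ G a)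
    (hlim : ∀ a, Tendsto (fun n => F n a) atTop (𝓝 (G a))) :
    Tendsto (fun n => ∫⁻ a, F n a ∂μ) atTop (𝓝 (∫⁻ a, G a ∂μ)) := by
  refine tendsto_of_le_liminf_of_limsup_le ?_ ?_
  · refine le_trans (le_of_eq ?_) (lintegral_liminf_le hF)
    exact lintegral_congr fun a => (hlim a).liminf_eq.symm
  · refine limsup_le_of_le (by isBoundedDefault) ?_
    exact Eventually.of_forall fun n => lintegral_mono (hle n)

lemma natCast_mul_inv_mul_le (n : ℕ) (x : ℝ≥0∞) : (n : ℝ≥0∞) * ((n : ℝ≥0∞)⁻¹ * x) ≤ x := by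
  rw [← mul_assoc]
  exact mul_le_of_le_one_left' (ENNReal.mul_inv_le_one _)

lemma tendsto_natCast_mul_inv_mul (x : ℝ≥0∞) :
    Tendsto (fun n : ℕ => (n : ℝ≥0∞) * ((n : ℝ≥0∞)⁻¹ * x)) atTop (𝓝 x) := by
  refine tendsto_const_nhds.congr' ?_
  filter_upwards [eventually_gt_atTop 0] with n hn
  rw [← mul_assoc, ENNReal.mul_inv_cancel (by exact_mod_cast hn.ne') (ENNReal.natCast_ne_top n),
    one_mul]

/-- The derivative at `0` of a Laplace transform. -/
lemma tendsto_deriv_laplace {α : Type*} [MeasurableSpace α] {μ : Measure α}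
    {F V : α → ℝ≥0∞} {v : ℕ → α → ℝ≥0∞} (hF : Measurable F) (hFi : ∫⁻ a, F a ∂μ ≠ ⊤)
    (hv : ∀ n, Measurable (v n)) (hle : ∀ (n : ℕ) a, (n : ℝ≥0∞) * v n a ≤ V a)
    (hlim : ∀ a, Tendsto (fun n : ℕ => (n : ℝ≥0∞) * v n a) atTop (𝓝 (V a))) :
    Tendsto (fun n : ℕ => (n : ℝ≥0∞) * (∫⁻ a, F a ∂μ - ∫⁻ a, F a * expNeg (v n a) ∂μ)) atTop
      (𝓝 (∫⁻ a, F a * V a ∂μ)) := by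
  have hFfin : ∀ᵐ a ∂μ, F a ≠ ⊤ := by
    filter_upwards [ae_lt_top hF hFi] with a ha using ha.ne
  have h1 : ∀ n : ℕ, (n : ℝ≥0∞) * (∫⁻ a, F a ∂μ - ∫⁻ a, F a * expNeg (v n a) ∂μ)
      = ∫⁻ a, F a * (n * (1 - expNeg (v n a))) ∂μ := by
    intro n
    have hsplit : ∫⁻ a, F a ∂μ = ∫⁻ a, F a * (1 - expNeg (v n a)) ∂μ
        + ∫⁻ a, F a * expNeg (v n a) ∂μ := by
      have hm : Measurable fun a => F a * expNeg (v n a) := hF.fun_mul (hv n).expNeg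
      rw [← lintegral_add_right _ hm]
      refine lintegral_congr fun a => ?_
      rw [← mul_add, tsub_add_cancel_of_le (expNeg_le_one _), mul_one]
    have hfin : ∫⁻ a, F a * expNeg (v n a) ∂μ ≠ ⊤ :=
      ne_top_of_le_ne_top hFi (lintegral_mono fun a => mul_le_of_le_one_right' (expNeg_le_one _))
    rw [hsplit, ENNReal.add_sub_cancel_right hfin, ← lintegral_const_mul]
    · exact lintegral_congr fun a => by ring
    · exact hF.fun_mul (measurable_const.fun_sub (hv n).expNeg)
  simp_rw [h1]
  -- Fatou gives the lower bound and `n (1 - e^{-v}) ≤ n v ≤ V` the upper one, so the limit is also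
  -- correct when it is infinite.
  refine tendsto_of_le_liminf_of_limsup_le ?_ ?_
  · refine le_trans (le_of_eq ?_) (lintegral_liminf_le fun n =>
      hF.fun_mul (measurable_const.fun_mul (measurable_const.fun_sub (hv n).expNeg)))
    refine lintegral_congr_ae ?_
    filter_upwards [hFfin] with a ha
    exact (ENNReal.Tendsto.const_mul (tendsto_mul_one_sub_expNeg (hlim a))
      (Or.inr ha)).liminf_eq.symm
  · refine limsup_le_of_le (by isBoundedDefault) (Eventually.of_forall fun n => ?_)
    refine lintegral_mono fun a => ?_
    gcongr
    exact (mul_le_mul_right (one_sub_expNeg_le _) _).trans (hle n a)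

lemma expNeg_lintegral_add {𝕎 E : Type*} [MeasurableSpace 𝕎] [MeasurableSpace E]
    {η : Kernel 𝕎 E} {f v : 𝕎 → E → ℝ≥0∞} (hf : Measurable (Function.uncurry f)) (w : 𝕎) :
    expNeg (∫⁻ p, 1 - expNeg (f w p + v w p) ∂η w)
      = expNeg (∫⁻ p, 1 - expNeg (f w p) ∂η w)
        * expNeg (∫⁻ p, expNeg (f w p) * (1 - expNeg (v w p)) ∂η w) := by
  have hfw : Measurable (f w) := hf.comp measurable_prodMk_left
  have hm : Measurable fun p => 1 - expNeg (f w p) := measurable_const.fun_sub hfw.expNeg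
  rw [← expNeg_add, ← lintegral_add_left hm]
  simp_rw [one_sub_expNeg_add]

/-- The difference quotients of the intensity integral. -/
lemma tendsto_mul_lintegral_one_sub_expNeg {E : Type*} [MeasurableSpace E] {μ : Measure E} {f g : E → ℝ≥0∞} (hf : Measurable f)
    (hg : Measurable g) :
    Tendsto (fun n : ℕ => (n : ℝ≥0∞) *
      ∫⁻ p, expNeg (f p) * (1 - expNeg ((n : ℝ≥0∞)⁻¹ * g p)) ∂μ) atTop
      (𝓝 (∫⁻ p, g p * expNeg (f p) ∂μ)) ∧
    ∀ n : ℕ, (n : ℝ≥0∞) * ∫⁻ p, expNeg (f p) * (1 - expNeg ((n : ℝ≥0∞)⁻¹ * g p)) ∂μ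
      ≤ ∫⁻ p, g p * expNeg (f p) ∂μ := by
  have hm : ∀ n : ℕ, Measurable fun p => expNeg (f p) * (1 - expNeg ((n : ℝ≥0∞)⁻¹ * g p)) :=
    fun n => hf.expNeg.fun_mul (measurable_const.fun_sub (measurable_const.fun_mul hg).expNeg)
  have hle : ∀ (n : ℕ) p, (n : ℝ≥0∞) * (expNeg (f p) * (1 - expNeg ((n : ℝ≥0∞)⁻¹ * g p)))
      ≤ g p * expNeg (f p) := by
    intro n p
    rw [mul_left_comm, mul_comm (g p)]
    gcongr
    exact (mul_le_mul_right (one_sub_expNeg_le _) _).trans (natCast_mul_inv_mul_le n _)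
  simp_rw [← lintegral_const_mul _ (hm _)]
  refine ⟨tendsto_lintegral_of_le (fun n => (hm n).const_mul _) hle fun p => ?_,
    fun n => lintegral_mono (hle n)⟩
  simp_rw [mul_left_comm _ (expNeg (f p)), mul_comm (g p)]
  exact ENNReal.Tendsto.const_mul (tendsto_mul_one_sub_expNeg (tendsto_natCast_mul_inv_mul _))
    (Or.inr (expNeg_ne_top _))

variable {Ω 𝕎 E J : Type*} [MeasurableSpace Ω] [MeasurableSpace 𝕎] [MeasurableSpace E]
  {P : Measure Ω} [IsProbabilityMeasure P] [Countable J] {W : Ω → 𝕎} {η : Kernel 𝕎 E}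
  [IsSFiniteKernel η] {ξ : J → Ω → E}

lemma measurable_lintegral_uncurry {f : 𝕎 → E → ℝ≥0∞} (hf : Measurable (Function.uncurry f)) :
    Measurable fun w => ∫⁻ p, f w p ∂η w := hf.lintegral_kernel_prod_right'

/-- The first-order Mecke formula, weighted by an exponential functional. -/
lemma HasPoissonLaplace.mecke (h : HasPoissonLaplace P W η ξ) {f g : 𝕎 → E → ℝ≥0∞}
    (hf : Measurable (Function.uncurry f)) (hg : Measurable (Function.uncurry g)) :
    ∫⁻ ω, (∑' i, g (W ω) (ξ i ω)) * expNeg (∑' i, f (W ω) (ξ i ω)) ∂P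
      = ∫⁻ ω, (∫⁻ p, g (W ω) p * expNeg (f (W ω) p) ∂η (W ω)) *
          expNeg (∫⁻ p, 1 - expNeg (f (W ω) p) ∂η (W ω)) ∂P := by
  have hW := h.measurable_background
  have hξ := h.measurable_point
  have hfξ : ∀ i, Measurable fun ω => f (W ω) (ξ i ω) := fun i => hf.comp (hW.prodMk (hξ i))
  have hgξ : ∀ i, Measurable fun ω => g (W ω) (ξ i ω) := fun i => hg.comp (hW.prodMk (hξ i))
  have hfin : ∀ f : Ω → ℝ≥0∞, ∫⁻ ω, expNeg (f ω) ∂P ≠ ⊤ := fun f =>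
    ne_top_of_le_ne_top ENNReal.one_ne_top
      ((lintegral_mono fun ω => expNeg_le_one _).trans (by simp))
  have hΛ : Measurable fun w => ∫⁻ p, 1 - expNeg (f w p) ∂η w :=
    measurable_lintegral_uncurry (f := fun w p => 1 - expNeg (f w p))
      (measurable_const.fun_sub hf.expNeg)
  have hG : ∀ n : ℕ, Measurable fun w =>
      ∫⁻ p, expNeg (f w p) * (1 - expNeg ((n : ℝ≥0∞)⁻¹ * g w p)) ∂η w := fun n =>
    measurable_lintegral_uncurry
      (f := fun w p => expNeg (f w p) * (1 - expNeg ((n : ℝ≥0∞)⁻¹ * g w p)))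
      (hf.expNeg.fun_mul (measurable_const.fun_sub (hg.const_mul _).expNeg))
  have h1 := tendsto_deriv_laplace (μ := P) (F := fun ω => expNeg (∑' i, f (W ω) (ξ i ω)))
    (V := fun ω => ∑' i, g (W ω) (ξ i ω))
    (v := fun n ω => (n : ℝ≥0∞)⁻¹ * ∑' i, g (W ω) (ξ i ω))
    (Measurable.tsum hfξ).expNeg (hfin _) (fun n => (Measurable.tsum hgξ).const_mul _)
    (fun n ω => natCast_mul_inv_mul_le n _) (fun ω => tendsto_natCast_mul_inv_mul _)
  have hfw : ∀ w, Measurable (f w) := fun w => hf.comp measurable_prodMk_left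
  have hgw : ∀ w, Measurable (g w) := fun w => hg.comp measurable_prodMk_left
  have h2 := tendsto_deriv_laplace (μ := P)
    (F := fun ω => expNeg (∫⁻ p, 1 - expNeg (f (W ω) p) ∂η (W ω)))
    (V := fun ω => ∫⁻ p, g (W ω) p * expNeg (f (W ω) p) ∂η (W ω))
    (v := fun n ω => ∫⁻ p, expNeg (f (W ω) p) * (1 - expNeg ((n : ℝ≥0∞)⁻¹ * g (W ω) p)) ∂η (W ω))
    (hΛ.comp hW).expNeg (hfin _) (fun n => (hG n).comp hW)
    (fun n ω => (tendsto_mul_lintegral_one_sub_expNeg (hfw _) (hgw _)).2 n)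
    (fun ω => (tendsto_mul_lintegral_one_sub_expNeg (hfw _) (hgw _)).1)
  refine (lintegral_congr fun ω => mul_comm _ _).trans
    (Eq.trans ?_ (lintegral_congr fun ω => mul_comm _ _))
  refine tendsto_nhds_unique h1 (h2.congr fun n => ?_)
  -- Perturbing `f` to `f + g / n` in the Laplace functional equates the two difference quotients.
  have h3 := h.laplace (fun w p => f w p + (n : ℝ≥0∞)⁻¹ * g w p) (hf.fun_add (hg.const_mul _))
  simp_rw [expNeg_lintegral_add (v := fun w p => (n : ℝ≥0∞)⁻¹ * g w p) hf, ENNReal.tsum_add,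
    expNeg_add, ENNReal.tsum_mul_left] at h3
  rw [h.laplace f hf, h3]

/-- A second differentiation, now of the first-order formula in the direction `g'`. Finiteness of
the first-order expression makes its differences meaningful, and finiteness of `g'` allows
exponentials to be cancelled. -/
lemma HasPoissonLaplace.mecke_pair_of_finite (h : HasPoissonLaplace P W η ξ) [DecidableEq J]
    {f g g' : 𝕎 → E → ℝ≥0∞} (hf : Measurable (Function.uncurry f))
    (hg : Measurable (Function.uncurry g)) (hg' : Measurable (Function.uncurry g'))
    (hg'_fin : ∀ w p, g' w p ≠ ⊤)
    (hfin : ∫⁻ ω, (∑' i, g (W ω) (ξ i ω)) * expNeg (∑' i, f (W ω) (ξ i ω)) ∂P ≠ ⊤) :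
    ∫⁻ ω, (∑' i, ∑' j, if i = j then 0 else g (W ω) (ξ i ω) * g' (W ω) (ξ j ω)) *
        expNeg (∑' i, f (W ω) (ξ i ω)) ∂P
      = ∫⁻ ω, (∫⁻ p, g (W ω) p * expNeg (f (W ω) p) ∂η (W ω)) *
          (∫⁻ p, g' (W ω) p * expNeg (f (W ω) p) ∂η (W ω)) *
          expNeg (∫⁻ p, 1 - expNeg (f (W ω) p) ∂η (W ω)) ∂P := by
  have hW := h.measurable_background
  have hξ := h.measurable_point
  have hfξ : ∀ i, Measurable fun ω => f (W ω) (ξ i ω) := fun i => hf.comp (hW.prodMk (hξ i))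
  have hgξ : ∀ i, Measurable fun ω => g (W ω) (ξ i ω) := fun i => hg.comp (hW.prodMk (hξ i))
  have hgξ' : ∀ i, Measurable fun ω => g' (W ω) (ξ i ω) := fun i => hg'.comp (hW.prodMk (hξ i))
  have hfw : ∀ w, Measurable (f w) := fun w => hf.comp measurable_prodMk_left
  have hgw' : ∀ w, Measurable (g' w) := fun w => hg'.comp measurable_prodMk_left
  let V : J → Ω → ℝ≥0∞ := fun i ω => ∑' j, if i = j then 0 else g' (W ω) (ξ j ω)
  have hV : ∀ i, Measurable (V i) := fun i => Measurable.tsum fun j => by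
    split_ifs
    · exact measurable_const
    · exact hgξ' j
  have hVsplit : ∀ i ω, ∑' j, g' (W ω) (ξ j ω) = g' (W ω) (ξ i ω) + V i ω := by
    intro i ω
    rw [ENNReal.tsum_eq_add_tsum_ite (f := fun j => g' (W ω) (ξ j ω)) i]
    simp only [V, @eq_comm J i]
    congr!

  let _ : MeasurableSpace J := ⊤
  -- Counting measure on the indices puts the outer sum inside one integral, so the derivative can
  -- be taken term by term.
  let F : J × Ω → ℝ≥0∞ := fun a => g (W a.2) (ξ a.1 a.2) * expNeg (∑' i, f (W a.2) (ξ i a.2))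
  have hFi : ∀ i, Measurable fun ω => F (i, ω) := fun i =>
    (hgξ i).fun_mul (Measurable.tsum hfξ).expNeg
  have hF : Measurable F := measurable_from_prod_countable_right hFi
  have hV' : Measurable fun a : J × Ω => V a.1 a.2 :=
    measurable_from_prod_countable_right fun i => hV i
  have hsum : ∀ H : J × Ω → ℝ≥0∞, Measurable H →
      ∫⁻ a, H a ∂(Measure.count.prod P) = ∫⁻ ω, ∑' i, H (i, ω) ∂P := by
    intro H hH
    rw [MeasureTheory.lintegral_prod _ hH.aemeasurable, lintegral_count,
      lintegral_tsum fun i => Measurable.aemeasurable (hH.fun_comp measurable_prodMk_left)]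
  have hFtot : ∫⁻ a, F a ∂(Measure.count.prod P)
      = ∫⁻ ω, (∑' i, g (W ω) (ξ i ω)) * expNeg (∑' i, f (W ω) (ξ i ω)) ∂P := by
    rw [hsum F hF]
    exact lintegral_congr fun ω => by simp only [F, ENNReal.tsum_mul_right]
  have h1 := tendsto_deriv_laplace (μ := Measure.count.prod P) (F := F)
    (V := fun a => V a.1 a.2) (v := fun n a => (n : ℝ≥0∞)⁻¹ * V a.1 a.2) hF (by rwa [hFtot])
    (fun n => hV'.const_mul _)
    (fun n ω => natCast_mul_inv_mul_le n _) (fun ω => tendsto_natCast_mul_inv_mul _)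
  let A : 𝕎 → ℝ≥0∞ := fun w => (∫⁻ p, g w p * expNeg (f w p) ∂η w) *
    expNeg (∫⁻ p, 1 - expNeg (f w p) ∂η w)
  have hA : Measurable A :=
    (measurable_lintegral_uncurry (f := fun w p => g w p * expNeg (f w p))
      (hg.fun_mul hf.expNeg)).mul
    (measurable_lintegral_uncurry (f := fun w p => 1 - expNeg (f w p))
      (measurable_const.fun_sub hf.expNeg)).expNeg
  have hG : ∀ n : ℕ, Measurable fun w =>
      ∫⁻ p, expNeg (f w p) * (1 - expNeg ((n : ℝ≥0∞)⁻¹ * g' w p)) ∂η w := fun n =>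
    measurable_lintegral_uncurry
      (f := fun w p => expNeg (f w p) * (1 - expNeg ((n : ℝ≥0∞)⁻¹ * g' w p)))
      (hf.expNeg.fun_mul (measurable_const.fun_sub (hg'.const_mul _).expNeg))
  have hmecke := h.mecke hf hg
  have h2 := tendsto_deriv_laplace (μ := P) (F := fun ω => A (W ω))
    (V := fun ω => ∫⁻ p, g' (W ω) p * expNeg (f (W ω) p) ∂η (W ω))
    (v := fun n ω => ∫⁻ p, expNeg (f (W ω) p) * (1 - expNeg ((n : ℝ≥0∞)⁻¹ * g' (W ω) p)) ∂η (W ω))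
    (hA.comp hW) (by rwa [← hmecke]) (fun n => (hG n).comp hW)
    (fun n ω => (tendsto_mul_lintegral_one_sub_expNeg (hfw _) (hgw' _)).2 n)
    (fun ω => (tendsto_mul_lintegral_one_sub_expNeg (hfw _) (hgw' _)).1)
  have h3 : ∀ᶠ n : ℕ in atTop, (n : ℝ≥0∞) * (∫⁻ ω, A (W ω) ∂P - ∫⁻ ω, A (W ω) * expNeg
      (∫⁻ p, expNeg (f (W ω) p) * (1 - expNeg ((n : ℝ≥0∞)⁻¹ * g' (W ω) p)) ∂η (W ω)) ∂P)
      = (n : ℝ≥0∞) * (∫⁻ a, F a ∂(Measure.count.prod P) -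
        ∫⁻ a, F a * expNeg ((n : ℝ≥0∞)⁻¹ * V a.1 a.2) ∂(Measure.count.prod P)) := by
    filter_upwards [eventually_gt_atTop 0] with n hn
    have hn' : (n : ℝ≥0∞)⁻¹ ≠ ⊤ := by simpa using hn.ne'
    have hne : ∀ w p, expNeg ((n : ℝ≥0∞)⁻¹ * g' w p) ≠ 0 := fun w p => by
      rw [Ne, expNeg_eq_zero]
      exact ENNReal.mul_ne_top hn' (hg'_fin w p)
    rw [hFtot, hmecke, hsum _ (hF.fun_mul (hV'.const_mul _).expNeg)]
    congr 2
    -- The factor `e^{g' / n}` put into `g` removes the contribution of the point `i` itself from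
    -- `e^{-∑ g' / n}`. What remains is `e^{-V i / n}`, whose derivative sees only distinct points.
    have h4 := h.mecke (f := fun w p => f w p + (n : ℝ≥0∞)⁻¹ * g' w p)
      (g := fun w p => g w p * (expNeg ((n : ℝ≥0∞)⁻¹ * g' w p))⁻¹) (hf.fun_add (hg'.const_mul _))
      (hg.fun_mul (hg'.const_mul _).expNeg.inv)
    simp_rw [expNeg_lintegral_add (v := fun w p => (n : ℝ≥0∞)⁻¹ * g' w p) hf] at h4
    have hcancel : ∀ a b c : ℝ≥0∞, ∀ w p, a * (expNeg ((n : ℝ≥0∞)⁻¹ * g' w p))⁻¹ *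
        (b * (expNeg ((n : ℝ≥0∞)⁻¹ * g' w p) * c)) = a * b * c := by
      intro a b c w p
      calc _ = a * b * c * ((expNeg ((n : ℝ≥0∞)⁻¹ * g' w p))⁻¹ *
            expNeg ((n : ℝ≥0∞)⁻¹ * g' w p)) := by ring
        _ = _ := by rw [ENNReal.inv_mul_cancel (hne w p) (expNeg_ne_top _), mul_one]
    have h5 : ∀ w p, g w p * (expNeg ((n : ℝ≥0∞)⁻¹ * g' w p))⁻¹ *
        expNeg (f w p + (n : ℝ≥0∞)⁻¹ * g' w p) = g w p * expNeg (f w p) := by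
      intro w p
      have := hcancel (g w p) (expNeg (f w p)) 1 w p
      rwa [mul_one, mul_one, ← expNeg_add] at this
    simp_rw [h5, ← mul_assoc] at h4
    rw [show ∫⁻ ω, A (W ω) * expNeg (∫⁻ p, expNeg (f (W ω) p) *
      (1 - expNeg ((n : ℝ≥0∞)⁻¹ * g' (W ω) p)) ∂η (W ω)) ∂P = _ from h4.symm]
    refine lintegral_congr fun ω => ?_
    rw [← ENNReal.tsum_mul_right]
    refine tsum_congr fun i => ?_
    rw [ENNReal.tsum_add, ENNReal.tsum_mul_left, hVsplit i ω, mul_add, expNeg_add, expNeg_add,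
      hcancel]
  have h6 := tendsto_nhds_unique h1 (h2.congr' h3)
  rw [hsum _ (hF.fun_mul hV')] at h6
  calc _ = ∫⁻ ω, ∑' i, F (i, ω) * V i ω ∂P := by
        refine lintegral_congr fun ω => ?_
        rw [← ENNReal.tsum_mul_right]
        refine tsum_congr fun i => ?_
        simp only [F, V]
        rw [mul_right_comm, ← ENNReal.tsum_mul_left]
        congr 1
        refine tsum_congr fun j => ?_
        split_ifs <;> simp
    _ = _ := h6
    _ = _ := lintegral_congr fun ω => by simp only [A]; ring

/-- Applied to `x = ∑ f`, it makes the first moments finite once `g` has been cut off at a multiple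
of `f`. -/
lemma mul_expNeg_le_one (x : ℝ≥0∞) : x * expNeg x ≤ 1 := by
  have h := le_one_sub_expNeg x
  rcases eq_or_ne x ⊤ with rfl | hx
  · simp
  lift x to ℝ≥0 using hx
  rw [← ENNReal.ofReal_coe_nnreal, expNeg_ofReal x.coe_nonneg, ← ENNReal.ofReal_mul x.coe_nonneg,
    ENNReal.ofReal_le_one, Real.exp_neg]
  rw [← div_eq_mul_inv, div_le_one (Real.exp_pos _)]
  linarith [Real.add_one_le_exp (x : ℝ)]

lemma tendsto_mul_of_monotone {a b : ℕ → ℝ≥0∞} (ha : Monotone a) (hb : Monotone b) :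
    Tendsto (fun n => a n * b n) atTop (𝓝 ((⨆ n, a n) * ⨆ n, b n)) := by
  have h : (⨆ n, a n) * ⨆ n, b n = ⨆ n, a n * b n := by
    refine le_antisymm ?_ (iSup_le fun n => mul_le_mul' (le_iSup a n) (le_iSup b n))
    simp_rw [ENNReal.iSup_mul, ENNReal.mul_iSup]
    exact iSup_le fun i => iSup_le fun j => le_iSup_of_le (max i j)
      (mul_le_mul' (ha (le_max_left i j)) (hb (le_max_right i j)))
  rw [h]
  exact tendsto_atTop_iSup (ha.mul' hb)

lemma iSup_min_natCast_mul {x y : ℝ≥0∞} (h : y = 0 → x = 0) : ⨆ n : ℕ, min x (n * y) = x := by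
  refine le_antisymm (iSup_le fun n => min_le_left _ _) ?_
  rcases eq_or_ne y 0 with hy | hy
  · simp [h hy]
  refine le_of_forall_lt fun c hc => ?_
  obtain ⟨n, hn⟩ := ENNReal.exists_nat_mul_gt hy (hc.trans_le le_top).ne
  exact lt_of_lt_of_le (lt_min hc hn) (le_iSup (fun n : ℕ => min x (n * y)) n)

lemma monotone_min_natCast_mul (x y : ℝ≥0∞) : Monotone fun n : ℕ => min x (n * y) :=
  fun i j hij => min_le_min le_rfl (by gcongr)

/-- The second-order Mecke formula for pairs of distinct points, weighted by an exponential
functional. -/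
lemma HasPoissonLaplace.mecke_pair (h : HasPoissonLaplace P W η ξ) [DecidableEq J]
    {f g g' : 𝕎 → E → ℝ≥0∞} (hf : Measurable (Function.uncurry f))
    (hg : Measurable (Function.uncurry g)) (hg' : Measurable (Function.uncurry g'))
    (hfg : ∀ w p, f w p = 0 → g w p = 0) :
    ∫⁻ ω, (∑' i, ∑' j, if i = j then 0 else g (W ω) (ξ i ω) * g' (W ω) (ξ j ω)) *
        expNeg (∑' i, f (W ω) (ξ i ω)) ∂P
      = ∫⁻ ω, (∫⁻ p, g (W ω) p * expNeg (f (W ω) p) ∂η (W ω)) *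
          (∫⁻ p, g' (W ω) p * expNeg (f (W ω) p) ∂η (W ω)) *
          expNeg (∫⁻ p, 1 - expNeg (f (W ω) p) ∂η (W ω)) ∂P := by
  have hW := h.measurable_background
  have hξ := h.measurable_point
  have hm : ∀ {f : 𝕎 → E → ℝ≥0∞} (i : J), Measurable (Function.uncurry f) →
    Measurable fun ω => f (W ω) (ξ i ω) := fun i hf => hf.comp (hW.prodMk (hξ i))
  have hK : ∀ {g : 𝕎 → E → ℝ≥0∞}, Measurable (Function.uncurry g) →
      Measurable fun ω => ∫⁻ p, g (W ω) p * expNeg (f (W ω) p) ∂η (W ω) := fun {g} hg =>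
    (measurable_lintegral_uncurry (f := fun w p => g w p * expNeg (f w p))
      (hg.fun_mul hf.expNeg)).comp hW
  -- The cut-off at `n f` bounds the first-order expression by `n`, and the cut-off at `n` makes the
  -- second function finite. As `g` vanishes where `f` does, both truncations increase to the
  -- original functions.
  let G : ℕ → 𝕎 → E → ℝ≥0∞ := fun n w p => min (g w p) (n * f w p)
  let G' : ℕ → 𝕎 → E → ℝ≥0∞ := fun n w p => min (g' w p) (n * 1)
  have hG : ∀ n, Measurable (Function.uncurry (G n)) := fun n => hg.min (hf.const_mul _)
  have hG' : ∀ n, Measurable (Function.uncurry (G' n)) := fun n => hg'.min measurable_const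
  have hGmono : ∀ w p, Monotone fun n => G n w p := fun w p => monotone_min_natCast_mul _ _
  have hGmono' : ∀ w p, Monotone fun n => G' n w p := fun w p => monotone_min_natCast_mul _ _
  have hGsup : ∀ w p, ⨆ n, G n w p = g w p := fun w p => iSup_min_natCast_mul (hfg w p)
  have hGsup' : ∀ w p, ⨆ n, G' n w p = g' w p := fun w p =>
    iSup_min_natCast_mul fun h => absurd h one_ne_zero
  have hfin : ∀ n, ∫⁻ ω, (∑' i, G n (W ω) (ξ i ω)) * expNeg (∑' i, f (W ω) (ξ i ω)) ∂P ≠ ⊤ := by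
    intro n
    refine ne_top_of_le_ne_top (b := ∫⁻ ω, (n : ℝ≥0∞) ∂P) (by simp) (lintegral_mono fun ω => ?_)
    calc _ ≤ (∑' i, (n : ℝ≥0∞) * f (W ω) (ξ i ω)) * expNeg (∑' i, f (W ω) (ξ i ω)) := by
          gcongr with i
          exact min_le_right _ _
      _ ≤ n := by
          rw [ENNReal.tsum_mul_left, mul_assoc]
          exact mul_le_of_le_one_right' (mul_expNeg_le_one _)
  have hn := fun n => h.mecke_pair_of_finite hf (hG n) (hG' n)
    (fun w p => ne_top_of_le_ne_top (by simp) (min_le_right _ _)) (hfin n)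
  have hint : ∀ {g : 𝕎 → E → ℝ≥0∞} {G : ℕ → 𝕎 → E → ℝ≥0∞}
      (_ : ∀ n, Measurable (Function.uncurry (G n))) (_ : ∀ w p, Monotone fun n => G n w p)
      (_ : ∀ w p, ⨆ n, G n w p = g w p) (w : 𝕎),
      Monotone (fun n => ∫⁻ p, G n w p * expNeg (f w p) ∂η w) ∧
      ⨆ n, ∫⁻ p, G n w p * expNeg (f w p) ∂η w = ∫⁻ p, g w p * expNeg (f w p) ∂η w := by
    intro g G hG hmono hsup w
    have hmono' : Monotone fun n p => G n w p * expNeg (f w p) := fun i j hij p =>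
      mul_le_mul_left (hmono w p hij) _
    refine ⟨fun i j hij => lintegral_mono (hmono' hij), ?_⟩
    have hGw : ∀ n, Measurable (G n w) := fun n => (hG n).comp measurable_prodMk_left
    have hfw : Measurable (f w) := hf.comp measurable_prodMk_left
    rw [← lintegral_iSup (fun n => (hGw n).fun_mul hfw.expNeg) hmono']
    simp_rw [← ENNReal.iSup_mul, hsup]
  have hL : Tendsto (fun n => ∫⁻ ω, (∑' i, ∑' j, if i = j then 0 else
      G n (W ω) (ξ i ω) * G' n (W ω) (ξ j ω)) * expNeg (∑' i, f (W ω) (ξ i ω)) ∂P) atTop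
      (𝓝 (∫⁻ ω, (∑' i, ∑' j, if i = j then 0 else g (W ω) (ξ i ω) * g' (W ω) (ξ j ω)) *
        expNeg (∑' i, f (W ω) (ξ i ω)) ∂P)) := by
    have hterm : ∀ ω i j, Monotone fun n => if i = j then 0 else
        G n (W ω) (ξ i ω) * G' n (W ω) (ξ j ω) := by
      intro ω i j m n hmn
      dsimp only
      split_ifs
      · exact le_rfl
      · exact mul_le_mul' (hGmono _ _ hmn) (hGmono' _ _ hmn)
    refine lintegral_tendsto_of_tendsto_of_monotone (fun n => ?_)
      (Eventually.of_forall fun ω m n hmn => ?_) (Eventually.of_forall fun ω => ?_)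
    · refine Measurable.aemeasurable (Measurable.fun_mul (Measurable.tsum fun i =>
        Measurable.tsum fun j => ?_) (Measurable.tsum fun i => hm i hf).expNeg)
      split_ifs
      · exact measurable_const
      · exact (hm i (hG n)).fun_mul (hm j (hG' n))
    · dsimp only
      gcongr ?_ * _
      exact ENNReal.tsum_le_tsum fun i => ENNReal.tsum_le_tsum fun j => hterm ω i j hmn
    · refine ENNReal.Tendsto.mul_const ?_ (Or.inr (expNeg_ne_top _))
      let _ : MeasurableSpace J := ⊤
      simp_rw [← lintegral_count]
      refine lintegral_tendsto_of_tendsto_of_monotone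
        (fun n => measurable_from_top.aemeasurable)
        (Eventually.of_forall fun i m n hmn => lintegral_mono fun j => hterm ω i j hmn)
        (Eventually.of_forall fun i => ?_)
      refine lintegral_tendsto_of_tendsto_of_monotone
        (fun n => measurable_from_top.aemeasurable)
        (Eventually.of_forall fun j m n hmn => hterm ω i j hmn)
        (Eventually.of_forall fun j => ?_)
      split_ifs
      · exact tendsto_const_nhds
      · have := tendsto_mul_of_monotone (hGmono (W ω) (ξ i ω)) (hGmono' (W ω) (ξ j ω))
        rwa [hGsup, hGsup'] at this
  refine tendsto_nhds_unique hL ?_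
  simp_rw [hn]
  have h1 := hint hG hGmono hGsup
  have h2 := hint hG' hGmono' hGsup'
  refine lintegral_tendsto_of_tendsto_of_monotone (fun n => ?_)
    (Eventually.of_forall fun ω m n hmn => ?_) (Eventually.of_forall fun ω => ?_)
  · exact (((hK (hG n)).fun_mul (hK (hG' n))).fun_mul ((measurable_lintegral_uncurry
      (f := fun w p => 1 - expNeg (f w p))
      (measurable_const.fun_sub hf.expNeg)).comp hW).expNeg).aemeasurable
  · exact mul_le_mul_left (mul_le_mul' ((h1 (W ω)).1 hmn) ((h2 (W ω)).1 hmn)) _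
  · refine ENNReal.Tendsto.mul_const ?_ (Or.inr (expNeg_ne_top _))
    have := tendsto_mul_of_monotone (h1 (W ω)).1 (h2 (W ω)).1
    rwa [(h1 (W ω)).2, (h2 (W ω)).2] at this

end mecke

/-! ### Integrating out one level of the cascade -/

section onelevel

variable {Ω 𝕎 𝒴 I : Type*} [MeasurableSpace Ω] [MeasurableSpace 𝕎] [MeasurableSpace 𝒴]
  [MeasurableSpace I] [Countable I] [MeasurableSingletonClass I] {P : Measure Ω}
  [IsProbabilityMeasure P] {W : Ω → 𝕎} {κ : I → Kernel 𝕎 𝒴} [∀ q, IsMarkovKernel (κ q)]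
  {u : I → ℕ → Ω → ℝ} {z : I → ℕ → Ω → 𝒴} {s θ : ℝ} {c f f' : I → 𝕎 → 𝒴 → ℝ≥0∞}

/-- The weight `x ^ θ * c` of a point of a marked level. -/
noncomputable def pointWeight (θ : ℝ) (c : I → 𝕎 → 𝒴 → ℝ≥0∞) (w : 𝕎) (p : I × ℝ × 𝒴) : ℝ≥0∞ :=
  ENNReal.ofReal p.2.1 ^ θ * c p.1 w p.2.2

/-- The sum `∑_q ∫ c_q ^ ρ f_q dκ_q` that replaces `∑ a f` when a level is integrated out. -/
noncomputable def parentSum (κ : I → Kernel 𝕎 𝒴) (ρ : ℝ) (c f : I → 𝕎 → 𝒴 → ℝ≥0∞) (w : 𝕎) :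
    ℝ≥0∞ := ∑' q, ∫⁻ y, c q w y ^ ρ * f q w y ∂κ q w

lemma measurable_uncurry_of_countable {𝒵 : Type*} [MeasurableSpace 𝒵] {F : 𝕎 → I × 𝒵 → ℝ≥0∞}
    (hF : ∀ q, Measurable fun p : 𝕎 × 𝒵 => F p.1 (q, p.2)) : Measurable (Function.uncurry F) := by
  have h : Measurable fun p : I × 𝕎 × 𝒵 => F p.2.1 (p.1, p.2.2) :=
    measurable_from_prod_countable_right hF
  exact h.comp (by fun_prop : Measurable fun p : 𝕎 × I × 𝒵 => (p.2.1, p.1, p.2.2))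

lemma measurable_mark_fun (hf : ∀ q, Measurable (Function.uncurry (f q))) :
    Measurable (Function.uncurry fun w (p : I × ℝ × 𝒴) => f p.1 w p.2.2) :=
  measurable_uncurry_of_countable fun q =>
    (hf q).comp (by fun_prop : Measurable fun p : 𝕎 × ℝ × 𝒴 => (p.1, p.2.2))

lemma measurable_pointWeight (hc : ∀ q, Measurable (Function.uncurry (c q))) :
    Measurable (Function.uncurry (pointWeight θ c)) :=
  Measurable.fun_mul (by fun_prop) (measurable_mark_fun hc)

lemma lintegral_pointWeight_pow (hs : 0 < s) (hsθ : s < θ)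
    (hc : ∀ q, Measurable (Function.uncurry (c q))) (hc_fin : ∀ q w y, c q w y ≠ ⊤)
    (hf : ∀ q, Measurable (Function.uncurry (f q))) {n : ℕ} (hn : n ≠ 0) {t : ℝ} (ht : 0 < t)
    (w : 𝕎) :
    ∫⁻ p, pointWeight θ c w p ^ n * f p.1 w p.2.2 *
        expNeg (ENNReal.ofReal t * pointWeight θ c w p) ∂levelIntensity (stableIntensity s) κ w
      = ENNReal.ofReal (Real.Gamma (n - s / θ) / θ) * ENNReal.ofReal t ^ (s / θ - n) *
        parentSum κ (s / θ) c f w := by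
  have hcw : ∀ q, Measurable (c q w) := fun q => (hc q).comp measurable_prodMk_left
  have hfw : ∀ q, Measurable (f q w) := fun q => (hf q).comp measurable_prodMk_left
  have hm : Measurable (pointWeight θ c w) :=
    (measurable_pointWeight hc).comp measurable_prodMk_left
  have hmf : Measurable fun p : I × ℝ × 𝒴 => f p.1 w p.2.2 :=
    (measurable_mark_fun hf).comp measurable_prodMk_left
  rw [lintegral_levelIntensity, parentSum, ← ENNReal.tsum_mul_left]
  · refine tsum_congr fun q => ?_
    rw [← lintegral_const_mul _ (by fun_prop)]
    refine lintegral_congr fun y => ?_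
    simp only [pointWeight]
    rw [← mul_assoc, ← lintegral_stable_pow hs hsθ hn (hc_fin q w y) ht,
      ← lintegral_mul_const _ (by fun_prop)]
    exact lintegral_congr fun x => by ring
  · exact ((hm.pow_const n).fun_mul hmf).fun_mul (hm.const_mul _).expNeg

lemma lintegral_one_sub_expNeg_pointWeight (hs : 0 < s) (hsθ : s < θ)
    (hc : ∀ q, Measurable (Function.uncurry (c q))) (hc_fin : ∀ q w y, c q w y ≠ ⊤)
    {t : ℝ} (ht : 0 < t) (w : 𝕎) :
    ∫⁻ p, 1 - expNeg (ENNReal.ofReal t * pointWeight θ c w p)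
        ∂levelIntensity (stableIntensity s) κ w
      = ENNReal.ofReal (Real.Gamma (1 - s / θ) / s) * ENNReal.ofReal t ^ (s / θ) *
        parentSum κ (s / θ) c (fun _ _ _ => 1) w := by
  have hcw : ∀ q, Measurable (c q w) := fun q => (hc q).comp measurable_prodMk_left
  have hm : Measurable (pointWeight θ c w) :=
    (measurable_pointWeight hc).comp measurable_prodMk_left
  rw [lintegral_levelIntensity, parentSum, ← ENNReal.tsum_mul_left]
  · refine tsum_congr fun q => ?_
    rw [← lintegral_const_mul _ (by fun_prop)]
    refine lintegral_congr fun y => ?_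
    simp only [pointWeight]
    rw [lintegral_stable_one_sub_expNeg hs hsθ (hc_fin q w y) ht, mul_one]
  · exact measurable_const.fun_sub (hm.const_mul _).expNeg

lemma measurable_parentTerm {ρ : ℝ} (hc : ∀ q, Measurable (Function.uncurry (c q)))
    (hf : ∀ q, Measurable (Function.uncurry (f q))) (q : I) :
    Measurable fun w => ∫⁻ y, c q w y ^ ρ * f q w y ∂κ q w :=
  Measurable.lintegral_kernel_prod_right' (f := fun p : 𝕎 × 𝒴 => c q p.1 p.2 ^ ρ * f q p.1 p.2)
    (((hc q).pow_const ρ).fun_mul (hf q))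

lemma measurable_parentSum {ρ : ℝ} (hc : ∀ q, Measurable (Function.uncurry (c q)))
    (hf : ∀ q, Measurable (Function.uncurry (f q))) : Measurable (parentSum κ ρ c f) :=
  Measurable.tsum fun q => measurable_parentTerm hc hf q

/-- Pointwise version of Tonelli's theorem used to integrate over the auxiliary parameter `t`. -/
lemma lintegral_of_forall_laplace {A B S : Ω → ℝ≥0∞} (hA : Measurable A) (hB : Measurable B)
    (hS : Measurable S) {T : Ω → ℝ≥0∞} (hT : Measurable T) {h k : ℝ → ℝ≥0∞} {H : ℝ → ℝ≥0∞}
    (hh : Measurable h) (hk : Measurable k) (hH : Measurable H)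
    {r r' : ℝ≥0∞ → ℝ≥0∞}
    (hr : ∀ S, ∫⁻ t in Set.Ioi (0 : ℝ), h t * expNeg (ENNReal.ofReal t * S) = r S)
    (hr' : ∀ S, ∫⁻ t in Set.Ioi (0 : ℝ), k t * expNeg (H t * S) = r' S)
    (heq : ∀ t, 0 < t → h t * ∫⁻ ω, A ω * expNeg (ENNReal.ofReal t * S ω) ∂P
      = k t * ∫⁻ ω, B ω * expNeg (H t * T ω) ∂P) :
    ∫⁻ ω, A ω * r (S ω) ∂P = ∫⁻ ω, B ω * r' (T ω) ∂P := by
  have key : ∀ {A S : Ω → ℝ≥0∞} {h H : ℝ → ℝ≥0∞} {r : ℝ≥0∞ → ℝ≥0∞}, Measurable A →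
      Measurable S → Measurable h → Measurable H →
      (∀ S, ∫⁻ t in Set.Ioi (0 : ℝ), h t * expNeg (H t * S) = r S) →
      ∫⁻ ω, A ω * r (S ω) ∂P
        = ∫⁻ t in Set.Ioi (0 : ℝ), (h t * ∫⁻ ω, A ω * expNeg (H t * S ω) ∂P) := by
    intro A S h H r hA hS hh hH hr
    simp_rw [← hr]
    calc _ = ∫⁻ ω, (∫⁻ t in Set.Ioi (0 : ℝ), h t * (A ω * expNeg (H t * S ω))) ∂P := by
          refine lintegral_congr fun ω => ?_
          rw [← lintegral_const_mul _ (by fun_prop)]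
          exact lintegral_congr fun t => by ring
      _ = _ := by
          rw [lintegral_lintegral_swap (by fun_prop)]
          refine lintegral_congr fun t => ?_
          rw [lintegral_const_mul _ (by fun_prop)]
  rw [key hA hS hh ENNReal.measurable_ofReal hr, key hB hT hk hH hr']
  exact setLIntegral_congr_fun measurableSet_Ioi fun t ht => heq t ht

variable (h : IsMarkedLevel P (stableIntensity s) W κ u z)
include h

lemma IsMarkedLevel.measurable_weight (hc : ∀ q, Measurable (Function.uncurry (c q)))
    (i : I × ℕ) : Measurable fun ω => pointWeight θ c (W ω) (i.1, u i.1 i.2 ω, z i.1 i.2 ω) :=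
  (measurable_pointWeight hc).comp
    (h.measurable_background.prodMk (h.hasPoissonLaplace.measurable_point i))

lemma IsMarkedLevel.measurable_mark_fun (hf : ∀ q, Measurable (Function.uncurry (f q)))
    (i : I × ℕ) : Measurable fun ω => f i.1 (W ω) (z i.1 i.2 ω) :=
  (hf i.1).comp (h.measurable_background.prodMk (h.marks.measurable_mark i))

/-- With `ρ = s / θ` and `D = Γ(1 - ρ) / s`, Mecke's formula turns the numerator into `D ρ t ^ (ρ -
1) * parentSum` and the exponential into `exp (-D t ^ ρ * parentSum)`. The first is the derivative
in `t` of the exponent up to the test function, so integration over `t` returns a quotient without a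
constant. -/
lemma IsMarkedLevel.lintegral_div (hs : 0 < s) (hsθ : s < θ)
    (hc : ∀ q, Measurable (Function.uncurry (c q))) (hc_fin : ∀ q w y, c q w y ≠ ⊤)
    (hf : ∀ q, Measurable (Function.uncurry (f q))) :
    ∫⁻ ω, (∑' i : I × ℕ, pointWeight θ c (W ω) (i.1, u i.1 i.2 ω, z i.1 i.2 ω) *
        f i.1 (W ω) (z i.1 i.2 ω)) /
        (∑' i : I × ℕ, pointWeight θ c (W ω) (i.1, u i.1 i.2 ω, z i.1 i.2 ω)) ∂P
      = ∫⁻ ω, parentSum κ (s / θ) c f (W ω) / parentSum κ (s / θ) c (fun _ _ _ => 1) (W ω) ∂P := by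
  have hθ : 0 < θ := hs.trans hsθ
  have hG : 0 < Real.Gamma (1 - s / θ) :=
    Real.Gamma_pos_of_pos (by rw [sub_pos, div_lt_one hθ]; exact hsθ)
  have hW := h.measurable_background
  simp_rw [div_eq_mul_inv]
  refine lintegral_of_forall_laplace (h := fun _ => 1)
    (k := fun t => ENNReal.ofReal (Real.Gamma (1 - s / θ) / s * (s / θ)) *
      ENNReal.ofReal t ^ (s / θ - 1))
    (H := fun t => ENNReal.ofReal (Real.Gamma (1 - s / θ) / s) * ENNReal.ofReal t ^ (s / θ))
    (r := fun S => S⁻¹) (r' := fun S => S⁻¹)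
    (Measurable.tsum fun i => (h.measurable_weight hc i).fun_mul (h.measurable_mark_fun hf i))
    ((measurable_parentSum hc hf).comp hW)
    (Measurable.tsum fun i => h.measurable_weight hc i)
    ((measurable_parentSum hc fun _ => measurable_const).comp hW)
    (by fun_prop) (by fun_prop) (by fun_prop) (fun S => by simpa using lintegral_expNeg_mul S)
    (fun S => lintegral_stable_first (by positivity) (by positivity) S) fun t ht => ?_
  have hM := h.hasPoissonLaplace.mecke
    (f := fun w p => ENNReal.ofReal t * pointWeight θ c w p)
    (g := fun w p => pointWeight θ c w p * f p.1 w p.2.2)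
    ((measurable_pointWeight hc).const_mul _)
    ((measurable_pointWeight hc).fun_mul (Cascade.measurable_mark_fun hf))
  have h1 := fun w => lintegral_pointWeight_pow (κ := κ) hs hsθ hc hc_fin hf one_ne_zero ht w
  simp only [pow_one, Nat.cast_one] at h1
  have h2 := fun w => lintegral_one_sub_expNeg_pointWeight (κ := κ) hs hsθ hc hc_fin ht w
  simp only [h1, h2, ENNReal.tsum_mul_left] at hM
  rw [one_mul, hM, ← lintegral_const_mul]
  · refine lintegral_congr fun ω => ?_
    rw [show Real.Gamma (1 - s / θ) / s * (s / θ) = Real.Gamma (1 - s / θ) / θ by field_simp]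
    simp only [Function.comp_apply]
    ring_nf
  · exact ((measurable_parentSum hc hf).comp hW).fun_mul
      (((measurable_parentSum hc fun _ => measurable_const).comp hW).const_mul _).expNeg

/-- One point still carries the whole numerator, now with a squared weight. The Gamma factor becomes
`Γ(2 - ρ) = (1 - ρ) Γ(1 - ρ)`, and the weight `t` of `(S ^ 2)⁻¹` turns `t ^ (ρ - 2)` into `t ^ (ρ -
1)`; apart from `1 - ρ` the computation is the first-order one. -/
lemma IsMarkedLevel.lintegral_sq_div (hs : 0 < s) (hsθ : s < θ)
    (hc : ∀ q, Measurable (Function.uncurry (c q))) (hc_fin : ∀ q w y, c q w y ≠ ⊤)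
    (hf : ∀ q, Measurable (Function.uncurry (f q))) :
    ∫⁻ ω, (∑' i : I × ℕ, pointWeight θ c (W ω) (i.1, u i.1 i.2 ω, z i.1 i.2 ω) ^ 2 *
        f i.1 (W ω) (z i.1 i.2 ω)) /
        (∑' i : I × ℕ, pointWeight θ c (W ω) (i.1, u i.1 i.2 ω, z i.1 i.2 ω)) ^ 2 ∂P
      = ENNReal.ofReal (1 - s / θ) *
        ∫⁻ ω, parentSum κ (s / θ) c f (W ω) / parentSum κ (s / θ) c (fun _ _ _ => 1) (W ω) ∂P := by
  have hθ : 0 < θ := hs.trans hsθ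
  have hρ : 0 < 1 - s / θ := by rw [sub_pos, div_lt_one hθ]; exact hsθ
  have hG : 0 < Real.Gamma (1 - s / θ) := Real.Gamma_pos_of_pos hρ
  have hW := h.measurable_background
  have hPS : Measurable fun ω => parentSum κ (s / θ) c f (W ω) :=
    (measurable_parentSum hc hf).comp hW
  have hPS1 : Measurable fun ω => parentSum κ (s / θ) c (fun _ _ _ => 1) (W ω) :=
    (measurable_parentSum hc fun _ => measurable_const).comp hW
  simp_rw [div_eq_mul_inv _ (parentSum _ _ _ _ _), div_eq_mul_inv _ (_ ^ 2)]
  have hm : Measurable fun ω => parentSum κ (s / θ) c f (W ω) *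
    (parentSum κ (s / θ) c (fun _ _ _ => 1) (W ω))⁻¹ := hPS.fun_mul hPS1.inv
  rw [← lintegral_const_mul _ hm]
  simp_rw [← mul_assoc (ENNReal.ofReal (1 - s / θ))]
  refine lintegral_of_forall_laplace (h := fun t => ENNReal.ofReal t)
    (k := fun t => ENNReal.ofReal (Real.Gamma (1 - s / θ) / s * (s / θ)) *
      ENNReal.ofReal t ^ (s / θ - 1))
    (H := fun t => ENNReal.ofReal (Real.Gamma (1 - s / θ) / s) * ENNReal.ofReal t ^ (s / θ))
    (r := fun S => (S ^ 2)⁻¹) (r' := fun S => S⁻¹)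
    (Measurable.tsum fun i =>
      ((h.measurable_weight hc i).pow_const 2).fun_mul (h.measurable_mark_fun hf i))
    (hPS.const_mul _) (Measurable.tsum fun i => h.measurable_weight hc i) hPS1
    (by fun_prop) (by fun_prop) (by fun_prop) lintegral_mul_expNeg_mul
    (fun S => lintegral_stable_first (by positivity) (by positivity) S) fun t ht => ?_
  have hM := h.hasPoissonLaplace.mecke
    (f := fun w p => ENNReal.ofReal t * pointWeight θ c w p)
    (g := fun w p => pointWeight θ c w p ^ 2 * f p.1 w p.2.2)
    ((measurable_pointWeight hc).const_mul _)
    (((measurable_pointWeight hc).pow_const 2).fun_mul (Cascade.measurable_mark_fun hf))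
  have h1 := fun w => lintegral_pointWeight_pow (κ := κ) hs hsθ hc hc_fin hf two_ne_zero ht w
  have h2 := fun w => lintegral_one_sub_expNeg_pointWeight (κ := κ) hs hsθ hc hc_fin ht w
  simp only [h1, h2, ENNReal.tsum_mul_left] at hM
  rw [hM, ← lintegral_const_mul, ← lintegral_const_mul]
  · refine lintegral_congr fun ω => ?_
    have hT : ENNReal.ofReal t * ENNReal.ofReal t ^ (s / θ - (2 : ℕ))
        = ENNReal.ofReal t ^ (s / θ - 1) := by
      nth_rewrite 1 [← ENNReal.rpow_one (ENNReal.ofReal t)]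
      rw [← ENNReal.rpow_add _ _ (by simpa using ht) ENNReal.ofReal_ne_top]
      congr 1; push_cast; ring
    have hC : ENNReal.ofReal (Real.Gamma ((2 : ℕ) - s / θ) / θ)
        = ENNReal.ofReal (Real.Gamma (1 - s / θ) / s * (s / θ)) * ENNReal.ofReal (1 - s / θ) := by
      rw [← ENNReal.ofReal_mul (by positivity)]
      congr 1
      rw [show (((2 : ℕ) : ℝ) - s / θ) = (1 - s / θ) + 1 by push_cast; ring,
        Real.Gamma_add_one hρ.ne']
      field_simp
    rw [hC, ← hT]
    ring
  · exact (hPS.const_mul _).fun_mul (hPS1.const_mul _).expNeg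
  · exact (hPS.const_mul _).fun_mul (hPS1.const_mul _).expNeg

/-- The second-order Mecke formula gives the square of the first-order coefficient, and its integral
against `t` produces `ρ`. The parents are fixed here so that any relation between them can be
imposed afterwards by summation. -/
lemma IsMarkedLevel.lintegral_pair_div (hs : 0 < s) (hsθ : s < θ) [DecidableEq I]
    (hc : ∀ q, Measurable (Function.uncurry (c q))) (hc_fin : ∀ q w y, c q w y ≠ ⊤)
    (hf : ∀ q, Measurable (Function.uncurry (f q)))
    (hf' : ∀ q, Measurable (Function.uncurry (f' q))) (q q' : I) :
    ∫⁻ ω, (∑' n : ℕ, ∑' n' : ℕ, if (q, n) = (q', n') then 0 else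
        (pointWeight θ c (W ω) (q, u q n ω, z q n ω) * f q (W ω) (z q n ω)) *
        (pointWeight θ c (W ω) (q', u q' n' ω, z q' n' ω) * f' q' (W ω) (z q' n' ω))) /
        (∑' i : I × ℕ, pointWeight θ c (W ω) (i.1, u i.1 i.2 ω, z i.1 i.2 ω)) ^ 2 ∂P
      = ENNReal.ofReal (s / θ) *
        ∫⁻ ω, ((∫⁻ y, c q (W ω) y ^ (s / θ) * f q (W ω) y ∂κ q (W ω)) *
          ∫⁻ y, c q' (W ω) y ^ (s / θ) * f' q' (W ω) y ∂κ q' (W ω)) /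
          parentSum κ (s / θ) c (fun _ _ _ => 1) (W ω) ^ 2 ∂P := by
  have hθ : 0 < θ := hs.trans hsθ
  have hρ : 0 < 1 - s / θ := by rw [sub_pos, div_lt_one hθ]; exact hsθ
  have hG : 0 < Real.Gamma (1 - s / θ) := Real.Gamma_pos_of_pos hρ
  have hW := h.measurable_background
  -- localize the test functions at the two parents
  let loc : (I → 𝕎 → 𝒴 → ℝ≥0∞) → I → I → 𝕎 → 𝒴 → ℝ≥0∞ :=
    fun f q q₁ w y => if q₁ = q then f q₁ w y else 0
  have hloc : ∀ {f : I → 𝕎 → 𝒴 → ℝ≥0∞} (q : I), (∀ q, Measurable (Function.uncurry (f q))) →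
      ∀ q₁, Measurable (Function.uncurry (loc f q q₁)) := by
    intro f q hf q₁
    by_cases hq : q₁ = q
    · simpa [loc, hq] using hf q
    · simp [loc, hq, Function.uncurry_def]
  have hlocPS : ∀ (f : I → 𝕎 → 𝒴 → ℝ≥0∞) (q : I) (w : 𝕎), parentSum κ (s / θ) c (loc f q) w
      = ∫⁻ y, c q w y ^ (s / θ) * f q w y ∂κ q w := by
    intro f q w
    rw [parentSum, tsum_eq_single q]
    · simp [loc]
    · intro q₁ hq₁
      simp [loc, hq₁]
  have hlocsum : ∀ ω, (∑' n : ℕ, ∑' n' : ℕ, if (q, n) = (q', n') then 0 else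
        (pointWeight θ c (W ω) (q, u q n ω, z q n ω) * f q (W ω) (z q n ω)) *
        (pointWeight θ c (W ω) (q', u q' n' ω, z q' n' ω) * f' q' (W ω) (z q' n' ω)))
      = ∑' i : I × ℕ, ∑' j : I × ℕ, if i = j then 0 else
        (pointWeight θ c (W ω) (i.1, u i.1 i.2 ω, z i.1 i.2 ω) *
          loc f q i.1 (W ω) (z i.1 i.2 ω)) *
        (pointWeight θ c (W ω) (j.1, u j.1 j.2 ω, z j.1 j.2 ω) *
          loc f' q' j.1 (W ω) (z j.1 j.2 ω)) := by
    intro ω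
    rw [ENNReal.tsum_prod', tsum_eq_single q]
    · refine tsum_congr fun n => ?_
      rw [ENNReal.tsum_prod', tsum_eq_single q']
      · simp [loc]
      · intro q₁ hq₁
        simp [loc, hq₁]
    · intro q₁ hq₁
      simp [loc, hq₁]
  have hPS : ∀ {f : I → 𝕎 → 𝒴 → ℝ≥0∞}, (∀ q, Measurable (Function.uncurry (f q))) →
      Measurable fun ω => parentSum κ (s / θ) c f (W ω) :=
    fun hf => (measurable_parentSum hc hf).comp hW
  have hPS1 : Measurable fun ω => parentSum κ (s / θ) c (fun _ _ _ => 1) (W ω) :=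
    hPS fun _ => measurable_const
  simp_rw [hlocsum, ← hlocPS]
  have hPP : Measurable fun ω => parentSum κ (s / θ) c (loc f q) (W ω) *
      parentSum κ (s / θ) c (loc f' q') (W ω) := (hPS (hloc q hf)).fun_mul (hPS (hloc q' hf'))
  have hm : Measurable fun ω => parentSum κ (s / θ) c (loc f q) (W ω) *
      parentSum κ (s / θ) c (loc f' q') (W ω) /
      parentSum κ (s / θ) c (fun _ _ _ => 1) (W ω) ^ 2 := hPP.div (hPS1.pow_const 2)
  rw [← lintegral_const_mul _ hm]
  simp_rw [div_eq_mul_inv _ (_ ^ 2), mul_left_comm (ENNReal.ofReal (s / θ))]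
  refine lintegral_of_forall_laplace (h := fun t => ENNReal.ofReal t)
    (k := fun t => ENNReal.ofReal t * (ENNReal.ofReal (Real.Gamma (1 - s / θ) / s * (s / θ)) *
      ENNReal.ofReal t ^ (s / θ - 1)) ^ 2)
    (H := fun t => ENNReal.ofReal (Real.Gamma (1 - s / θ) / s) * ENNReal.ofReal t ^ (s / θ))
    (r := fun S => (S ^ 2)⁻¹) (r' := fun S => ENNReal.ofReal (s / θ) * (S ^ 2)⁻¹)
    (Measurable.tsum fun i => Measurable.tsum fun j => ?_)
    hPP (Measurable.tsum fun i => h.measurable_weight hc i) hPS1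
    (by fun_prop) (by fun_prop) (by fun_prop) lintegral_mul_expNeg_mul
    (fun S => lintegral_stable_second (by positivity) (by positivity) S) fun t ht => ?_
  · split_ifs
    · exact measurable_const
    · exact ((h.measurable_weight hc i).fun_mul (h.measurable_mark_fun (hloc q hf) i)).fun_mul
        ((h.measurable_weight hc j).fun_mul (h.measurable_mark_fun (hloc q' hf') j))
  have hM := h.hasPoissonLaplace.mecke_pair
    (f := fun w p => ENNReal.ofReal t * pointWeight θ c w p)
    (g := fun w p => pointWeight θ c w p * loc f q p.1 w p.2.2)
    (g' := fun w p => pointWeight θ c w p * loc f' q' p.1 w p.2.2)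
    ((measurable_pointWeight hc).const_mul _)
    ((measurable_pointWeight hc).fun_mul (Cascade.measurable_mark_fun (hloc q hf)))
    ((measurable_pointWeight hc).fun_mul (Cascade.measurable_mark_fun (hloc q' hf')))
    (fun w p hp => by
      rcases mul_eq_zero.1 hp with h0 | h0
      · simp [not_le.2 ht] at h0
      · simp [h0])
  have h1 := fun w => lintegral_pointWeight_pow (κ := κ) hs hsθ hc hc_fin (hloc q hf)
    one_ne_zero ht w
  have h1' := fun w => lintegral_pointWeight_pow (κ := κ) hs hsθ hc hc_fin (hloc q' hf')
    one_ne_zero ht w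
  simp only [pow_one, Nat.cast_one] at h1 h1'
  have h2 := fun w => lintegral_one_sub_expNeg_pointWeight (κ := κ) hs hsθ hc hc_fin ht w
  simp only [h1, h1', h2, ENNReal.tsum_mul_left] at hM
  rw [hM, ← lintegral_const_mul, ← lintegral_const_mul]
  · refine lintegral_congr fun ω => ?_
    rw [show Real.Gamma (1 - s / θ) / s * (s / θ) = Real.Gamma (1 - s / θ) / θ by field_simp]
    ring
  · exact hPP.fun_mul (hPS1.const_mul _).expNeg
  · exact (((hPS (hloc q hf)).const_mul _).fun_mul ((hPS (hloc q' hf')).const_mul _)).fun_mul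
      (hPS1.const_mul _).expNeg

end onelevel

/-! ### Exponents, averaged functions and densities -/

section levels

variable {k : ℕ} {m : Fin (k + 1) → ℝ}

/-- The exponent `m_{j+1}` for `j < k`, and `1` for `j = k`. -/
noncomputable def theta (m : Fin (k + 1) → ℝ) (j : Fin (k + 1)) : ℝ :=
  Fin.lastCases (motive := fun _ => ℝ) 1 (fun l => m l.succ) j

@[simp] lemma theta_last (m : Fin (k + 1) → ℝ) : theta m (Fin.last k) = 1 := by simp [theta]

@[simp] lemma theta_castSucc (m : Fin (k + 1) → ℝ) (l : Fin k) : theta m l.castSucc = m l.succ := by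
  simp [theta]

/-- Makes every ratio `ρ` less than `1`, as the stable integrals require; at the last level this is
the condition `m_k < 1`. -/
lemma theta_castSucc_lt_succ (hm : StrictMono m) (hm1 : m (Fin.last k) < 1) (l : Fin k) :
    theta m l.castSucc < theta m l.succ := by
  rw [theta_castSucc]
  rcases Fin.eq_castSucc_or_eq_last l.succ with ⟨j, hj⟩ | hj
  · rw [hj, theta_castSucc]
    exact hm (by rw [Fin.castSucc_lt_succ_iff])
  · rw [hj, theta_last]; exact hm1

lemma apply_succ_pos (hm0 : m 0 = 0) (hm : StrictMono m) (l : Fin k) : 0 < m l.succ := by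
  rw [← hm0]; exact hm (Fin.succ_pos l)

variable {𝒳 : Fin k → Type*} [∀ l, MeasurableSpace (𝒳 l)]
  {ν : (l : Fin k) → Kernel ((i : Set.Iio l) → 𝒳 i) (𝒳 l)} {X : (∀ l, 𝒳 l) → ℝ}

lemma levelFun_last : levelFun m ν X (Fin.last k) = X := by simp [levelFun]

lemma levelFun_castSucc (l : Fin k) (x : ∀ l, 𝒳 l) : levelFun m ν X l.castSucc x
    = 1 / m l.succ * Real.log (∫ y, Real.exp (m l.succ *
      levelFun m ν X l.succ (Function.update x l y)) ∂ν l (fun i => x i)) := by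
  simp [levelFun]

/-- The coordinates of the levels before `j`. -/
def before (j : Fin (k + 1)) : Set (Fin k) := {i | i.castSucc < j}

@[simp] lemma mem_before {j : Fin (k + 1)} {i : Fin k} : i ∈ before j ↔ i.castSucc < j := Iff.rfl

lemma mem_before_castSucc {l i : Fin k} : i ∈ before l.castSucc ↔ i < l := by simp

lemma mem_before_succ {l i : Fin k} : i ∈ before l.succ ↔ i ≤ l := by
  simp [Fin.castSucc_lt_succ_iff]

/-- Integration of the coordinate `l` with respect to `ν l`. -/
noncomputable def levelOp (ν : (l : Fin k) → Kernel ((i : Set.Iio l) → 𝒳 i) (𝒳 l)) (l : Fin k)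
    (F : (∀ l, 𝒳 l) → ℝ≥0∞) (x : ∀ l, 𝒳 l) : ℝ≥0∞ :=
  ∫⁻ y, F (Function.update x l y) ∂ν l (fun i => x i)

lemma update_congr_before {l : Fin k} {x x' : ∀ l, 𝒳 l} (h : ∀ i ∈ before l.castSucc, x i = x' i)
    (y : 𝒳 l) : ∀ i ∈ before l.succ, Function.update x l y i = Function.update x' l y i := by
  intro i hi
  rcases (mem_before_succ.1 hi).eq_or_lt with rfl | hil
  · simp
  · rw [Function.update_of_ne hil.ne, Function.update_of_ne hil.ne, h i (mem_before_castSucc.2 hil)]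

lemma restrict_congr_before {l : Fin k} {x x' : ∀ l, 𝒳 l}
    (h : ∀ i ∈ before l.castSucc, x i = x' i) :
    (fun i : Set.Iio l => x i) = fun i : Set.Iio l => x' i :=
  funext fun i => h i (mem_before_castSucc.2 i.2)

/-- Statements of this kind record that a function reads only earlier coordinates. This allows its
evaluation on tables from which the later levels have been erased. -/
lemma dependsOn_levelOp {l : Fin k} {F : (∀ l, 𝒳 l) → ℝ≥0∞} (hF : DependsOn F (before l.succ)) :
    DependsOn (levelOp ν l F) (before l.castSucc) := by
  intro x x' h
  simp only [levelOp]
  rw [restrict_congr_before h]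
  exact lintegral_congr fun y => hF (update_congr_before h y)

lemma measurable_updateProd (l : Fin k) :
    Measurable fun p : (∀ l, 𝒳 l) × 𝒳 l => Function.update p.1 l p.2 := measurable_update'

lemma measurable_restrict_path (l : Fin k) :
    Measurable fun (x : ∀ l, 𝒳 l) (i : Set.Iio l) => x i :=
  measurable_pi_lambda _ fun i => measurable_pi_apply (i : Fin k)

lemma measurable_levelOp [∀ l, IsMarkovKernel (ν l)] {l : Fin k} {F : (∀ l, 𝒳 l) → ℝ≥0∞}
    (hF : Measurable F) : Measurable (levelOp ν l F) :=
  Measurable.lintegral_kernel_prod_right' (κ := (ν l).comap _ (measurable_restrict_path l))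
    (hF.comp (measurable_updateProd l))

lemma dependsOn_levelFun (j : Fin (k + 1)) : DependsOn (levelFun m ν X j) (before j) := by
  induction j using Fin.reverseInduction with
  | last =>
    intro x x' h
    rw [show x = x' from funext fun i => h i (Fin.castSucc_lt_last i)]
  | cast l ih =>
    intro x x' h
    rw [levelFun_castSucc, levelFun_castSucc, restrict_congr_before h]
    congr 3
    funext y
    rw [ih (update_congr_before h y)]

lemma measurable_levelFun [∀ l, IsMarkovKernel (ν l)] (hX : Measurable X) (j : Fin (k + 1)) :
    Measurable (levelFun m ν X j) := by
  induction j using Fin.reverseInduction with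
  | last => rwa [levelFun_last]
  | cast l ih =>
    have h : StronglyMeasurable fun p : (∀ l, 𝒳 l) × 𝒳 l =>
        Real.exp (m l.succ * levelFun m ν X l.succ (Function.update p.1 l p.2)) :=
      (((ih.comp (measurable_updateProd l)).const_mul _).exp).stronglyMeasurable
    have h2 := h.integral_kernel_prod_right' (κ := (ν l).comap _ (measurable_restrict_path l))
    have h3 : levelFun m ν X l.castSucc = _ := funext (levelFun_castSucc l)
    rw [h3]
    exact h2.measurable.log.const_mul _

lemma dependsOn_density (l : Fin k) : DependsOn (density m ν X l) (before l.succ) := by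
  intro x x' h
  rw [density, density, dependsOn_levelFun l.succ h, dependsOn_levelFun l.castSucc fun i hi =>
    h i (mem_before_succ.2 (mem_before_castSucc.1 hi).le)]

lemma measurable_density [∀ l, IsMarkovKernel (ν l)] (hX : Measurable X) (l : Fin k) :
    Measurable (density m ν X l) :=
  (((measurable_levelFun hX l.succ).fun_sub (measurable_levelFun hX l.castSucc)).const_mul _).exp

/-- The factor `exp (m_{j+1} X_j)` (`exp X` for `j = k`) of the weight of a vertex. -/
noncomputable def levelExp (m : Fin (k + 1) → ℝ)
    (ν : (l : Fin k) → Kernel ((i : Set.Iio l) → 𝒳 i) (𝒳 l)) (X : (∀ l, 𝒳 l) → ℝ)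
    (j : Fin (k + 1)) (x : ∀ l, 𝒳 l) : ℝ≥0∞ :=
  ENNReal.ofReal (Real.exp (theta m j * levelFun m ν X j x))

lemma levelExp_pos (j : Fin (k + 1)) (x : ∀ l, 𝒳 l) : levelExp m ν X j x ≠ 0 := by
  simp [levelExp, Real.exp_pos]

lemma levelExp_ne_top (j : Fin (k + 1)) (x : ∀ l, 𝒳 l) : levelExp m ν X j x ≠ ⊤ :=
  ENNReal.ofReal_ne_top

lemma dependsOn_levelExp (j : Fin (k + 1)) : DependsOn (levelExp m ν X j) (before j) := by
  intro x x' h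
  rw [levelExp, levelExp, dependsOn_levelFun j h]

lemma measurable_levelExp [∀ l, IsMarkovKernel (ν l)] (hX : Measurable X) (j : Fin (k + 1)) :
    Measurable (levelExp m ν X j) :=
  ((measurable_levelFun hX j).const_mul _).exp.ennreal_ofReal

/-- The density `W_l` with values in `[0, ∞]`. -/
noncomputable def eDensity (m : Fin (k + 1) → ℝ)
    (ν : (l : Fin k) → Kernel ((i : Set.Iio l) → 𝒳 i) (𝒳 l)) (X : (∀ l, 𝒳 l) → ℝ)
    (l : Fin k) (x : ∀ l, 𝒳 l) : ℝ≥0∞ := ENNReal.ofReal (density m ν X l x)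

lemma dependsOn_eDensity (l : Fin k) : DependsOn (eDensity m ν X l) (before l.succ) := by
  intro x x' h
  rw [eDensity, eDensity, dependsOn_density l h]

lemma measurable_eDensity [∀ l, IsMarkovKernel (ν l)] (hX : Measurable X) (l : Fin k) :
    Measurable (eDensity m ν X l) := (measurable_density hX l).ennreal_ofReal

/-- Raising the level factor to the ratio of the exponents extracts the density `W_l`. -/
lemma levelExp_succ_rpow (l : Fin k) (hpos : theta m l.succ ≠ 0) (x : ∀ l, 𝒳 l) :
    levelExp m ν X l.succ x ^ (theta m l.castSucc / theta m l.succ)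
      = levelExp m ν X l.castSucc x * eDensity m ν X l x := by
  rw [levelExp, ENNReal.ofReal_rpow_of_pos (Real.exp_pos _), levelExp, eDensity,
    ← ENNReal.ofReal_mul (Real.exp_pos _).le, density, ← Real.exp_add, ← Real.exp_mul,
    theta_castSucc]
  congr 2
  field_simp
  ring

end levels

/-! ### Enlarging the background of conditionally independent marks -/

section enlarge

variable {Ω 𝕌 𝕍 𝕎 𝕋 𝒴 J : Type*} [MeasurableSpace Ω] [MeasurableSpace 𝕌] [MeasurableSpace 𝕍]
  [MeasurableSpace 𝕎] [MeasurableSpace 𝕋] [MeasurableSpace 𝒴] {P : Measure Ω}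
  [IsProbabilityMeasure P]

/-- The background of conditionally independent marks may be enlarged by independent variables. -/
lemma HasCondMarks.enlarge {V : Ω → 𝕍} {κ : J → Kernel 𝕍 𝒴} {z : J → Ω → 𝒴}
    (h : HasCondMarks P V κ z) {U : Ω → 𝕌} (hU : Measurable U) {T : Ω → 𝕋} (hT : Measurable T)
    (hUT : IndepFun U T P) {a : 𝕋 → 𝕍} (ha : Measurable a) (hVa : ∀ ω, V ω = a (T ω))
    {b : J → 𝕋 → 𝒴} (hb : ∀ i, Measurable (b i)) (hzb : ∀ i ω, z i ω = b i (T ω))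
    {g : 𝕌 × 𝕍 → 𝕎} (hg : Measurable g) {κ' : J → Kernel 𝕎 𝒴}
    (hκ : ∀ i u v, κ' i (g (u, v)) = κ i v) :
    HasCondMarks P (fun ω => g (U ω, V ω)) κ' z where
  measurable_background := hg.comp (hU.prodMk h.measurable_background)
  measurable_mark := h.measurable_mark
  condLaw S B hB G hG := by
    have hV := h.measurable_background
    have hUV : Measurable fun ω => (U ω, V ω) := hU.prodMk hV
    set C : Set Ω := ⋂ i ∈ S, z i ⁻¹' B i with hC
    have hCm : MeasurableSet C :=
      Finset.measurableSet_biInter _ fun i _ => h.measurable_mark i (hB i)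
    set D : 𝕍 → ℝ≥0∞ := fun v => ∏ i ∈ S, κ i v (B i) with hD
    have hDm : Measurable D := Finset.measurable_prod _ fun i _ => (κ i).measurable_coe (hB i)
    -- The restriction of `P` to the mark event and the density `D (V)` have the same image under
    -- `(U, V)`. On rectangles this follows from the conditional law, because `U` is independent of
    -- `T`, which determines both `V` and the marks.
    have hmeas : (P.restrict C).map (fun ω => (U ω, V ω))
        = (P.withDensity fun ω => D (V ω)).map fun ω => (U ω, V ω) := by
      refine Measure.ext_prod fun {s t} hs ht => ?_
      have hst : MeasurableSet ((fun ω => (U ω, V ω)) ⁻¹' s ×ˢ t) := hUV (hs.prod ht)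
      rw [Measure.map_apply hUV (hs.prod ht), Measure.map_apply hUV (hs.prod ht),
        Measure.restrict_apply hst, withDensity_apply _ hst]
      have e1 : (fun ω => (U ω, V ω)) ⁻¹' s ×ˢ t ∩ C
          = U ⁻¹' s ∩ T ⁻¹' (a ⁻¹' t ∩ ⋂ i ∈ S, b i ⁻¹' B i) := by
        ext ω
        simp [hC, hVa, hzb, and_assoc]
      have e2 : T ⁻¹' (a ⁻¹' t ∩ ⋂ i ∈ S, b i ⁻¹' B i) = V ⁻¹' t ∩ C := by
        ext ω
        simp [hC, hVa, hzb]
      rw [e1, hUT.measure_inter_preimage_eq_mul _ _ hs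
        ((ha ht).inter (Finset.measurableSet_biInter _ fun i _ => hb i (hB i))), e2,
        h.condLaw S B hB t ht]
      have h3 := lintegral_mul_eq_lintegral_mul_lintegral_of_indepFun (μ := P)
        (f := fun ω => s.indicator 1 (U ω)) (g := fun ω => (t.indicator D) (a (T ω)))
        ((measurable_one.indicator hs).comp hU) (((hDm.indicator ht).comp ha).comp hT)
        (hUT.comp (measurable_one.indicator hs) ((hDm.indicator ht).comp ha))
      have e3 : ∫⁻ ω, s.indicator 1 (U ω) ∂P = P (U ⁻¹' s) := by
        rw [← lintegral_indicator_one (hU hs)]; rfl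
      have e4 : ∫⁻ ω, (t.indicator D) (a (T ω)) ∂P = ∫⁻ ω in V ⁻¹' t, D (V ω) ∂P := by
        rw [← lintegral_indicator (hV ht)]
        refine lintegral_congr fun ω => ?_
        rw [← hVa]
        rfl
      rw [e3, e4] at h3
      rw [← h3, ← lintegral_indicator hst]
      refine lintegral_congr fun ω => ?_
      simp only [Set.indicator, Set.mem_preimage, hVa, Set.mem_prod, Pi.mul_apply, Pi.one_apply]
      split_ifs <;> simp_all
    have hGm : MeasurableSet (g ⁻¹' G) := hg hG
    have := congrArg (fun μ => μ (g ⁻¹' G)) hmeas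
    simp only [Measure.map_apply hUV hGm, Measure.restrict_apply (hUV hGm),
      withDensity_apply _ (hUV hGm)] at this
    simp only [hκ]
    exact this

/-- On boxes, independence of `B` from `(A, C)` splits off `B`, and that of `A` and `C` splits the
rest. It will be used with the earlier points as `A`, the earlier marks as `B` and the current
points as `C`. -/
lemma indepFun_prod_left {A : Ω → 𝕌} {B : Ω → 𝕍} {C : Ω → 𝕎} (hA : Measurable A)
    (hB : Measurable B) (hC : Measurable C) (h : IndepFun (fun ω => (A ω, C ω)) B P)
    (hAC : IndepFun A C P) : IndepFun (fun ω => (A ω, B ω)) C P := by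
  have hAB : IndepFun A B P := h.comp measurable_fst measurable_id
  rw [indepFun_iff_map_prod_eq_prod_map_map (hA.prodMk hB).aemeasurable hC.aemeasurable]
  have := Measure.isProbabilityMeasure_map (μ := P) ((hA.prodMk hB).prodMk hC).aemeasurable
  refine Measure.ext_prod₃' fun {s t v} hs ht hv => ?_
  rw [Measure.map_apply ((hA.prodMk hB).prodMk hC) ((hs.prod ht).prod hv), Measure.prod_prod,
    Measure.map_apply (hA.prodMk hB) (hs.prod ht), Measure.map_apply hC hv]
  have e1 : (fun ω => ((A ω, B ω), C ω)) ⁻¹' (s ×ˢ t) ×ˢ v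
      = (fun ω => (A ω, C ω)) ⁻¹' (s ×ˢ v) ∩ B ⁻¹' t := by
    ext ω; simp only [Set.mem_preimage, Set.mem_prod, Set.mem_inter_iff]; tauto
  rw [e1, h.measure_inter_preimage_eq_mul _ _ (hs.prod hv) ht, Set.mk_preimage_prod,
    Set.mk_preimage_prod, hAC.measure_inter_preimage_eq_mul _ _ hs hv,
    hAB.measure_inter_preimage_eq_mul _ _ hs ht]
  ring

end enlarge

/-! ### The past of a level as a random table -/

section tables

variable {k : ℕ} {𝒳 : Fin k → Type*} [∀ l, MeasurableSpace (𝒳 l)]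

/-- A family of elements of `𝒳 l` indexed by all vertices of the tree. -/
abbrev Table {k : ℕ} (𝒳 : Fin k → Type*) : Type _ := (l : Fin k) → (Set.Iio l → ℕ) → ℕ → 𝒳 l

/-- The table with the entries of the levels from `l` on replaced by constants. -/
noncomputable def mask (x0 : ∀ l, 𝒳 l) (l : Fin k) (t : Table 𝒳) : Table 𝒳 :=
  fun j p n => if j < l then t j p n else x0 j

lemma mask_of_lt {x0 : ∀ l, 𝒳 l} {l j : Fin k} (h : j < l) (t : Table 𝒳) :
    mask x0 l t j = t j := by
  funext p n; simp [mask, h]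

lemma measurable_mask (x0 : ∀ l, 𝒳 l) (l : Fin k) : Measurable (mask x0 l) := by
  refine measurable_pi_lambda _ fun j => measurable_pi_lambda _ fun p =>
    measurable_pi_lambda _ fun n => ?_
  by_cases h : j < l
  · simp only [mask, h, if_true]; fun_prop
  · simp only [mask, h, if_false]; fun_prop

/-- The path of the table along the vertex `p`. -/
def tablePath {l : Fin k} (p : Set.Iio l → ℕ) (t : Table 𝒳) : (i : Set.Iio l) → 𝒳 i :=
  fun i => t i (fun j => p ⟨j, lt_trans (Set.mem_Iio.1 j.2) (Set.mem_Iio.1 i.2)⟩) (p i)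

lemma measurable_tablePath {l : Fin k} (p : Set.Iio l → ℕ) :
    Measurable (tablePath (𝒳 := 𝒳) p) :=
  measurable_pi_lambda _ fun i => by unfold tablePath; fun_prop

lemma tablePath_mask {x0 : ∀ l, 𝒳 l} {l : Fin k} (p : Set.Iio l → ℕ) (t : Table 𝒳) :
    tablePath p (mask x0 l t) = tablePath p t := by
  funext i
  simp only [tablePath, mask_of_lt (Set.mem_Iio.1 i.2)]

variable {Ω : Type*} [MeasurableSpace Ω] {P : Measure Ω} {m : Fin (k + 1) → ℝ}
  {ν : (l : Fin k) → Kernel ((i : Set.Iio l) → 𝒳 i) (𝒳 l)}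
  {u : (l : Fin k) → (Set.Iio l → ℕ) → ℕ → Ω → ℝ}
  {z : (l : Fin k) → (Set.Iio l → ℕ) → ℕ → Ω → 𝒳 l}

/-- The law of the children of `p`, as a kernel on tables. -/
noncomputable def childKernel (ν : (l : Fin k) → Kernel ((i : Set.Iio l) → 𝒳 i) (𝒳 l)) (l : Fin k)
    (p : Set.Iio l → ℕ) : Kernel (Table 𝒳) (𝒳 l) :=
  (ν l).comap (tablePath p) (measurable_tablePath p)

instance [∀ l, IsMarkovKernel (ν l)] (l : Fin k) (p : Set.Iio l → ℕ) :
    IsMarkovKernel (childKernel ν l p) := by unfold childKernel; infer_instance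

lemma measurable_mask_pastSigma (x0 : ∀ l, 𝒳 l) (l : Fin k) :
    Measurable[pastSigma z l] fun ω => mask x0 l fun j p n => z j p n ω := by
  refine @measurable_pi_lambda _ _ _ (pastSigma z l) _ _ fun j =>
    @measurable_pi_lambda _ _ _ (pastSigma z l) _ _ fun p =>
    @measurable_pi_lambda _ _ _ (pastSigma z l) _ _ fun n => ?_
  by_cases h : j < l
  · simp only [mask, h, if_true]
    have h1 : MeasurableSpace.comap (z j p n) inferInstance ≤ pastSigma z l :=
      le_iSup₂_of_le j h (le_iSup₂_of_le p n le_rfl)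
    exact (comap_measurable (z j p n)).mono h1 le_rfl
  · simp only [mask, h, if_false]
    exact @measurable_const _ _ _ (pastSigma z l) _

lemma IsTreeProcess.measurable_table (hz : IsTreeProcess P ν z) :
    Measurable fun ω => (fun l p n => z l p n ω : Table 𝒳) := by
  have := hz.measurable; fun_prop

/-- The masked table is measurable for the past, and it retains the path to every parent, on which
alone the law of the children depends. -/
lemma IsTreeProcess.hasCondMarks (hz : IsTreeProcess P ν z) (x0 : ∀ l, 𝒳 l) (l : Fin k) :
    HasCondMarks P (fun ω => mask x0 l fun j p n => z j p n ω)
      (fun i : (Set.Iio l → ℕ) × ℕ => childKernel ν l i.1) (fun i => z l i.1 i.2) where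
  measurable_background := (measurable_mask x0 l).comp hz.measurable_table
  measurable_mark i := hz.measurable l i.1 i.2
  condLaw S B hB G hG := by
    rw [hz.condLaw l S B hB _ (measurable_mask_pastSigma x0 l hG)]
    simp only [childKernel, Kernel.comap_apply, tablePath_mask]
    rfl

lemma IsCascade.measurable (hu : IsCascade P m u) (l : Fin k) (p : Set.Iio l → ℕ) (n : ℕ) :
    Measurable (u l p n) := (hu.poisson l p).measurable n

lemma IsCascade.measurable_table (hu : IsCascade P m u) :
    Measurable fun ω => (fun l p n => u l p n ω : Table fun _ : Fin k => ℝ) := by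
  have := hu.measurable; fun_prop

/-- Points before level `l` and points at level `l` come from disjoint subfamilies of the
independent processes. -/
lemma IsCascade.indepFun_mask (hu : IsCascade P m u) (l : Fin k) :
    IndepFun (fun ω => mask (fun _ => (0 : ℝ)) l fun j p n => u j p n ω)
      (fun ω p n => u l p n ω) P := by
  set f := fun (v : (l : Fin k) × (Set.Iio l → ℕ)) (ω : Ω) (n : ℕ) => u v.1 v.2 n ω with hf
  have hfm : ∀ v, Measurable (f v) := fun v => by have := hu.measurable v.1 v.2; fun_prop
  have h := indep_iSup_of_disjoint (m := fun v => MeasurableSpace.comap (f v) inferInstance)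
    (fun v => (hfm v).comap_le) hu.indep.iIndep (S := {v | v.1 < l}) (T := {v | v.1 = l})
    (Set.disjoint_left.2 fun v (h1 : v.1 < l) (h2 : v.1 = l) => h1.ne h2)
  have hle : ∀ (S : Set ((l : Fin k) × (Set.Iio l → ℕ))) (v) (_ : v ∈ S) (n : ℕ),
      Measurable[⨆ v ∈ S, MeasurableSpace.comap (f v) inferInstance] (u v.1 v.2 n) := by
    intro S v hv n
    refine Measurable.mono ?_ (le_iSup₂_of_le v hv le_rfl) le_rfl
    exact (measurable_pi_apply n).comp (comap_measurable (f v))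
  rw [IndepFun_iff_Indep]
  refine indep_of_indep_of_le_left (indep_of_indep_of_le_right h ?_) ?_
  · rw [← measurable_iff_comap_le]
    refine @measurable_pi_lambda _ _ _ (_) _ _ fun p =>
      @measurable_pi_lambda _ _ _ (_) _ _ fun n => ?_
    exact hle {v | v.1 = l} ⟨l, p⟩ rfl n
  · rw [← measurable_iff_comap_le]
    refine @measurable_pi_lambda _ _ _ (_) _ _ fun j => @measurable_pi_lambda _ _ _ (_) _ _ fun p =>
      @measurable_pi_lambda _ _ _ (_) _ _ fun n => ?_
    by_cases hj : j < l
    · simp only [mask, hj, if_true]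
      exact hle {v | v.1 < l} ⟨j, p⟩ hj n
    · simp only [mask, hj, if_false]
      exact @measurable_const _ _ _ (_) _

/-- The points and marks of the levels before `l`. -/
noncomputable def background (u : (l : Fin k) → (Set.Iio l → ℕ) → ℕ → Ω → ℝ)
    (z : (l : Fin k) → (Set.Iio l → ℕ) → ℕ → Ω → 𝒳 l) (x0 : ∀ l, 𝒳 l) (l : Fin k) (ω : Ω) :
    Table (fun _ : Fin k => ℝ) × Table 𝒳 :=
  (mask (fun _ => 0) l fun j p n => u j p n ω, mask x0 l fun j p n => z j p n ω)

/-- The background must contain the earlier points and marks, and for the law of the new marks also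
the new points. Independence of the points from the whole tree process allows this enlargement
without changing the conditional law. -/
lemma isMarkedLevel [IsProbabilityMeasure P] [∀ l, IsMarkovKernel (ν l)] (hu : IsCascade P m u)
    (hz : IsTreeProcess P ν z)
    (huz : IndepFun (fun ω l p n => u l p n ω) (fun ω l p n => z l p n ω) P) (x0 : ∀ l, 𝒳 l)
    (l : Fin k) :
    IsMarkedLevel P (stableIntensity (m l.succ)) (background u z x0 l)
      (fun p => (childKernel ν l p).prodMkLeft _) (u l) (z l) where
  poisson := hu.poisson l
  indep := hu.indep.precomp (g := fun p => (⟨l, p⟩ : (l : Fin k) × (Set.Iio l → ℕ)))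
    fun p q h => by simpa using h
  indep_background := by
    have hU := hu.measurable_table
    have hZ := hz.measurable_table
    refine indepFun_prod_left ((measurable_mask _ l).comp hU) ((measurable_mask x0 l).comp hZ)
      ((measurable_pi_apply l).comp hU) ?_ (hu.indepFun_mask l)
    exact huz.comp (φ := fun t => (mask (fun _ => (0 : ℝ)) l t, t l))
      ((measurable_mask _ l).prodMk (measurable_pi_apply l)) (measurable_mask x0 l)
  marks := by
    refine (hz.hasCondMarks x0 l).enlarge hu.measurable_table hz.measurable_table huz
      (measurable_mask x0 l) (fun _ => rfl) (b := fun i t => t l i.1 i.2) (fun i => by fun_prop)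
      (fun _ _ => rfl)
      (g := fun p => ((mask (fun _ => (0 : ℝ)) l p.1, p.2), p.1 l)) ?_ fun i t v => ?_
    · exact (((measurable_mask _ l).comp measurable_fst).prodMk measurable_snd).prodMk
        ((measurable_pi_apply l).comp measurable_fst)
    · simp [Kernel.prodMkRight_apply, Kernel.prodMkLeft_apply]

end tables

/-! ### Sums over pairs of points with a relation between their parents -/

section pairs

variable {Ω 𝕎 𝒴 I : Type*} [MeasurableSpace Ω] [MeasurableSpace 𝕎] [MeasurableSpace 𝒴]
  [MeasurableSpace I] [Countable I] [MeasurableSingletonClass I] {P : Measure Ω}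
  [IsProbabilityMeasure P] {W : Ω → 𝕎} {κ : I → Kernel 𝕎 𝒴} [∀ q, IsMarkovKernel (κ q)]
  {u : I → ℕ → Ω → ℝ} {z : I → ℕ → Ω → 𝒴} {s θ : ℝ} {c f f' : I → 𝕎 → 𝒴 → ℝ≥0∞}

/-- Sums over pairs of points with different positions, grouped by parents. -/
lemma tsum_pair_eq [DecidableEq I] (E : I → I → Prop) [∀ q q', Decidable (E q q')]
    [∀ i j : I × ℕ, Decidable (E i.1 j.1 ∧ i ≠ j)] (A B : I × ℕ → ℝ≥0∞) :
    (∑' i : I × ℕ, ∑' j : I × ℕ, if E i.1 j.1 ∧ i ≠ j then A i * B j else 0)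
      = ∑' q : I, ∑' q' : I, if E q q' then
          (∑' n : ℕ, ∑' n' : ℕ, if (q, n) = (q', n') then 0 else A (q, n) * B (q', n')) else 0 := by
  rw [ENNReal.tsum_prod']
  refine tsum_congr fun q => ?_
  simp_rw [ENNReal.tsum_prod' (α := I) (β := ℕ)]
  rw [ENNReal.tsum_comm]
  refine tsum_congr fun q' => ?_
  by_cases hE : E q q'
  · rw [if_pos hE]
    refine tsum_congr fun n => tsum_congr fun n' => ?_
    by_cases hn : (q, n) = (q', n')
    · rw [if_pos hn, if_neg fun hh => hh.2 hn]
    · rw [if_neg hn, if_pos ⟨hE, hn⟩]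
  · simp [hE]

/-- There are countably many parents, so Tonelli reduces the claim to the formula for two fixed
parents. -/
lemma IsMarkedLevel.lintegral_pairs_div (h : IsMarkedLevel P (stableIntensity s) W κ u z)
    (hs : 0 < s) (hsθ : s < θ)
    (hc : ∀ q, Measurable (Function.uncurry (c q))) (hc_fin : ∀ q w y, c q w y ≠ ⊤)
    (hf : ∀ q, Measurable (Function.uncurry (f q)))
    (hf' : ∀ q, Measurable (Function.uncurry (f' q))) (E : I → I → Prop) [∀ q q', Decidable (E q q')]
    [∀ i j : I × ℕ, Decidable (E i.1 j.1 ∧ i ≠ j)] :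
    ∫⁻ ω, (∑' i : I × ℕ, ∑' j : I × ℕ, if E i.1 j.1 ∧ i ≠ j then
        (pointWeight θ c (W ω) (i.1, u i.1 i.2 ω, z i.1 i.2 ω) * f i.1 (W ω) (z i.1 i.2 ω)) *
        (pointWeight θ c (W ω) (j.1, u j.1 j.2 ω, z j.1 j.2 ω) * f' j.1 (W ω) (z j.1 j.2 ω))
        else 0) /
        (∑' i : I × ℕ, pointWeight θ c (W ω) (i.1, u i.1 i.2 ω, z i.1 i.2 ω)) ^ 2 ∂P
      = ENNReal.ofReal (s / θ) *
        ∫⁻ ω, (∑' q : I, ∑' q' : I, if E q q' then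
          (∫⁻ y, c q (W ω) y ^ (s / θ) * f q (W ω) y ∂κ q (W ω)) *
          ∫⁻ y, c q' (W ω) y ^ (s / θ) * f' q' (W ω) y ∂κ q' (W ω) else 0) /
          parentSum κ (s / θ) c (fun _ _ _ => 1) (W ω) ^ 2 ∂P := by
  classical
  have hW := h.measurable_background
  have hmul : ∀ {F : I → ℕ → Ω → ℝ≥0∞} {F' : I → ℕ → Ω → ℝ≥0∞} (q q' : I),
      (∀ q n, Measurable (F q n)) → (∀ q n, Measurable (F' q n)) →
      Measurable fun ω => ∑' n : ℕ, ∑' n' : ℕ, if (q, n) = (q', n') then 0 else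
        F q n ω * F' q' n' ω := by
    intro F F' q q' hF hF'
    refine Measurable.tsum fun n => Measurable.tsum fun n' => ?_
    split_ifs
    · exact measurable_const
    · exact (hF _ _).fun_mul (hF' _ _)
  have hswap : ∀ {T : I → I → Ω → ℝ≥0∞} {D : Ω → ℝ≥0∞}, (∀ q q', Measurable (T q q')) →
      Measurable D → ∫⁻ ω, (∑' q : I, ∑' q' : I, if E q q' then T q q' ω else 0) / D ω ∂P
        = ∑' q : I, ∑' q' : I, if E q q' then ∫⁻ ω, T q q' ω / D ω ∂P else 0 := by
    intro T D hT hD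
    have hm : ∀ q q', Measurable fun ω => (if E q q' then T q q' ω else 0) * (D ω)⁻¹ := by
      intro q q'
      split_ifs
      · exact (hT q q').fun_mul hD.inv
      · simp
    simp_rw [div_eq_mul_inv, ← ENNReal.tsum_mul_right]
    rw [lintegral_tsum fun q => (Measurable.tsum fun q' => hm q q').aemeasurable]
    refine tsum_congr fun q => ?_
    rw [lintegral_tsum fun q' => (hm q q').aemeasurable]
    refine tsum_congr fun q' => ?_
    split_ifs <;> simp
  have hw := h.measurable_weight (θ := θ) hc
  have hS : Measurable fun ω => (∑' i : I × ℕ, pointWeight θ c (W ω)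
      (i.1, u i.1 i.2 ω, z i.1 i.2 ω)) ^ 2 := (Measurable.tsum hw).pow_const 2
  have hS' : Measurable fun ω => parentSum κ (s / θ) c (fun _ _ _ => 1) (W ω) ^ 2 :=
    ((measurable_parentSum hc fun _ => measurable_const).comp hW).pow_const 2
  have hA : ∀ q n, Measurable fun ω => pointWeight θ c (W ω) (q, u q n ω, z q n ω) *
      f q (W ω) (z q n ω) := fun q n => (hw (q, n)).fun_mul (h.measurable_mark_fun hf (q, n))
  have hB : ∀ q n, Measurable fun ω => pointWeight θ c (W ω) (q, u q n ω, z q n ω) *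
      f' q (W ω) (z q n ω) := fun q n => (hw (q, n)).fun_mul (h.measurable_mark_fun hf' (q, n))
  have hC : ∀ q q', Measurable fun ω =>
      (∫⁻ y, c q (W ω) y ^ (s / θ) * f q (W ω) y ∂κ q (W ω)) *
        ∫⁻ y, c q' (W ω) y ^ (s / θ) * f' q' (W ω) y ∂κ q' (W ω) := fun q q' =>
    ((measurable_parentTerm hc hf q).comp hW).fun_mul ((measurable_parentTerm hc hf' q').comp hW)
  simp_rw [tsum_pair_eq E]
  rw [hswap (fun q q' => hmul q q' hA hB) hS, hswap hC hS']
  simp_rw [← ENNReal.tsum_mul_left]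
  refine tsum_congr fun q => tsum_congr fun q' => ?_
  split_ifs
  · exact h.lintegral_pair_div hs hsθ hc hc_fin hf hf' q q'
  · simp

end pairs

/-! ### Vertices of all levels, represented by leaves -/

section nodes

variable {k : ℕ}

/-- The vertices at the end of `j` levels, as leaves whose remaining coordinates are `0`. -/
def nodes (j : Fin (k + 1)) : Set (Fin k → ℕ) := {α | ∀ i, j ≤ i.castSucc → α i = 0}

/-- The vertex `q`, with the remaining coordinates set to `0`. -/
def extendZero (l : Fin k) (q : Set.Iio l → ℕ) : Fin k → ℕ :=
  fun i => if h : i < l then q ⟨i, h⟩ else 0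

/-- The child number `n` of `q`, with the remaining coordinates set to `0`. -/
def child (l : Fin k) (q : Set.Iio l → ℕ) (n : ℕ) : Fin k → ℕ :=
  Function.update (extendZero l q) l n

lemma extendZero_of_lt {l i : Fin k} (h : i < l) (q : Set.Iio l → ℕ) :
    extendZero l q i = q ⟨i, h⟩ := by simp [extendZero, h]

lemma child_of_lt {l i : Fin k} (h : i < l) (q : Set.Iio l → ℕ) (n : ℕ) :
    child l q n i = q ⟨i, h⟩ := by
  rw [child, Function.update_of_ne h.ne, extendZero_of_lt h]

@[simp] lemma child_self (l : Fin k) (q : Set.Iio l → ℕ) (n : ℕ) : child l q n l = n := by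
  simp [child]

/-- Vertices of level `l`, as leaves with vanishing coordinates from `l` on. -/
def parentEquiv (l : Fin k) : (Set.Iio l → ℕ) ≃ nodes l.castSucc where
  toFun q := ⟨extendZero l q, fun i hi => by
    have : ¬ i < l := not_lt.2 (Fin.castSucc_le_castSucc_iff.1 hi)
    simp [extendZero, this]⟩
  invFun α i := α.1 i
  left_inv q := funext fun i => extendZero_of_lt i.2 q
  right_inv α := by
    refine Subtype.ext (funext fun i => ?_)
    by_cases h : i < l
    · exact extendZero_of_lt h fun i => α.1 i
    · rw [α.2 i (Fin.castSucc_le_castSucc_iff.2 (not_lt.1 h))]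
      simp [extendZero, h]

/-- Children of the vertices of level `l`, as leaves with vanishing coordinates after `l`. -/
def childEquiv (l : Fin k) : (Set.Iio l → ℕ) × ℕ ≃ nodes l.succ where
  toFun i := ⟨child l i.1 i.2, fun j hj => by
    have h : l < j := Fin.succ_le_castSucc_iff.1 hj
    simp [child, Function.update_of_ne h.ne', extendZero, h.le]⟩
  invFun α := (fun i => α.1 i, α.1 l)
  left_inv i := Prod.ext (funext fun j => child_of_lt j.2 i.1 i.2) (child_self l i.1 i.2)
  right_inv α := by
    refine Subtype.ext (funext fun i => ?_)
    rcases lt_trichotomy i l with h | rfl | h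
    · exact child_of_lt h _ _
    · exact child_self _ _ _
    · rw [α.2 i (Fin.succ_le_castSucc_iff.2 h)]
      simp [child, Function.update_of_ne h.ne', extendZero, h.le]

lemma tsum_nodes_castSucc (l : Fin k) (φ : (Fin k → ℕ) → ℝ≥0∞) :
    ∑' α : nodes l.castSucc, φ α = ∑' q, φ (extendZero l q) :=
  ((parentEquiv l).tsum_eq fun α : nodes l.castSucc => φ α).symm

lemma tsum_nodes_succ (l : Fin k) (φ : (Fin k → ℕ) → ℝ≥0∞) :
    ∑' α : nodes l.succ, φ α = ∑' i : (Set.Iio l → ℕ) × ℕ, φ (child l i.1 i.2) :=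
  ((childEquiv l).tsum_eq fun α : nodes l.succ => φ α).symm

lemma tsum_nodes_zero (φ : (Fin k → ℕ) → ℝ≥0∞) : ∑' α : nodes (0 : Fin (k + 1)), φ α = φ 0 := by
  have : nodes (0 : Fin (k + 1)) = {0} := by
    ext α
    simp only [nodes, Set.mem_ofPred_eq, Fin.zero_le, forall_true_left, Set.mem_singleton_iff]
    exact ⟨fun h => funext h, fun h i => by simp [h]⟩
  rw [this, tsum_singleton]

lemma nodes_last : nodes (Fin.last k) = Set.univ := by
  ext α
  simp only [nodes, Set.mem_ofPred_eq, Set.mem_univ, iff_true]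
  intro i hi
  exact absurd (Fin.castSucc_lt_last i) (not_lt.2 hi)

lemma tsum_nodes_last (φ : (Fin k → ℕ) → ℝ≥0∞) :
    ∑' α : nodes (Fin.last k), φ α = ∑' α, φ α := by
  rw [nodes_last, tsum_univ]

/-- The paths to `α` and `β` separate at level `r`. -/
def Separate (r : Fin k) (α β : Fin k → ℕ) : Prop := (∀ i < r, α i = β i) ∧ α r ≠ β r

/-- Separation before level `l` is already visible at the parents and forces the children to differ.
The redundant `i ≠ j` matches the form of the two-point formula. -/
lemma separate_child_of_lt {r l : Fin k} (h : r < l) (i j : (Set.Iio l → ℕ) × ℕ) :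
    Separate r (child l i.1 i.2) (child l j.1 j.2) ↔
      Separate r (extendZero l i.1) (extendZero l j.1) ∧ i ≠ j := by
  have h1 : Separate r (child l i.1 i.2) (child l j.1 j.2) ↔
      Separate r (extendZero l i.1) (extendZero l j.1) := by
    refine and_congr (forall₂_congr fun a ha => ?_) ?_
    · rw [child_of_lt (ha.trans h), child_of_lt (ha.trans h), extendZero_of_lt (ha.trans h),
        extendZero_of_lt (ha.trans h)]
    · rw [child_of_lt h, child_of_lt h, extendZero_of_lt h, extendZero_of_lt h]
  rw [h1, iff_self_and]
  rintro ⟨-, hr⟩ rfl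
  exact hr rfl

/-- Separation at level `l` itself means being distinct siblings; this is where the pair recursion
turns diagonal. -/
lemma separate_child_self (l : Fin k) (i j : (Set.Iio l → ℕ) × ℕ) :
    Separate l (child l i.1 i.2) (child l j.1 j.2) ↔ i.1 = j.1 ∧ i ≠ j := by
  rw [Separate, child_self, child_self, ne_eq, ne_eq, Prod.ext_iff, not_and]
  have : (∀ a < l, child l i.1 i.2 a = child l j.1 j.2 a) ↔ i.1 = j.1 := by
    constructor
    · intro h
      funext a
      have := h a a.2
      rwa [child_of_lt a.2, child_of_lt a.2] at this
    · intro h a ha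
      rw [child_of_lt ha, child_of_lt ha, h]
  rw [this]
  tauto

lemma wedge_eq_iff {α β : Fin k → ℕ} {r : Fin k} :
    wedge α β = (r : ℕ) + 1 ↔ Separate r α β := by
  have hr := r.2
  constructor
  · intro h
    by_cases hαβ : α = β
    · rw [wedge, if_pos hαβ] at h; omega
    · rw [wedge, if_neg hαβ] at h
      have hne : {l : ℕ | ∃ i : Fin k, l = (i : ℕ) + 1 ∧ α i ≠ β i}.Nonempty := by
        obtain ⟨i, hi⟩ := Function.ne_iff.1 hαβ
        exact ⟨_, i, rfl, hi⟩
      have hmem := Nat.sInf_mem hne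
      rw [h] at hmem
      obtain ⟨i, hi, hne'⟩ := hmem
      obtain rfl : r = i := Fin.ext (by omega)
      refine ⟨fun j hj => ?_, hne'⟩
      by_contra hc
      have h1 : (r : ℕ) + 1 ≤ (j : ℕ) + 1 := by rw [← h]; exact Nat.sInf_le ⟨j, rfl, hc⟩
      have h2 : (j : ℕ) < r := hj
      omega
  · rintro ⟨h1, h2⟩
    have hαβ : α ≠ β := fun h => h2 (by rw [h])
    rw [wedge, if_neg hαβ]
    refine le_antisymm (Nat.sInf_le ⟨r, rfl, h2⟩) (le_csInf ⟨_, r, rfl, h2⟩ ?_)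
    rintro _ ⟨i, rfl, hi⟩
    by_contra hc
    exact hi (h1 i (Fin.lt_def.2 (by omega)))

end nodes

/-! ### Weights of vertices and of their children -/

section weights

variable {k : ℕ} {𝒳 : Fin k → Type*} [∀ l, MeasurableSpace (𝒳 l)] {m : Fin (k + 1) → ℝ}
  {ν : (l : Fin k) → Kernel ((i : Set.Iio l) → 𝒳 i) (𝒳 l)} {X : (∀ l, 𝒳 l) → ℝ}

/-- The path of the table along a leaf. -/
def fullPath (t : Table 𝒳) (α : Fin k → ℕ) : ∀ l, 𝒳 l := fun l => t l (fun i => α i) (α l)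

lemma measurable_fullPath (α : Fin k → ℕ) :
    Measurable fun t : Table 𝒳 => fullPath t α :=
  measurable_pi_lambda _ fun i => by unfold fullPath; fun_prop

lemma fullPath_mask {x0 : ∀ l, 𝒳 l} {l : Fin k} (t : Table 𝒳) (α : Fin k → ℕ) :
    ∀ i ∈ before l.castSucc, fullPath (mask x0 l t) α i = fullPath t α i := by
  intro i hi
  simp only [fullPath, mask_of_lt (mem_before_castSucc.1 hi)]

lemma fullPath_congr {j : Fin (k + 1)} {α β : Fin k → ℕ} (h : ∀ i ∈ before j, α i = β i)
    (t : Table 𝒳) : ∀ i ∈ before j, fullPath t α i = fullPath t β i := by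
  intro i hi
  have h1 : (fun a : Set.Iio i => α a) = fun a : Set.Iio i => β a :=
    funext fun a => h a ((Fin.castSucc_lt_castSucc_iff.2 (Set.mem_Iio.1 a.2)).trans hi)
  simp only [fullPath]
  rw [h1, h i hi]

lemma fullPath_child (l : Fin k) (q : Set.Iio l → ℕ) (n : ℕ) (t : Table 𝒳) :
    ∀ i ∈ before l.succ, fullPath t (child l q n) i
      = Function.update (fullPath t (extendZero l q)) l (t l q n) i := by
  intro i hi
  rcases (mem_before_succ.1 hi).eq_or_lt with rfl | hil
  · rw [Function.update_self]
    simp only [fullPath, child_self]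
    congr 1
    exact funext fun j => child_of_lt j.2 q n
  · rw [Function.update_of_ne hil.ne]
    refine fullPath_congr (fun j hj => ?_) t i (mem_before_castSucc.2 hil)
    have hj := mem_before_castSucc.1 hj
    rw [child_of_lt hj, extendZero_of_lt hj]

lemma restrict_fullPath_extendZero (l : Fin k) (q : Set.Iio l → ℕ) (t : Table 𝒳) :
    (fun i : Set.Iio l => fullPath t (extendZero l q) i) = tablePath q t := by
  funext i
  have h1 : (fun j : Set.Iio (i : Fin k) => extendZero l q j) =
      fun j : Set.Iio (i : Fin k) => q ⟨j, lt_trans (Set.mem_Iio.1 j.2) (Set.mem_Iio.1 i.2)⟩ :=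
    funext fun j => extendZero_of_lt _ q
  simp only [fullPath, tablePath, h1, extendZero_of_lt (Set.mem_Iio.1 i.2)]

/-- The product of the points of the table along the first `j` levels of `α`. -/
noncomputable def pointProd (t : Table fun _ : Fin k => ℝ) (j : Fin (k + 1)) (α : Fin k → ℕ) :
    ℝ≥0∞ := ∏ i with i.castSucc < j, ENNReal.ofReal (fullPath t α i)

lemma measurable_pointProd (j : Fin (k + 1)) (α : Fin k → ℕ) :
    Measurable fun t : Table fun _ : Fin k => ℝ => pointProd t j α :=
  Finset.measurable_prod _ fun i _ =>
    (((measurable_pi_apply i).comp (measurable_fullPath α))).ennreal_ofReal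

lemma pointProd_ne_top (t : Table fun _ : Fin k => ℝ) (j : Fin (k + 1)) (α : Fin k → ℕ) :
    pointProd t j α ≠ ⊤ := ENNReal.prod_ne_top fun _ _ => ENNReal.ofReal_ne_top

lemma prod_before_castSucc_eq {M : Type*} [CommMonoid M] {f g : Fin k → M} {l : Fin k}
    (h : ∀ i ∈ before l.castSucc, f i = g i) :
    ∏ i with i.castSucc < l.castSucc, f i = ∏ i with i.castSucc < l.castSucc, g i :=
  Finset.prod_congr rfl fun i hi => h i (by simpa using hi)

lemma filter_before_succ (l : Fin k) :
    Finset.univ.filter (fun i : Fin k => i.castSucc < l.succ)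
      = insert l (Finset.univ.filter fun i : Fin k => i.castSucc < l.castSucc) := by
  ext i
  simp [Fin.castSucc_lt_succ_iff, le_iff_eq_or_lt]

lemma prod_before_succ {M : Type*} [CommMonoid M] (f : Fin k → M) (l : Fin k) :
    ∏ i with i.castSucc < l.succ, f i = f l * ∏ i with i.castSucc < l.castSucc, f i := by
  rw [filter_before_succ, Finset.prod_insert (by simp)]

lemma pointProd_mask {l : Fin k} (t : Table fun _ : Fin k => ℝ) (α : Fin k → ℕ) :
    pointProd (mask (fun _ => 0) l t) l.castSucc α = pointProd t l.castSucc α :=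
  prod_before_castSucc_eq fun i hi => by rw [fullPath_mask t α i hi]

lemma pointProd_child (l : Fin k) (q : Set.Iio l → ℕ) (n : ℕ) (t : Table fun _ : Fin k => ℝ) :
    pointProd t l.succ (child l q n)
      = pointProd t l.castSucc (extendZero l q) * ENNReal.ofReal (t l q n) := by
  have h := fullPath_child l q n t
  rw [pointProd, prod_before_succ, h l (mem_before_succ.2 le_rfl), Function.update_self, mul_comm]
  congr 1
  refine prod_before_castSucc_eq fun i hi => ?_
  have hi := mem_before_castSucc.1 hi
  rw [h i (mem_before_succ.2 hi.le), Function.update_of_ne hi.ne]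

/-- The weight of the vertex of level `j` on the path to `α`. -/
noncomputable def nodeWeight (m : Fin (k + 1) → ℝ)
    (ν : (l : Fin k) → Kernel ((i : Set.Iio l) → 𝒳 i) (𝒳 l)) (X : (∀ l, 𝒳 l) → ℝ)
    (t : Table (fun _ : Fin k => ℝ) × Table 𝒳) (j : Fin (k + 1)) (α : Fin k → ℕ) : ℝ≥0∞ :=
  pointProd t.1 j α ^ theta m j * levelExp m ν X j (fullPath t.2 α)

/-- The factor of the weight of a child of `q` without its own point. -/
noncomputable def childFactor (m : Fin (k + 1) → ℝ)
    (ν : (l : Fin k) → Kernel ((i : Set.Iio l) → 𝒳 i) (𝒳 l)) (X : (∀ l, 𝒳 l) → ℝ) (l : Fin k)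
    (q : Set.Iio l → ℕ) (t : Table (fun _ : Fin k => ℝ) × Table 𝒳) (y : 𝒳 l) : ℝ≥0∞ :=
  pointProd t.1 l.castSucc (extendZero l q) ^ theta m l.succ *
    levelExp m ν X l.succ (Function.update (fullPath t.2 (extendZero l q)) l y)

/-- A function of the path to a child of `q`, as a function of the background and the mark. -/
noncomputable def childFun (F : (∀ l, 𝒳 l) → ℝ≥0∞) (l : Fin k) (q : Set.Iio l → ℕ)
    (t : Table (fun _ : Fin k => ℝ) × Table 𝒳) (y : 𝒳 l) : ℝ≥0∞ :=
  F (Function.update (fullPath t.2 (extendZero l q)) l y)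

lemma measurable_childFun {F : (∀ l, 𝒳 l) → ℝ≥0∞} (hF : Measurable F) (l : Fin k)
    (q : Set.Iio l → ℕ) : Measurable (Function.uncurry (childFun F l q)) :=
  hF.comp ((measurable_updateProd l).comp
    (((measurable_fullPath _).comp measurable_fst.snd).prodMk measurable_snd))

lemma measurable_childFactor [∀ l, IsMarkovKernel (ν l)] (hX : Measurable X) (l : Fin k)
    (q : Set.Iio l → ℕ) : Measurable (Function.uncurry (childFactor m ν X l q)) :=
  Measurable.fun_mul (((measurable_pointProd _ _).comp measurable_fst.fst).pow_const _)
    (measurable_childFun (measurable_levelExp hX l.succ) l q)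

lemma childFactor_ne_top {l : Fin k} (h : 0 ≤ theta m l.succ) (q : Set.Iio l → ℕ)
    (t : Table (fun _ : Fin k => ℝ) × Table 𝒳) (y : 𝒳 l) : childFactor m ν X l q t y ≠ ⊤ :=
  ENNReal.mul_ne_top (ENNReal.rpow_ne_top_of_nonneg h (pointProd_ne_top _ _ _))
    (levelExp_ne_top _ _)

/-- The background of level `l`, as a function of the pair of complete tables. -/
noncomputable def maskPair (x0 : ∀ l, 𝒳 l) (l : Fin k)
    (t : Table (fun _ : Fin k => ℝ) × Table 𝒳) : Table (fun _ : Fin k => ℝ) × Table 𝒳 :=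
  (mask (fun _ => 0) l t.1, mask x0 l t.2)

lemma childFun_maskPair {x0 : ∀ l, 𝒳 l} {F : (∀ l, 𝒳 l) → ℝ≥0∞} {l : Fin k}
    (hF : DependsOn F (before l.succ)) (q : Set.Iio l → ℕ)
    (t : Table (fun _ : Fin k => ℝ) × Table 𝒳) (y : 𝒳 l) :
    childFun F l q (maskPair x0 l t) y = childFun F l q t y :=
  hF (update_congr_before (fullPath_mask t.2 _) y)

/-- The factor reads the tables only before level `l`, hence is a function of the background; the
child's own point and mark are supplied separately. -/
lemma childFactor_maskPair {x0 : ∀ l, 𝒳 l} {l : Fin k} (q : Set.Iio l → ℕ)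
    (t : Table (fun _ : Fin k => ℝ) × Table 𝒳) (y : 𝒳 l) :
    childFactor m ν X l q (maskPair x0 l t) y = childFactor m ν X l q t y := by
  have h := childFun_maskPair (x0 := x0) (dependsOn_levelExp (m := m) (ν := ν) (X := X) l.succ) q t y
  simp only [childFun] at h
  simp only [childFactor, h]
  simp only [maskPair, pointProd_mask]

lemma childFun_child {F : (∀ l, 𝒳 l) → ℝ≥0∞} {l : Fin k} (hF : DependsOn F (before l.succ))
    (q : Set.Iio l → ℕ) (n : ℕ) (t : Table (fun _ : Fin k => ℝ) × Table 𝒳) :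
    childFun F l q t (t.2 l q n) = F (fullPath t.2 (child l q n)) :=
  (hF (fullPath_child l q n t.2)).symm

lemma pointWeight_childFactor {x0 : ∀ l, 𝒳 l} {l : Fin k} (h : 0 ≤ theta m l.succ)
    (q : Set.Iio l → ℕ) (n : ℕ) (t : Table (fun _ : Fin k => ℝ) × Table 𝒳) :
    pointWeight (theta m l.succ) (childFactor m ν X l) (maskPair x0 l t)
        (q, t.1 l q n, t.2 l q n)
      = nodeWeight m ν X t l.succ (child l q n) := by
  have h1 := childFun_child (dependsOn_levelExp (m := m) (ν := ν) (X := X) l.succ) q n t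
  simp only [childFun] at h1
  simp only [pointWeight, childFactor_maskPair]
  rw [childFactor, nodeWeight, pointProd_child, ENNReal.mul_rpow_of_nonneg _ _ h, h1]
  ring

/-- The power `θ_parent / θ_child` brings the point product to the parent's exponent and splits the
exponential factor into the parent's one and the density. The parent's part does not read coordinate
`l` and leaves the integral. -/
lemma lintegral_childFactor [∀ l, IsMarkovKernel (ν l)] {x0 : ∀ l, 𝒳 l} {l : Fin k}
    (hpos : 0 < theta m l.succ) (hpos' : 0 ≤ theta m l.castSucc) (hX : Measurable X)
    {F : (∀ l, 𝒳 l) → ℝ≥0∞}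
    (hF : DependsOn F (before l.succ)) (hFm : Measurable F) (q : Set.Iio l → ℕ)
    (t : Table (fun _ : Fin k => ℝ) × Table 𝒳) :
    ∫⁻ y, childFactor m ν X l q (maskPair x0 l t) y ^ (theta m l.castSucc / theta m l.succ) *
        childFun F l q (maskPair x0 l t) y
        ∂((childKernel ν l q).prodMkLeft (Table fun _ : Fin k => ℝ)) (maskPair x0 l t)
      = nodeWeight m ν X t l.castSucc (extendZero l q) *
        levelOp ν l (fun x => eDensity m ν X l x * F x) (fullPath t.2 (extendZero l q)) := by
  have hρ : 0 ≤ theta m l.castSucc / theta m l.succ := by positivity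
  simp only [childFactor_maskPair, childFun_maskPair hF]
  rw [Kernel.prodMkLeft_apply, childKernel, Kernel.comap_apply]
  simp only [maskPair, tablePath_mask]
  rw [← restrict_fullPath_extendZero, levelOp, ← lintegral_const_mul]
  · refine lintegral_congr fun y => ?_
    rw [childFactor, ENNReal.mul_rpow_of_nonneg _ _ hρ, ← ENNReal.rpow_mul,
      mul_div_cancel₀ _ hpos.ne', levelExp_succ_rpow l hpos.ne', nodeWeight, childFun]
    have : levelExp m ν X l.castSucc (Function.update (fullPath t.2 (extendZero l q)) l y)
        = levelExp m ν X l.castSucc (fullPath t.2 (extendZero l q)) :=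
      dependsOn_levelExp l.castSucc fun i hi =>
        Function.update_of_ne (mem_before_castSucc.1 hi).ne _ _
    rw [this]
    ring
  · exact ((measurable_eDensity hX l).fun_mul hFm).comp
      ((measurable_updateProd l).comp measurable_prodMk_left)

end weights

/-! ### One step of the recursion over levels -/

section recursion

variable {Ω : Type*} [MeasurableSpace Ω] {P : Measure Ω} [IsProbabilityMeasure P]
  {k : ℕ} {𝒳 : Fin k → Type*} [∀ l, MeasurableSpace (𝒳 l)] {m : Fin (k + 1) → ℝ}
  {ν : (l : Fin k) → Kernel ((i : Set.Iio l) → 𝒳 i) (𝒳 l)} [∀ l, IsMarkovKernel (ν l)]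
  {X : (∀ l, 𝒳 l) → ℝ}
  {u : (l : Fin k) → (Set.Iio l → ℕ) → ℕ → Ω → ℝ}
  {z : (l : Fin k) → (Set.Iio l → ℕ) → ℕ → Ω → 𝒳 l}

/-- The sum of `F`, weighted with the vertices of level `j`. -/
noncomputable def nodeSum (m : Fin (k + 1) → ℝ)
    (ν : (l : Fin k) → Kernel ((i : Set.Iio l) → 𝒳 i) (𝒳 l)) (X : (∀ l, 𝒳 l) → ℝ)
    (t : Table (fun _ : Fin k => ℝ) × Table 𝒳) (j : Fin (k + 1)) (F : (∀ l, 𝒳 l) → ℝ≥0∞) : ℝ≥0∞ :=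
  ∑' α : nodes j, nodeWeight m ν X t j α * F (fullPath t.2 α)

/-- The sum of the weights of the vertices of level `j`. -/
noncomputable def partition (m : Fin (k + 1) → ℝ)
    (ν : (l : Fin k) → Kernel ((i : Set.Iio l) → 𝒳 i) (𝒳 l)) (X : (∀ l, 𝒳 l) → ℝ)
    (t : Table (fun _ : Fin k => ℝ) × Table 𝒳) (j : Fin (k + 1)) : ℝ≥0∞ :=
  ∑' α : nodes j, nodeWeight m ν X t j α

/-- The sum of `F`, weighted with the squared weights of the vertices of level `j`. -/
noncomputable def diagSum (m : Fin (k + 1) → ℝ)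
    (ν : (l : Fin k) → Kernel ((i : Set.Iio l) → 𝒳 i) (𝒳 l)) (X : (∀ l, 𝒳 l) → ℝ)
    (t : Table (fun _ : Fin k => ℝ) × Table 𝒳) (j : Fin (k + 1)) (F : (∀ l, 𝒳 l) → ℝ≥0∞) : ℝ≥0∞ :=
  ∑' α : nodes j, nodeWeight m ν X t j α ^ 2 * F (fullPath t.2 α)

open Classical in
/-- The weighted sum of `F(Z_α) G(Z_β)` over the pairs of vertices of level `j` that separate at
level `r`. -/
noncomputable def pairSum (m : Fin (k + 1) → ℝ)
    (ν : (l : Fin k) → Kernel ((i : Set.Iio l) → 𝒳 i) (𝒳 l)) (X : (∀ l, 𝒳 l) → ℝ)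
    (t : Table (fun _ : Fin k => ℝ) × Table 𝒳) (r : Fin k) (j : Fin (k + 1))
    (F G : (∀ l, 𝒳 l) → ℝ≥0∞) : ℝ≥0∞ :=
  ∑' α : nodes j, ∑' β : nodes j, if Separate r (α : Fin k → ℕ) β then
    (nodeWeight m ν X t j α * F (fullPath t.2 α)) *
      (nodeWeight m ν X t j β * G (fullPath t.2 β)) else 0

/-- The tables of all points and all marks. -/
def tables (u : (l : Fin k) → (Set.Iio l → ℕ) → ℕ → Ω → ℝ)
    (z : (l : Fin k) → (Set.Iio l → ℕ) → ℕ → Ω → 𝒳 l) (ω : Ω) :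
    Table (fun _ : Fin k => ℝ) × Table 𝒳 :=
  (fun l p n => u l p n ω, fun l p n => z l p n ω)

/-- A cascade with marks whose densities are normalized. -/
structure IsMarkedCascade (P : Measure Ω) (m : Fin (k + 1) → ℝ)
    (ν : (l : Fin k) → Kernel ((i : Set.Iio l) → 𝒳 i) (𝒳 l)) (X : (∀ l, 𝒳 l) → ℝ)
    (u : (l : Fin k) → (Set.Iio l → ℕ) → ℕ → Ω → ℝ)
    (z : (l : Fin k) → (Set.Iio l → ℕ) → ℕ → Ω → 𝒳 l) : Prop where
  zero : m 0 = 0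
  strictMono : StrictMono m
  last_lt : m (Fin.last k) < 1
  cascade : IsCascade P m u
  tree : IsTreeProcess P ν z
  indep : IndepFun (fun ω l p n => u l p n ω) (fun ω l p n => z l p n ω) P
  measurable : Measurable X
  normalized : ∀ l α, ∀ᵐ ω ∂P, levelOp ν l (eDensity m ν X l) (leafPath z α ω) = 1

/-- The operator `F ↦ E_l (W_l F)`. -/
noncomputable def tilt (m : Fin (k + 1) → ℝ)
    (ν : (l : Fin k) → Kernel ((i : Set.Iio l) → 𝒳 i) (𝒳 l)) (X : (∀ l, 𝒳 l) → ℝ) (l : Fin k)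
    (F : (∀ l, 𝒳 l) → ℝ≥0∞) : (∀ l, 𝒳 l) → ℝ≥0∞ :=
  levelOp ν l fun x => eDensity m ν X l x * F x

lemma measurable_tilt (hX : Measurable X) {l : Fin k} {F : (∀ l, 𝒳 l) → ℝ≥0∞}
    (hF : Measurable F) : Measurable (tilt m ν X l F) :=
  measurable_levelOp ((measurable_eDensity hX l).fun_mul hF)

lemma dependsOn_tilt {l : Fin k} {F : (∀ l, 𝒳 l) → ℝ≥0∞} (hF : DependsOn F (before l.succ)) :
    DependsOn (tilt m ν X l F) (before l.castSucc) :=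
  dependsOn_levelOp fun x x' h => by
    rw [hF h, dependsOn_eDensity l h]

lemma dependsOn_const_one {s : Set (Fin k)} :
    DependsOn (fun _ : ∀ l, 𝒳 l => (1 : ℝ≥0∞)) s := fun _ _ _ => rfl

variable (h : IsMarkedCascade P m ν X u z)
include h

lemma IsMarkedCascade.theta_pos (j : Fin (k + 1)) : 0 < theta m j := by
  rcases Fin.eq_castSucc_or_eq_last j with ⟨l, rfl⟩ | rfl
  · rw [theta_castSucc]; exact apply_succ_pos h.zero h.strictMono l
  · simp

lemma IsMarkedCascade.exists_isMarkedLevel (l : Fin k) : ∃ x0 : ∀ l, 𝒳 l,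
    IsMarkedLevel P (stableIntensity (theta m l.castSucc)) (fun ω => maskPair x0 l (tables u z ω))
      (fun p => (childKernel ν l p).prodMkLeft _) (u l) (z l) := by
  -- A probability space is nonempty, and the marks at one sample point serve as the constants that
  -- fill the erased entries.
  obtain ⟨ω⟩ := P.nonempty_of_neZero
  refine ⟨fun j => z j 0 0 ω, ?_⟩
  rw [theta_castSucc]
  exact isMarkedLevel h.cascade h.tree h.indep _ l

lemma IsMarkedCascade.parentSum_eq (x0 : ∀ l, 𝒳 l) (l : Fin k) {F : (∀ l, 𝒳 l) → ℝ≥0∞}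
    (hF : DependsOn F (before l.succ)) (hFm : Measurable F)
    (t : Table (fun _ : Fin k => ℝ) × Table 𝒳) :
    parentSum (fun p => (childKernel ν l p).prodMkLeft (Table fun _ : Fin k => ℝ))
        (theta m l.castSucc / theta m l.succ) (childFactor m ν X l) (childFun F l)
        (maskPair x0 l t)
      = nodeSum m ν X t l.castSucc (tilt m ν X l F) := by
  rw [nodeSum, tsum_nodes_castSucc l fun α => nodeWeight m ν X t l.castSucc α *
    tilt m ν X l F (fullPath t.2 α), parentSum]
  exact tsum_congr fun q => lintegral_childFactor (h.theta_pos _) (h.theta_pos _).le h.measurable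
    hF hFm q t

/-- The normalization of the densities makes the denominator a plain sum of parent weights again, so
that the recursion closes. -/
lemma IsMarkedCascade.parentSum_one (l : Fin k) : ∀ᵐ ω ∂P, ∀ x0 : ∀ l, 𝒳 l,
    parentSum (fun p => (childKernel ν l p).prodMkLeft (Table fun _ : Fin k => ℝ))
        (theta m l.castSucc / theta m l.succ) (childFactor m ν X l) (fun _ _ _ => 1)
        (maskPair x0 l (tables u z ω))
      = partition m ν X (tables u z ω) l.castSucc := by
  filter_upwards [ae_all_iff.2 (h.normalized l)] with ω hω x0
  have := h.parentSum_eq x0 l dependsOn_const_one measurable_const (tables u z ω)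
  refine this.trans (tsum_congr fun α => ?_)
  have h1 : tilt m ν X l (fun _ => 1) (fullPath (tables u z ω).2 α) = 1 := by
    simp only [tilt, mul_one]
    exact hω α
  rw [h1, mul_one]

/-- The free function `Φ` covers the three sums of `a`, `a * b` and `a ^ 2 * b` at once. -/
lemma IsMarkedCascade.sum_child (x0 : ∀ l, 𝒳 l) (l : Fin k) (ω : Ω)
    (Φ : ℝ≥0∞ → ℝ≥0∞ → ℝ≥0∞) {F : (∀ l, 𝒳 l) → ℝ≥0∞} (hF : DependsOn F (before l.succ)) :
    ∑' α : nodes l.succ, Φ (nodeWeight m ν X (tables u z ω) l.succ α)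
        (F (fullPath (tables u z ω).2 α))
      = ∑' i : (Set.Iio l → ℕ) × ℕ, Φ (pointWeight (theta m l.succ) (childFactor m ν X l)
          (maskPair x0 l (tables u z ω)) (i.1, u l i.1 i.2 ω, z l i.1 i.2 ω))
          (childFun F l i.1 (maskPair x0 l (tables u z ω)) (z l i.1 i.2 ω)) := by
  rw [tsum_nodes_succ l fun α => Φ (nodeWeight m ν X (tables u z ω) l.succ α)
    (F (fullPath (tables u z ω).2 α))]
  refine tsum_congr fun i => ?_
  rw [← pointWeight_childFactor (x0 := x0) (h.theta_pos _).le, childFun_maskPair hF,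
    ← childFun_child hF]
  rfl

lemma IsMarkedCascade.lintegral_nodeSum_succ (l : Fin k) {F : (∀ l, 𝒳 l) → ℝ≥0∞}
    (hF : DependsOn F (before l.succ)) (hFm : Measurable F) :
    ∫⁻ ω, nodeSum m ν X (tables u z ω) l.succ F / partition m ν X (tables u z ω) l.succ ∂P
      = ∫⁻ ω, nodeSum m ν X (tables u z ω) l.castSucc (tilt m ν X l F) /
          partition m ν X (tables u z ω) l.castSucc ∂P := by
  obtain ⟨x0, hx⟩ := h.exists_isMarkedLevel l
  have hc := fun q => measurable_childFactor (m := m) (ν := ν) h.measurable l q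
  have key := hx.lintegral_div (h.theta_pos _)
    (theta_castSucc_lt_succ h.strictMono h.last_lt l) hc
    (fun q t y => childFactor_ne_top (h.theta_pos _).le q t y) (measurable_childFun hFm l)
  have e1 := fun ω => h.sum_child x0 l ω (fun a b => a * b) hF
  have e2 := fun ω => h.sum_child x0 l ω (fun a _ => a) hF
  simp only [nodeSum, partition, e1, e2]
  rw [key]
  refine lintegral_congr_ae ?_
  filter_upwards [h.parentSum_one l] with ω hω
  rw [hω x0, h.parentSum_eq x0 l hF hFm]
  rfl

lemma IsMarkedCascade.lintegral_diagSum_succ (l : Fin k) {F : (∀ l, 𝒳 l) → ℝ≥0∞}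
    (hF : DependsOn F (before l.succ)) (hFm : Measurable F) :
    ∫⁻ ω, diagSum m ν X (tables u z ω) l.succ F / partition m ν X (tables u z ω) l.succ ^ 2 ∂P
      = ENNReal.ofReal (1 - theta m l.castSucc / theta m l.succ) *
        ∫⁻ ω, nodeSum m ν X (tables u z ω) l.castSucc (tilt m ν X l F) /
          partition m ν X (tables u z ω) l.castSucc ∂P := by
  obtain ⟨x0, hx⟩ := h.exists_isMarkedLevel l
  have hc := fun q => measurable_childFactor (m := m) (ν := ν) h.measurable l q
  have key := hx.lintegral_sq_div (h.theta_pos _)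
    (theta_castSucc_lt_succ h.strictMono h.last_lt l) hc
    (fun q t y => childFactor_ne_top (h.theta_pos _).le q t y) (measurable_childFun hFm l)
  have e1 := fun ω => h.sum_child x0 l ω (fun a b => a ^ 2 * b) hF
  have e2 := fun ω => h.sum_child x0 l ω (fun a _ => a) hF
  simp only [diagSum, partition, e1, e2]
  rw [key]
  congr 1
  refine lintegral_congr_ae ?_
  filter_upwards [h.parentSum_one l] with ω hω
  rw [hω x0, h.parentSum_eq x0 l hF hFm]
  rfl

open Classical in
/-- One step of the recursion for sums over pairs of children; the parents satisfy `E`. -/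
lemma IsMarkedCascade.lintegral_pairs_succ (l : Fin k) {r : Fin k}
    {E : (Set.Iio l → ℕ) → (Set.Iio l → ℕ) → Prop}
    (hE : ∀ i j : (Set.Iio l → ℕ) × ℕ,
      Separate r (child l i.1 i.2) (child l j.1 j.2) ↔ E i.1 j.1 ∧ i ≠ j)
    {F G : (∀ l, 𝒳 l) → ℝ≥0∞}
    (hF : DependsOn F (before l.succ)) (hFm : Measurable F)
    (hG : DependsOn G (before l.succ)) (hGm : Measurable G) :
    ∫⁻ ω, pairSum m ν X (tables u z ω) r l.succ F G /
        partition m ν X (tables u z ω) l.succ ^ 2 ∂P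
      = ENNReal.ofReal (theta m l.castSucc / theta m l.succ) *
        ∫⁻ ω, (∑' q, ∑' q', if E q q' then
          (nodeWeight m ν X (tables u z ω) l.castSucc (extendZero l q) *
            tilt m ν X l F (fullPath (tables u z ω).2 (extendZero l q))) *
          (nodeWeight m ν X (tables u z ω) l.castSucc (extendZero l q') *
            tilt m ν X l G (fullPath (tables u z ω).2 (extendZero l q'))) else 0) /
          partition m ν X (tables u z ω) l.castSucc ^ 2 ∂P := by
  obtain ⟨x0, hx⟩ := h.exists_isMarkedLevel l
  have hc := fun q => measurable_childFactor (m := m) (ν := ν) h.measurable l q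
  have key := hx.lintegral_pairs_div (h.theta_pos _)
    (theta_castSucc_lt_succ h.strictMono h.last_lt l) hc
    (fun q t y => childFactor_ne_top (h.theta_pos _).le q t y) (measurable_childFun hFm l)
    (measurable_childFun hGm l) E
  have e2 := fun ω => h.sum_child x0 l ω (fun a _ => a) hF
  have e1 : ∀ ω, pairSum m ν X (tables u z ω) r l.succ F G
      = ∑' i : (Set.Iio l → ℕ) × ℕ, ∑' j : (Set.Iio l → ℕ) × ℕ, if E i.1 j.1 ∧ i ≠ j then
        (pointWeight (theta m l.succ) (childFactor m ν X l) (maskPair x0 l (tables u z ω))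
          (i.1, u l i.1 i.2 ω, z l i.1 i.2 ω) *
          childFun F l i.1 (maskPair x0 l (tables u z ω)) (z l i.1 i.2 ω)) *
        (pointWeight (theta m l.succ) (childFactor m ν X l) (maskPair x0 l (tables u z ω))
          (j.1, u l j.1 j.2 ω, z l j.1 j.2 ω) *
          childFun G l j.1 (maskPair x0 l (tables u z ω)) (z l j.1 j.2 ω)) else 0 := by
    intro ω
    have hw := fun i : (Set.Iio l → ℕ) × ℕ => pointWeight_childFactor (m := m) (ν := ν) (X := X)
      (x0 := x0) (l := l) (h.theta_pos _).le i.1 i.2 (tables u z ω)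
    have hF' := fun i : (Set.Iio l → ℕ) × ℕ => childFun_child hF i.1 i.2 (tables u z ω)
    have hG' := fun i : (Set.Iio l → ℕ) × ℕ => childFun_child hG i.1 i.2 (tables u z ω)
    rw [pairSum, tsum_nodes_succ l fun α => ∑' β : nodes l.succ, if Separate r α β then
      (nodeWeight m ν X (tables u z ω) l.succ α * F (fullPath (tables u z ω).2 α)) *
      (nodeWeight m ν X (tables u z ω) l.succ β * G (fullPath (tables u z ω).2 β)) else 0]
    refine tsum_congr fun i => ?_
    rw [tsum_nodes_succ l fun β => if Separate r (child l i.1 i.2) β then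
      (nodeWeight m ν X (tables u z ω) l.succ (child l i.1 i.2) *
        F (fullPath (tables u z ω).2 (child l i.1 i.2))) *
      (nodeWeight m ν X (tables u z ω) l.succ β * G (fullPath (tables u z ω).2 β)) else 0]
    refine tsum_congr fun j => ?_
    rw [← hw, ← hw, ← hF', ← hG', childFun_maskPair hF, childFun_maskPair hG]
    exact if_congr (hE i j) rfl rfl
  simp only [e1, partition, e2]
  refine key.trans ?_
  congr 1
  refine lintegral_congr_ae ?_
  filter_upwards [h.parentSum_one l] with ω hω
  rw [hω x0]
  have hA := fun q => lintegral_childFactor (ν := ν) (X := X) (x0 := x0) (h.theta_pos l.succ)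
    (h.theta_pos l.castSucc).le h.measurable hF hFm q (tables u z ω)
  have hB := fun q => lintegral_childFactor (ν := ν) (X := X) (x0 := x0) (h.theta_pos l.succ)
    (h.theta_pos l.castSucc).le h.measurable hG hGm q (tables u z ω)
  simp only [hA, hB]
  rfl

/-- Above the separation level the parents are still distinct, so pairs reduce to pairs. -/
lemma IsMarkedCascade.lintegral_pairSum_succ {l r : Fin k} (hr : r < l)
    {F G : (∀ l, 𝒳 l) → ℝ≥0∞}
    (hF : DependsOn F (before l.succ)) (hFm : Measurable F)
    (hG : DependsOn G (before l.succ)) (hGm : Measurable G) :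
    ∫⁻ ω, pairSum m ν X (tables u z ω) r l.succ F G /
        partition m ν X (tables u z ω) l.succ ^ 2 ∂P
      = ENNReal.ofReal (theta m l.castSucc / theta m l.succ) *
        ∫⁻ ω, pairSum m ν X (tables u z ω) r l.castSucc (tilt m ν X l F) (tilt m ν X l G) /
          partition m ν X (tables u z ω) l.castSucc ^ 2 ∂P := by
  classical
  rw [h.lintegral_pairs_succ l (E := fun q q' => Separate r (extendZero l q) (extendZero l q'))
    (separate_child_of_lt hr) hF hFm hG hGm]
  congr 1
  refine lintegral_congr fun ω => ?_
  congr 1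
  rw [pairSum, tsum_nodes_castSucc l fun α => ∑' β : nodes l.castSucc, if Separate r α β then
    (nodeWeight m ν X (tables u z ω) l.castSucc α *
      tilt m ν X l F (fullPath (tables u z ω).2 α)) *
    (nodeWeight m ν X (tables u z ω) l.castSucc β *
      tilt m ν X l G (fullPath (tables u z ω).2 β)) else 0]
  refine tsum_congr fun q => ?_
  rw [tsum_nodes_castSucc l fun β => if Separate r (extendZero l q) β then
    (nodeWeight m ν X (tables u z ω) l.castSucc (extendZero l q) *
      tilt m ν X l F (fullPath (tables u z ω).2 (extendZero l q))) *
    (nodeWeight m ν X (tables u z ω) l.castSucc β *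
      tilt m ν X l G (fullPath (tables u z ω).2 β)) else 0]

/-- At the separation level the two vertices have a common parent, so the double sum over parents
collapses to the diagonal and its weight appears squared. -/
lemma IsMarkedCascade.lintegral_pairSum_succ_self (l : Fin k)
    {F G : (∀ l, 𝒳 l) → ℝ≥0∞}
    (hF : DependsOn F (before l.succ)) (hFm : Measurable F)
    (hG : DependsOn G (before l.succ)) (hGm : Measurable G) :
    ∫⁻ ω, pairSum m ν X (tables u z ω) l l.succ F G /
        partition m ν X (tables u z ω) l.succ ^ 2 ∂P
      = ENNReal.ofReal (theta m l.castSucc / theta m l.succ) *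
        ∫⁻ ω, diagSum m ν X (tables u z ω) l.castSucc
          (fun x => tilt m ν X l F x * tilt m ν X l G x) /
          partition m ν X (tables u z ω) l.castSucc ^ 2 ∂P := by
  classical
  rw [h.lintegral_pairs_succ l (separate_child_self l) hF hFm hG hGm]
  congr 1
  refine lintegral_congr fun ω => ?_
  congr 1
  rw [diagSum, tsum_nodes_castSucc l fun α => nodeWeight m ν X (tables u z ω) l.castSucc α ^ 2 *
    (tilt m ν X l F (fullPath (tables u z ω).2 α) * tilt m ν X l G (fullPath (tables u z ω).2 α))]
  refine tsum_congr fun q => ?_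
  refine (tsum_eq_single q fun q' hq' => if_neg fun h => hq' h.symm).trans ?_
  rw [if_pos rfl]
  ring

end recursion

/-! ### Expectations along the tree and normalization of the densities -/

section treelaw

variable {Ω : Type*} [MeasurableSpace Ω] {P : Measure Ω} [IsProbabilityMeasure P]
  {k : ℕ} {𝒳 : Fin k → Type*} [∀ l, MeasurableSpace (𝒳 l)] {m : Fin (k + 1) → ℝ}
  {ν : (l : Fin k) → Kernel ((i : Set.Iio l) → 𝒳 i) (𝒳 l)} [∀ l, IsMarkovKernel (ν l)]
  {X : (∀ l, 𝒳 l) → ℝ}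
  {u : (l : Fin k) → (Set.Iio l → ℕ) → ℕ → Ω → ℝ}
  {z : (l : Fin k) → (Set.Iio l → ℕ) → ℕ → Ω → 𝒳 l}

lemma extendZero_restrict (l : Fin k) (α : Fin k → ℕ) :
    ∀ i ∈ before l.castSucc, extendZero l (fun i => α i) i = α i :=
  fun _ hi => extendZero_of_lt (mem_before_castSucc.1 hi) _

lemma child_restrict (l : Fin k) (α : Fin k → ℕ) :
    ∀ i ∈ before l.succ, child l (fun i => α i) (α l) i = α i := by
  intro i hi
  rcases (mem_before_succ.1 hi).eq_or_lt with rfl | h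
  · exact child_self _ _ _
  · exact child_of_lt h _ _

lemma apply_fullPath_eq {x0 : ∀ l, 𝒳 l} {l : Fin k} {F : (∀ l, 𝒳 l) → ℝ≥0∞}
    (hF : DependsOn F (before l.succ)) (t : Table 𝒳) (α : Fin k → ℕ) :
    F (fullPath t α) = F (Function.update
      (fullPath (mask x0 l t) (extendZero l fun i => α i)) l (t l (fun i => α i) (α l))) := by
  rw [← hF (fullPath_congr (child_restrict l α) t)]
  refine hF fun i hi => (fullPath_child l _ _ t i hi).trans ?_
  exact (update_congr_before (fullPath_mask t _) _ i hi).symm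

lemma levelOp_fullPath_eq {x0 : ∀ l, 𝒳 l} {l : Fin k} {F : (∀ l, 𝒳 l) → ℝ≥0∞}
    (hF : DependsOn F (before l.succ)) (t : Table 𝒳) (α : Fin k → ℕ) :
    levelOp ν l F (fullPath t α) = ∫⁻ y, F (Function.update
      (fullPath (mask x0 l t) (extendZero l fun i => α i)) l y)
        ∂childKernel ν l (fun i => α i) (mask x0 l t) := by
  rw [← dependsOn_levelOp hF (fullPath_congr (extendZero_restrict l α) t),
    ← dependsOn_levelOp hF (fullPath_mask (x0 := x0) t _), levelOp, restrict_fullPath_extendZero]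
  rfl

/-- Given the past, the marks of two different vertices of level `l` may be integrated out
independently. -/
lemma IsTreeProcess.lintegral_mul_eq (hz : IsTreeProcess P ν z) {l : Fin k} {α β : Fin k → ℕ}
    (hαβ : ∃ i ≤ l, α i ≠ β i) {F G : (∀ l, 𝒳 l) → ℝ≥0∞}
    (hF : DependsOn F (before l.succ)) (hFm : Measurable F)
    (hG : DependsOn G (before l.succ)) (hGm : Measurable G) :
    ∫⁻ ω, F (leafPath z α ω) * G (leafPath z β ω) ∂P
      = ∫⁻ ω, levelOp ν l F (leafPath z α ω) * levelOp ν l G (leafPath z β ω) ∂P := by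
  classical
  obtain ⟨ω0⟩ := P.nonempty_of_neZero
  set x0 : ∀ l, 𝒳 l := fun j => z j 0 0 ω0
  set a : (Set.Iio l → ℕ) × ℕ := (fun i => α i, α l)
  set b : (Set.Iio l → ℕ) × ℕ := (fun i => β i, β l)
  -- If the vertices differ before level `l`, their parents differ; if only at `l`, their numbers
  -- do. Either way the two marks are conditionally independent.
  have hab : a ≠ b := by
    intro h
    obtain ⟨i, hi, hne⟩ := hαβ
    rcases hi.eq_or_lt with rfl | hi
    · exact hne (congrArg Prod.snd h)
    · exact hne (congrFun (congrArg Prod.fst h) ⟨i, hi⟩)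
  set φ : (Set.Iio l → ℕ) × ℕ → Table 𝒳 → 𝒳 l → ℝ≥0∞ := fun i t y =>
    if i = a then F (Function.update (fullPath t (extendZero l i.1)) l y)
    else G (Function.update (fullPath t (extendZero l i.1)) l y) with hφ
  have hm : ∀ q : Set.Iio l → ℕ, Measurable fun p : Table 𝒳 × 𝒳 l =>
      Function.update (fullPath p.1 (extendZero l q)) l p.2 := fun q =>
    (measurable_updateProd l).comp
      (((measurable_fullPath _).comp measurable_fst).prodMk measurable_snd)
  have h := (hz.hasCondMarks x0 l).lintegral_prod {a, b} (g := fun _ => 1) measurable_const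
    (φ := φ) fun i => by
      by_cases hi : i = a
      · simp only [hφ, hi, if_true]; exact hFm.comp (hm a.1)
      · simp only [hφ, hi, if_false]; exact hGm.comp (hm i.1)
  simp only [one_mul, Finset.prod_pair hab, hφ, if_true, if_neg hab.symm] at h
  have e1 := fun ω => apply_fullPath_eq (x0 := x0) hF (fun j p n => z j p n ω) α
  have e2 := fun ω => apply_fullPath_eq (x0 := x0) hG (fun j p n => z j p n ω) β
  have e3 := fun ω => levelOp_fullPath_eq (ν := ν) (x0 := x0) hF (fun j p n => z j p n ω) α
  have e4 := fun ω => levelOp_fullPath_eq (ν := ν) (x0 := x0) hG (fun j p n => z j p n ω) β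
  calc _ = _ := lintegral_congr fun ω => congrArg₂ _ (e1 ω) (e2 ω)
    _ = _ := h
    _ = _ := (lintegral_congr fun ω => congrArg₂ _ (e3 ω) (e4 ω)).symm

/-- The two-vertex formula with a sibling of `α` as second vertex and the constant `1` there. -/
lemma IsTreeProcess.lintegral_eq (hz : IsTreeProcess P ν z) {l : Fin k} (α : Fin k → ℕ)
    {F : (∀ l, 𝒳 l) → ℝ≥0∞} (hF : DependsOn F (before l.succ)) (hFm : Measurable F) :
    ∫⁻ ω, F (leafPath z α ω) ∂P = ∫⁻ ω, levelOp ν l F (leafPath z α ω) ∂P := by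
  have h := hz.lintegral_mul_eq (l := l) (α := α) (β := Function.update α l (α l + 1))
    ⟨l, le_rfl, by simp⟩ hF hFm dependsOn_const_one measurable_const
  simpa [levelOp] using h

lemma IsTreeProcess.measurable_leafPath (hz : IsTreeProcess P ν z) (α : Fin k → ℕ) :
    Measurable (leafPath z α) :=
  measurable_pi_lambda _ fun l => hz.measurable l _ _

lemma dependsOn_exp_mul_levelFun (l : Fin k) :
    DependsOn (fun x : ∀ l, 𝒳 l =>
      ENNReal.ofReal (Real.exp (m l.succ * levelFun m ν X l.succ x))) (before l.succ) := by
  intro x x' h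
  change ENNReal.ofReal (Real.exp (m l.succ * levelFun m ν X l.succ x)) = _
  rw [dependsOn_levelFun l.succ h]

lemma measurable_exp_mul_levelFun (hX : Measurable X) (l : Fin k) :
    Measurable fun x : ∀ l, 𝒳 l =>
      ENNReal.ofReal (Real.exp (m l.succ * levelFun m ν X l.succ x)) :=
  ((measurable_levelFun hX l.succ).const_mul _).exp.ennreal_ofReal

/-- The exponential moment of level `l`. -/
lemma levelExp_castSucc_eq {l : Fin k} (hpos : 0 < m l.succ) (x : ∀ l, 𝒳 l) (hX : Measurable X)
    (hfin : levelOp ν l (fun x => ENNReal.ofReal (Real.exp (m l.succ * levelFun m ν X l.succ x))) x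
      ≠ ⊤) :
    levelExp m ν X l.castSucc x
      = levelOp ν l (fun x => ENNReal.ofReal (Real.exp (m l.succ * levelFun m ν X l.succ x))) x := by
  have hm : Measurable fun y => Real.exp (m l.succ *
      levelFun m ν X l.succ (Function.update x l y)) :=
    (((measurable_levelFun hX l.succ).comp
      ((measurable_updateProd l).comp measurable_prodMk_left)).const_mul _).exp
  set A := levelOp ν l (fun x => ENNReal.ofReal (Real.exp (m l.succ * levelFun m ν X l.succ x))) x
    with hA
  have hA0 : A ≠ 0 := by
    intro h0
    rw [hA, levelOp, lintegral_eq_zero_iff hm.ennreal_ofReal] at h0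
    have : ∀ᵐ y ∂ν l (fun i => x i), False := by
      filter_upwards [h0] with y hy
      simp only [Pi.zero_apply, ENNReal.ofReal_eq_zero] at hy
      exact absurd (Real.exp_pos _) (not_lt.2 hy)
    simp [ae_iff] at this
  have hint : ∫ y, Real.exp (m l.succ * levelFun m ν X l.succ (Function.update x l y))
      ∂ν l (fun i => x i) = A.toReal :=
    integral_eq_lintegral_of_nonneg_ae (Eventually.of_forall fun y => (Real.exp_pos _).le)
      hm.aestronglyMeasurable
  rw [levelExp, theta_castSucc, levelFun_castSucc, hint, ← mul_assoc,
    mul_one_div_cancel hpos.ne', one_mul, Real.exp_log (ENNReal.toReal_pos hA0 hfin),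
    ENNReal.ofReal_toReal hfin]

/-- From `e^{m x} ≤ 1 + e^{θ x}` for `0 < m < θ`, by distinguishing the sign of `x`. -/
lemma lintegral_exp_mul_le {l : Fin k} (hm : StrictMono m) (hm1 : m (Fin.last k) < 1) (hpos : 0 < m l.succ)
    (α : Fin k → ℕ) :
    ∫⁻ ω, ENNReal.ofReal (Real.exp (m l.succ * levelFun m ν X l.succ (leafPath z α ω))) ∂P
      ≤ 1 + ∫⁻ ω, levelExp m ν X l.succ (leafPath z α ω) ∂P := by
  have h1 := theta_castSucc_lt_succ hm hm1 l
  rw [theta_castSucc] at h1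
  calc _ ≤ ∫⁻ ω, (1 + levelExp m ν X l.succ (leafPath z α ω)) ∂P := by
        refine lintegral_mono fun ω => ?_
        simp only [levelExp]
        rw [← ENNReal.ofReal_one, ← ENNReal.ofReal_add zero_le_one (Real.exp_pos _).le]
        refine ENNReal.ofReal_le_ofReal ?_
        rcases le_total (levelFun m ν X l.succ (leafPath z α ω)) 0 with h | h
        · have := Real.exp_le_one_iff.2 (mul_nonpos_of_nonneg_of_nonpos hpos.le h)
          linarith [Real.exp_pos (theta m l.succ * levelFun m ν X l.succ (leafPath z α ω))]
        · have := Real.exp_le_exp.2 (mul_le_mul_of_nonneg_right h1.le h)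
          linarith
    _ = _ := by rw [lintegral_add_left measurable_const]; simp

/-- Downward induction from the moment assumption on `exp X`: lowering the exponent costs at most
the additive constant `1`, and averaging over one coordinate does not change the expectation. -/
lemma IsTreeProcess.lintegral_levelExp_lt_top (hz : IsTreeProcess P ν z) (hm0 : m 0 = 0)
    (hm : StrictMono m) (hm1 : m (Fin.last k) < 1) (hX : Measurable X)
    (hX_exp : ∀ γ, Integrable (fun ω => Real.exp (X (leafPath z γ ω))) P) (j : Fin (k + 1))
    (α : Fin k → ℕ) : ∫⁻ ω, levelExp m ν X j (leafPath z α ω) ∂P < ⊤ := by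
  induction j using Fin.reverseInduction with
  | last =>
    simp only [levelExp, theta_last, one_mul, levelFun_last]
    exact (hX_exp α).lintegral_lt_top
  | cast l ih =>
    have hpos := apply_succ_pos hm0 hm l
    have hle := lintegral_exp_mul_le (P := P) (ν := ν) (X := X) (z := z) hm hm1 hpos α
    rw [hz.lintegral_eq (l := l) α (dependsOn_exp_mul_levelFun l) (measurable_exp_mul_levelFun hX l)]
      at hle
    refine lt_of_le_of_lt (lintegral_mono fun ω => ?_)
      (hle.trans_lt (ENNReal.add_lt_top.2 ⟨ENNReal.one_lt_top, ih⟩))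
    by_cases hfin : levelOp ν l (fun x => ENNReal.ofReal (Real.exp (m l.succ *
        levelFun m ν X l.succ x))) (leafPath z α ω) = ⊤
    · simp only [hfin]; exact le_top
    · exact (levelExp_castSucc_eq hpos _ hX hfin).le

/-- Multiplied by `exp (m_l X_{l-1})` the density becomes `exp (m_l X_l)`, whose conditional
integral is that same factor. This needs a finite conditional moment, because the Bochner integral
in `levelFun` is `0` otherwise; the moment is finite almost surely. -/
lemma IsTreeProcess.levelOp_eDensity (hz : IsTreeProcess P ν z) (hm0 : m 0 = 0)
    (hm : StrictMono m) (hm1 : m (Fin.last k) < 1) (hX : Measurable X)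
    (hX_exp : ∀ γ, Integrable (fun ω => Real.exp (X (leafPath z γ ω))) P) (l : Fin k)
    (α : Fin k → ℕ) : ∀ᵐ ω ∂P, levelOp ν l (eDensity m ν X l) (leafPath z α ω) = 1 := by
  have hpos := apply_succ_pos hm0 hm l
  have hFm := measurable_exp_mul_levelFun (m := m) (ν := ν) hX l
  have hF := dependsOn_exp_mul_levelFun (m := m) (ν := ν) (X := X) l
  have hle := lintegral_exp_mul_le (P := P) (ν := ν) (X := X) (z := z) hm hm1 hpos α
  rw [hz.lintegral_eq (l := l) α hF hFm] at hle
  have hfin := ae_lt_top ((measurable_levelOp hFm).comp (hz.measurable_leafPath α))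
    (hle.trans_lt (ENNReal.add_lt_top.2 ⟨ENNReal.one_lt_top,
      hz.lintegral_levelExp_lt_top hm0 hm hm1 hX hX_exp l.succ α⟩)).ne
  filter_upwards [hfin] with ω hω
  set x := leafPath z α ω
  have h1 := levelExp_castSucc_eq hpos x hX hω.ne
  have h2 : levelExp m ν X l.castSucc x * levelOp ν l (eDensity m ν X l) x
      = levelExp m ν X l.castSucc x := by
    nth_rewrite 2 [h1]
    rw [levelOp, levelOp, ← lintegral_const_mul]
    · refine lintegral_congr fun y => ?_
      have h3 : levelFun m ν X l.castSucc (Function.update x l y) = levelFun m ν X l.castSucc x :=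
        dependsOn_levelFun l.castSucc fun i hi =>
          Function.update_of_ne (mem_before_castSucc.1 hi).ne _ _
      rw [levelExp, eDensity, ← ENNReal.ofReal_mul (Real.exp_pos _).le, density, ← Real.exp_add,
        theta_castSucc, h3]
      congr 2
      ring
    · exact (measurable_eDensity hX l).comp
        ((measurable_updateProd l).comp measurable_prodMk_left)
  exact (ENNReal.mul_eq_left (levelExp_pos _ _) (levelExp_ne_top _ _)).1 h2

end treelaw

/-! ### Induction over the levels -/

section induction

variable {Ω : Type*} [MeasurableSpace Ω] {P : Measure Ω} [IsProbabilityMeasure P]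
  {k : ℕ} {𝒳 : Fin k → Type*} [∀ l, MeasurableSpace (𝒳 l)] {m : Fin (k + 1) → ℝ}
  {ν : (l : Fin k) → Kernel ((i : Set.Iio l) → 𝒳 i) (𝒳 l)} [∀ l, IsMarkovKernel (ν l)]
  {X : (∀ l, 𝒳 l) → ℝ}
  {u : (l : Fin k) → (Set.Iio l → ℕ) → ℕ → Ω → ℝ}
  {z : (l : Fin k) → (Set.Iio l → ℕ) → ℕ → Ω → 𝒳 l}

/-- The product of the densities of the levels from `a` on and before `j`. -/
noncomputable def densProd (m : Fin (k + 1) → ℝ)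
    (ν : (l : Fin k) → Kernel ((i : Set.Iio l) → 𝒳 i) (𝒳 l)) (X : (∀ l, 𝒳 l) → ℝ) (a : ℕ)
    (j : Fin (k + 1)) (x : ∀ l, 𝒳 l) : ℝ≥0∞ :=
  ∏ i : Fin k with i.castSucc < j, if a ≤ (i : ℕ) then eDensity m ν X i x else 1

lemma densProd_eq_one {a : ℕ} {j : Fin (k + 1)} (h : (j : ℕ) ≤ a) (x : ∀ l, 𝒳 l) :
    densProd m ν X a j x = 1 := by
  refine Finset.prod_eq_one fun i hi => if_neg ?_
  have : (i : ℕ) < j := (Finset.mem_filter.1 hi).2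
  omega

lemma densProd_succ {a : ℕ} {l : Fin k} (h : a ≤ l) (x : ∀ l, 𝒳 l) :
    densProd m ν X a l.succ x = eDensity m ν X l x * densProd m ν X a l.castSucc x := by
  rw [densProd, prod_before_succ, if_pos h, densProd]

lemma dependsOn_densProd (a : ℕ) (j : Fin (k + 1)) : DependsOn (densProd m ν X a j) (before j) := by
  intro x x' h
  refine Finset.prod_congr rfl fun i hi => ?_
  have hi : i.castSucc < j := (Finset.mem_filter.1 hi).2
  rw [dependsOn_eDensity i fun b hb => h b (lt_of_le_of_lt
    (Fin.castSucc_le_castSucc_iff.2 (mem_before_succ.1 hb)) hi)]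

lemma measurable_densProd (hX : Measurable X) (a : ℕ) (j : Fin (k + 1)) :
    Measurable (densProd m ν X a j) := by
  refine Finset.measurable_prod _ fun i _ => ?_
  split_ifs
  · exact measurable_eDensity hX i
  · exact measurable_const

lemma dependsOn_mul {s : Set (Fin k)} {F G : (∀ l, 𝒳 l) → ℝ≥0∞} (hF : DependsOn F s)
    (hG : DependsOn G s) : DependsOn (fun x => F x * G x) s := by
  intro x x' h
  change F x * G x = F x' * G x'
  rw [hF h, hG h]

/-- Only the density of level `l` reads coordinate `l`; the earlier ones leave the integral. -/
lemma levelOp_densProd_mul (hX : Measurable X) {a : ℕ} {l : Fin k} (h : a ≤ l)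
    {F : (∀ l, 𝒳 l) → ℝ≥0∞} (hFm : Measurable F) (x : ∀ l, 𝒳 l) :
    levelOp ν l (fun x => densProd m ν X a l.succ x * F x) x
      = densProd m ν X a l.castSucc x * tilt m ν X l F x := by
  rw [tilt, levelOp, levelOp, ← lintegral_const_mul]
  · refine lintegral_congr fun y => ?_
    rw [densProd_succ h, dependsOn_densProd a l.castSucc (x := Function.update x l y) (y := x)
      fun i hi => Function.update_of_ne (mem_before_castSucc.1 hi).ne _ _]
    ring
  · exact ((measurable_eDensity hX l).fun_mul hFm).comp
      ((measurable_updateProd l).comp measurable_prodMk_left)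

variable (h : IsMarkedCascade P m ν X u z)
include h

lemma IsMarkedCascade.lintegral_densProd_succ (l : Fin k) (α : Fin k → ℕ)
    {F : (∀ l, 𝒳 l) → ℝ≥0∞} (hF : DependsOn F (before l.succ)) (hFm : Measurable F) :
    ∫⁻ ω, densProd m ν X 0 l.succ (leafPath z α ω) * F (leafPath z α ω) ∂P
      = ∫⁻ ω, densProd m ν X 0 l.castSucc (leafPath z α ω) *
          tilt m ν X l F (leafPath z α ω) ∂P := by
  rw [h.tree.lintegral_eq α (dependsOn_mul (dependsOn_densProd 0 l.succ) hF)
    ((measurable_densProd h.measurable 0 l.succ).fun_mul hFm)]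
  simp only [levelOp_densProd_mul h.measurable (Nat.zero_le _) hFm]

lemma IsMarkedCascade.lintegral_densProd_pair_succ {r l : Fin k} (hr : r ≤ l) {α β : Fin k → ℕ}
    (hαβ : Separate r α β) {F G : (∀ l, 𝒳 l) → ℝ≥0∞}
    (hF : DependsOn F (before l.succ)) (hFm : Measurable F)
    (hG : DependsOn G (before l.succ)) (hGm : Measurable G) :
    ∫⁻ ω, (densProd m ν X 0 l.succ (leafPath z α ω) * F (leafPath z α ω)) *
        (densProd m ν X r l.succ (leafPath z β ω) * G (leafPath z β ω)) ∂P
      = ∫⁻ ω, (densProd m ν X 0 l.castSucc (leafPath z α ω) * tilt m ν X l F (leafPath z α ω)) *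
        (densProd m ν X r l.castSucc (leafPath z β ω) * tilt m ν X l G (leafPath z β ω)) ∂P := by
  rw [h.tree.lintegral_mul_eq ⟨r, hr, hαβ.2⟩
    (dependsOn_mul (dependsOn_densProd 0 l.succ) hF)
    ((measurable_densProd h.measurable 0 l.succ).fun_mul hFm)
    (dependsOn_mul (dependsOn_densProd r l.succ) hG)
    ((measurable_densProd h.measurable r l.succ).fun_mul hGm)]
  simp only [levelOp_densProd_mul h.measurable (Nat.zero_le _) hFm,
    levelOp_densProd_mul h.measurable hr hGm]

/-- Both sides obey the recursion `F ↦ tilt F`. At the root there is one vertex, whose weight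
cancels. -/
lemma IsMarkedCascade.lintegral_nodeSum (j : Fin (k + 1)) (α : Fin k → ℕ)
    {F : (∀ l, 𝒳 l) → ℝ≥0∞} (hF : DependsOn F (before j)) (hFm : Measurable F) :
    ∫⁻ ω, nodeSum m ν X (tables u z ω) j F / partition m ν X (tables u z ω) j ∂P
      = ∫⁻ ω, densProd m ν X 0 j (leafPath z α ω) * F (leafPath z α ω) ∂P := by
  induction j using Fin.induction generalizing F with
  | zero =>
    refine lintegral_congr fun ω => ?_
    rw [nodeSum, partition, densProd_eq_one (by simp), one_mul,
      tsum_nodes_zero fun α => nodeWeight m ν X (tables u z ω) 0 α * F (fullPath _ α),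
      tsum_nodes_zero fun α => nodeWeight m ν X (tables u z ω) 0 α]
    have h1 : nodeWeight m ν X (tables u z ω) 0 0 = levelExp m ν X 0 (fullPath (tables u z ω).2 0) := by
      simp [nodeWeight, pointProd]
    rw [h1, mul_div_assoc, mul_comm, ENNReal.div_mul_cancel (levelExp_pos _ _)
      (levelExp_ne_top _ _)]
    exact hF fun i hi => absurd hi (by simp)
  | succ l ih =>
    rw [h.lintegral_nodeSum_succ l hF hFm, h.lintegral_densProd_succ l α hF hFm,
      ih (dependsOn_tilt hF) (measurable_tilt h.measurable hFm)]

/-- The diagonal rule and the first-order rule lead to the same quotient one level lower, with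
constants `1 - ρ` and `1`. At the root the constant is `1` because `m_0 = 0`. -/
lemma IsMarkedCascade.lintegral_diagSum (j : Fin (k + 1))
    {F : (∀ l, 𝒳 l) → ℝ≥0∞} (hF : DependsOn F (before j)) (hFm : Measurable F) :
    ∫⁻ ω, diagSum m ν X (tables u z ω) j F / partition m ν X (tables u z ω) j ^ 2 ∂P
      = ENNReal.ofReal (1 - m j / theta m j) *
        ∫⁻ ω, nodeSum m ν X (tables u z ω) j F / partition m ν X (tables u z ω) j ∂P := by
  rcases Fin.eq_zero_or_eq_succ j with rfl | ⟨l, rfl⟩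
  · rw [h.zero, zero_div, sub_zero, ENNReal.ofReal_one, one_mul]
    refine lintegral_congr fun ω => ?_
    rw [nodeSum, partition, diagSum,
      tsum_nodes_zero fun α => nodeWeight m ν X (tables u z ω) 0 α * F (fullPath _ α),
      tsum_nodes_zero fun α => nodeWeight m ν X (tables u z ω) 0 α ^ 2 * F (fullPath _ α),
      tsum_nodes_zero fun α => nodeWeight m ν X (tables u z ω) 0 α]
    have h1 : nodeWeight m ν X (tables u z ω) 0 0 = levelExp m ν X 0 (fullPath (tables u z ω).2 0) := by
      simp [nodeWeight, pointProd]
    have h2 := levelExp_pos (m := m) (ν := ν) (X := X) 0 (fullPath (tables u z ω).2 0)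
    have h3 := levelExp_ne_top (m := m) (ν := ν) (X := X) 0 (fullPath (tables u z ω).2 0)
    rw [h1, ENNReal.mul_div_right_comm, ENNReal.mul_div_right_comm, ENNReal.div_self h2 h3,
      ENNReal.div_self (pow_ne_zero 2 h2) (ENNReal.pow_ne_top h3)]
  · rw [h.lintegral_diagSum_succ l hF hFm, h.lintegral_nodeSum_succ l hF hFm, theta_castSucc]

/-- The factor `θ_j` on the left absorbs the ratio of each step, which makes the product telescope.
The densities on the common part of the two paths are counted once, with `α`. -/
lemma IsMarkedCascade.lintegral_pairSum {r : Fin k} {α β : Fin k → ℕ} (hαβ : Separate r α β)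
    (j : Fin (k + 1)) (hj : r.castSucc < j) {F G : (∀ l, 𝒳 l) → ℝ≥0∞}
    (hF : DependsOn F (before j)) (hFm : Measurable F)
    (hG : DependsOn G (before j)) (hGm : Measurable G) :
    ENNReal.ofReal (theta m j) * ∫⁻ ω, pairSum m ν X (tables u z ω) r j F G /
        partition m ν X (tables u z ω) j ^ 2 ∂P
      = ENNReal.ofReal (m r.succ - m r.castSucc) *
        ∫⁻ ω, (densProd m ν X 0 j (leafPath z α ω) * F (leafPath z α ω)) *
          (densProd m ν X r j (leafPath z β ω) * G (leafPath z β ω)) ∂P := by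
  induction j using Fin.induction generalizing F G with
  | zero => exact absurd hj (by simp)
  | succ l ih =>
    have hr : r ≤ l := Fin.castSucc_lt_succ_iff.1 hj
    have hθ : ENNReal.ofReal (theta m l.succ) * ENNReal.ofReal (theta m l.castSucc / theta m l.succ)
        = ENNReal.ofReal (theta m l.castSucc) := by
      rw [← ENNReal.ofReal_mul (h.theta_pos _).le, mul_div_cancel₀ _ (h.theta_pos _).ne']
    have hF' := dependsOn_tilt (m := m) (ν := ν) (X := X) hF
    have hG' := dependsOn_tilt (m := m) (ν := ν) (X := X) hG
    have hFm' := measurable_tilt (m := m) (ν := ν) (l := l) h.measurable hFm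
    have hGm' := measurable_tilt (m := m) (ν := ν) (l := l) h.measurable hGm
    rw [h.lintegral_densProd_pair_succ hr hαβ hF hFm hG hGm]
    rcases hr.eq_or_lt with rfl | hlt
    -- At the separation level the constant is `θ (1 - m_{r-1} / θ)` with `θ = m_r`, that is, `m_r -
    -- m_{r-1}`.
    · rw [h.lintegral_pairSum_succ_self r hF hFm hG hGm, ← mul_assoc, hθ,
        h.lintegral_diagSum r.castSucc (dependsOn_mul hF' hG') (hFm'.fun_mul hGm'),
        h.lintegral_nodeSum r.castSucc α (dependsOn_mul hF' hG') (hFm'.fun_mul hGm'), ← mul_assoc,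
        ← ENNReal.ofReal_mul (h.theta_pos _).le, mul_sub, mul_div_cancel₀ _ (h.theta_pos _).ne',
        mul_one, theta_castSucc]
      congr 1
      refine lintegral_congr fun ω => ?_
      -- Below level `r` nothing is left of the product along `β`, and the two paths agree there.
      rw [densProd_eq_one (a := r) (by simp), one_mul, mul_assoc]
      congr 2
      exact hG' (fullPath_congr (fun i hi => hαβ.1 i (mem_before_castSucc.1 hi))
        (tables u z ω).2)
    · rw [h.lintegral_pairSum_succ hlt hF hFm hG hGm, ← mul_assoc, hθ,
        ih (Fin.castSucc_lt_castSucc_iff.2 hlt) hF' hFm' hG' hGm']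

end induction

/-! ### Gibbs averages over the leaves -/

section leaves

variable {Ω : Type*} [MeasurableSpace Ω] {P : Measure Ω} [IsProbabilityMeasure P]
  {k : ℕ} {𝒳 : Fin k → Type*} [∀ l, MeasurableSpace (𝒳 l)] {m : Fin (k + 1) → ℝ}
  {ν : (l : Fin k) → Kernel ((i : Set.Iio l) → 𝒳 i) (𝒳 l)} [∀ l, IsMarkovKernel (ν l)]
  {X : (∀ l, 𝒳 l) → ℝ}
  {u : (l : Fin k) → (Set.Iio l → ℕ) → ℕ → Ω → ℝ}
  {z : (l : Fin k) → (Set.Iio l → ℕ) → ℕ → Ω → 𝒳 l}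

/-- The unnormalized Gibbs weight of the leaf `γ`. -/
noncomputable def gibbsWeight (u : (l : Fin k) → (Set.Iio l → ℕ) → ℕ → Ω → ℝ)
    (z : (l : Fin k) → (Set.Iio l → ℕ) → ℕ → Ω → 𝒳 l) (X : (∀ l, 𝒳 l) → ℝ) (γ : Fin k → ℕ)
    (ω : Ω) : ℝ≥0∞ :=
  (∏ l, ENNReal.ofReal (u l (fun i => γ i) (γ l) ω)) * ENNReal.ofReal (Real.exp (X (leafPath z γ ω)))

lemma nodeWeight_last (γ : Fin k → ℕ) (ω : Ω) :
    nodeWeight m ν X (tables u z ω) (Fin.last k) γ = gibbsWeight u z X γ ω := by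
  rw [nodeWeight, pointProd, theta_last, ENNReal.rpow_one, levelExp, theta_last, one_mul,
    levelFun_last, Finset.filter_true_of_mem fun i _ => Fin.castSucc_lt_last i]
  rfl

lemma partition_last (ω : Ω) :
    partition m ν X (tables u z ω) (Fin.last k) = ∑' γ, gibbsWeight u z X γ ω := by
  rw [partition, tsum_nodes_last fun α => nodeWeight m ν X (tables u z ω) (Fin.last k) α]
  exact tsum_congr fun γ => nodeWeight_last γ ω

instance countable_pairsAt (r : Fin k) : Countable (PairsAt r) := Subtype.countable

open Classical in
lemma tsum_pairsAt (r : Fin k) (f : (Fin k → ℕ) → (Fin k → ℕ) → ℝ≥0∞) :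
    ∑' q : PairsAt r, f q.1.1 q.1.2 = ∑' γ, ∑' δ, if Separate r γ δ then f γ δ else 0 := by
  have h := tsum_subtype {p : (Fin k → ℕ) × (Fin k → ℕ) | wedge p.1 p.2 = (r : ℕ) + 1}
    fun p => f p.1 p.2
  refine h.trans (ENNReal.tsum_prod'.trans (tsum_congr fun γ => tsum_congr fun δ => ?_))
  simp only [Set.indicator, Set.mem_ofPred_eq, wedge_eq_iff]

lemma pairSum_last (r : Fin k) (F G : (∀ l, 𝒳 l) → ℝ≥0∞) (ω : Ω) :
    pairSum m ν X (tables u z ω) r (Fin.last k) F G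
      = ∑' q : PairsAt r, (gibbsWeight u z X q.1.1 ω * F (leafPath z q.1.1 ω)) *
          (gibbsWeight u z X q.1.2 ω * G (leafPath z q.1.2 ω)) := by
  classical
  rw [tsum_pairsAt r fun γ δ => (gibbsWeight u z X γ ω * F (leafPath z γ ω)) *
    (gibbsWeight u z X δ ω * G (leafPath z δ ω)), pairSum, tsum_nodes_last fun α =>
    ∑' β : nodes (Fin.last k), if Separate r (α : Fin k → ℕ) β then
    (nodeWeight m ν X (tables u z ω) (Fin.last k) α * F (fullPath (tables u z ω).2 α)) *
      (nodeWeight m ν X (tables u z ω) (Fin.last k) β * G (fullPath (tables u z ω).2 β)) else 0]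
  refine tsum_congr fun γ => ?_
  rw [tsum_nodes_last fun β => if Separate r γ β then
    (nodeWeight m ν X (tables u z ω) (Fin.last k) γ * F (fullPath (tables u z ω).2 γ)) *
      (nodeWeight m ν X (tables u z ω) (Fin.last k) β * G (fullPath (tables u z ω).2 β)) else 0]
  simp only [nodeWeight_last]
  rfl

variable (h : IsMarkedCascade P m ν X u z)
include h

lemma IsMarkedCascade.measurable_gibbsWeight (γ : Fin k → ℕ) :
    Measurable (gibbsWeight u z X γ) := by
  have hu := fun l : Fin k => h.cascade.measurable l (fun i => γ i) (γ l)
  have hX := h.measurable.comp (h.tree.measurable_leafPath γ)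
  exact (Finset.measurable_prod _ fun l _ => (hu l).ennreal_ofReal).fun_mul
    hX.exp.ennreal_ofReal

/-- Each density has conditional mean `1`, so the product is a probability density. -/
lemma IsMarkedCascade.lintegral_densProd (j : Fin (k + 1)) (α : Fin k → ℕ) :
    ∫⁻ ω, densProd m ν X 0 j (leafPath z α ω) ∂P = 1 := by
  induction j using Fin.induction with
  | zero =>
    simp only [densProd_eq_one (a := 0) (j := (0 : Fin (k + 1))) (by simp)]
    simp
  | succ l ih =>
    have h1 := h.lintegral_densProd_succ l α dependsOn_const_one measurable_const
    simp only [mul_one, tilt] at h1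
    rw [h1, ← ih]
    refine lintegral_congr_ae ?_
    filter_upwards [h.normalized l α] with ω hω
    rw [hω, mul_one]

/-- The partition function is almost surely positive and finite. -/
lemma IsMarkedCascade.ae_tsum_gibbsWeight :
    ∀ᵐ ω ∂P, ∑' γ, gibbsWeight u z X γ ω ≠ 0 ∧ ∑' γ, gibbsWeight u z X γ ω ≠ ⊤ := by
  have h1 := h.lintegral_nodeSum (Fin.last k) 0 dependsOn_const_one measurable_const
  simp only [nodeSum, mul_one, h.lintegral_densProd] at h1
  change ∫⁻ ω, partition m ν X (tables u z ω) (Fin.last k) /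
    partition m ν X (tables u z ω) (Fin.last k) ∂P = 1 at h1
  simp only [partition_last] at h1
  set S := fun ω => ∑' γ, gibbsWeight u z X γ ω with hS
  have hSm : Measurable S := Measurable.tsum h.measurable_gibbsWeight
  -- The quotient never exceeds `1`, and it is `0` when `S` is `0` or `⊤`; mean `1` therefore
  -- excludes both values almost surely.
  have h2 : ∀ᵐ ω ∂P, S ω / S ω = 1 := by
    refine ae_eq_of_ae_le_of_lintegral_le (g := fun _ => 1)
      (Eventually.of_forall fun ω => ENNReal.div_self_le_one) ?_ aemeasurable_const ?_
    · exact (lt_of_le_of_lt (lintegral_mono fun ω => ENNReal.div_self_le_one) (by simp)).ne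
    · simp only [lintegral_one, measure_univ]
      exact h1.ge
  filter_upwards [h2] with ω hω
  refine ⟨fun h0 => ?_, fun h0 => ?_⟩
  · simp [show S ω = 0 from h0] at hω
  · simp [show S ω = ⊤ from h0] at hω

/-- The recursion propagates products of one function per path; at the last level these functions
may depend on all coordinates. -/
lemma IsMarkedCascade.lintegral_pairs_mul {r : Fin k} {α β : Fin k → ℕ} (hαβ : Separate r α β)
    {F G : (∀ l, 𝒳 l) → ℝ≥0∞} (hF : Measurable F) (hG : Measurable G) :
    ∫⁻ ω, (∑' q : PairsAt r, gibbsWeight u z X q.1.1 ω * gibbsWeight u z X q.1.2 ω *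
        (F (leafPath z q.1.1 ω) * G (leafPath z q.1.2 ω))) /
          (∑' γ, gibbsWeight u z X γ ω) ^ 2 ∂P
      = ENNReal.ofReal (m r.succ - m r.castSucc) *
        ∫⁻ ω, densProd m ν X 0 (Fin.last k) (leafPath z α ω) *
          densProd m ν X r (Fin.last k) (leafPath z β ω) *
          (F (leafPath z α ω) * G (leafPath z β ω)) ∂P := by
  have hdep : ∀ F : (∀ l, 𝒳 l) → ℝ≥0∞, DependsOn F (before (Fin.last k)) := fun F x y hxy => by
    rw [show x = y from funext fun i => hxy i (Fin.castSucc_lt_last i)]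
  have key := h.lintegral_pairSum hαβ (Fin.last k) (Fin.castSucc_lt_last r) (hdep F) hF (hdep G) hG
  rw [theta_last, ENNReal.ofReal_one, one_mul] at key
  simp only [pairSum_last, partition_last] at key
  simp only [mul_mul_mul_comm _ _ (F _) (G _)]
  exact key

/-- The average of `H (Z_γ, Z_δ)` over pairs of leaves that separate at level `r`. -/
theorem IsMarkedCascade.lintegral_pairs {r : Fin k} {α β : Fin k → ℕ} (hαβ : Separate r α β)
    {H : (∀ l, 𝒳 l) × (∀ l, 𝒳 l) → ℝ≥0∞} (hH : Measurable H) :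
    ∫⁻ ω, (∑' q : PairsAt r, gibbsWeight u z X q.1.1 ω * gibbsWeight u z X q.1.2 ω *
        H (leafPath z q.1.1 ω, leafPath z q.1.2 ω)) / (∑' γ, gibbsWeight u z X γ ω) ^ 2 ∂P
      = ENNReal.ofReal (m r.succ - m r.castSucc) *
        ∫⁻ ω, densProd m ν X 0 (Fin.last k) (leafPath z α ω) *
          densProd m ν X r (Fin.last k) (leafPath z β ω) * H (leafPath z α ω, leafPath z β ω) ∂P := by
  have hw := h.measurable_gibbsWeight
  have hS : Measurable fun ω => (∑' γ, gibbsWeight u z X γ ω) ^ 2 :=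
    (Measurable.tsum hw).pow_const 2
  have hZ := h.tree.measurable_leafPath
  set D : Ω → ℝ≥0∞ := fun ω => densProd m ν X 0 (Fin.last k) (leafPath z α ω) *
    densProd m ν X r (Fin.last k) (leafPath z β ω) with hD
  have hDm : Measurable D := ((measurable_densProd h.measurable 0 _).comp (hZ α)).fun_mul
    ((measurable_densProd h.measurable r _).comp (hZ β))
  set ρ : PairsAt r → Ω → ℝ≥0∞ := fun q ω => gibbsWeight u z X q.1.1 ω *
    gibbsWeight u z X q.1.2 ω / (∑' γ, gibbsWeight u z X γ ω) ^ 2 with hρ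
  have hρm : ∀ q, Measurable (ρ q) := fun q => ((hw _).fun_mul (hw _)).div hS
  set μ₁ : Measure ((∀ l, 𝒳 l) × (∀ l, 𝒳 l)) := Measure.sum fun q : PairsAt r =>
    (P.withDensity (ρ q)).map fun ω => (leafPath z q.1.1 ω, leafPath z q.1.2 ω) with hμ₁
  set μ₂ : Measure ((∀ l, 𝒳 l) × (∀ l, 𝒳 l)) := ENNReal.ofReal (m r.succ - m r.castSucc) •
    (P.withDensity D).map fun ω => (leafPath z α ω, leafPath z β ω) with hμ₂
  have e1 : ∀ {H : (∀ l, 𝒳 l) × (∀ l, 𝒳 l) → ℝ≥0∞}, Measurable H → ∫⁻ x, H x ∂μ₁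
      = ∫⁻ ω, (∑' q : PairsAt r, gibbsWeight u z X q.1.1 ω * gibbsWeight u z X q.1.2 ω *
        H (leafPath z q.1.1 ω, leafPath z q.1.2 ω)) / (∑' γ, gibbsWeight u z X γ ω) ^ 2 ∂P := by
    intro H hH
    have hHq : ∀ q : PairsAt r, Measurable fun ω => H (leafPath z q.1.1 ω, leafPath z q.1.2 ω) :=
      fun q => hH.comp ((hZ _).prodMk (hZ _))
    have hm : ∀ q : PairsAt r, Measurable fun ω => gibbsWeight u z X q.1.1 ω *
        gibbsWeight u z X q.1.2 ω * H (leafPath z q.1.1 ω, leafPath z q.1.2 ω) *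
        ((∑' γ, gibbsWeight u z X γ ω) ^ 2)⁻¹ := fun q =>
      (((hw _).fun_mul (hw _)).fun_mul (hHq q)).fun_mul hS.inv
    simp only [div_eq_mul_inv, ← ENNReal.tsum_mul_right]
    rw [hμ₁, lintegral_sum_measure, lintegral_tsum fun q => (hm q).aemeasurable]
    refine tsum_congr fun q => ?_
    rw [lintegral_map hH ((hZ _).prodMk (hZ _)),
      lintegral_withDensity_eq_lintegral_mul _ (hρm q) (hHq q)]
    refine lintegral_congr fun ω => ?_
    simp only [Pi.mul_apply, hρ, div_eq_mul_inv]
    ring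
  have e2 : ∀ {H : (∀ l, 𝒳 l) × (∀ l, 𝒳 l) → ℝ≥0∞}, Measurable H → ∫⁻ x, H x ∂μ₂
      = ENNReal.ofReal (m r.succ - m r.castSucc) *
        ∫⁻ ω, D ω * H (leafPath z α ω, leafPath z β ω) ∂P := by
    intro H hH
    rw [hμ₂, lintegral_smul_measure, smul_eq_mul, lintegral_map hH ((hZ _).prodMk (hZ _)),
      lintegral_withDensity_eq_lintegral_mul _ hDm
        (g := fun ω => H (leafPath z α ω, leafPath z β ω)) (hH.comp ((hZ _).prodMk (hZ _)))]
    rfl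
  -- The pairs at level `r` are among all pairs, whose weights sum to the square of the denominator;
  -- the mass is at most `1`.
  have hfin : IsFiniteMeasure μ₁ := by
    refine ⟨?_⟩
    rw [← lintegral_one, e1 (H := fun _ => 1) measurable_const]
    refine lt_of_le_of_lt (lintegral_mono (g := fun _ => 1) fun ω => ?_) (by simp)
    refine ENNReal.div_le_of_le_mul ?_
    rw [one_mul, pow_two, ← ENNReal.tsum_mul_left]
    simp only [← ENNReal.tsum_mul_right, mul_one]
    classical
    rw [tsum_pairsAt r fun γ δ => gibbsWeight u z X γ ω * gibbsWeight u z X δ ω, ENNReal.tsum_comm]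
    refine ENNReal.tsum_le_tsum fun δ => ENNReal.tsum_le_tsum fun γ => ?_
    split_ifs
    · exact le_rfl
    · exact zero_le
  -- Indicators of rectangles are product test functions, and rectangles determine a finite measure
  -- on the product.
  have hμ : μ₁ = μ₂ := by
    refine Measure.ext_prod fun {s t} hs ht => ?_
    have h1s : Measurable (s.indicator fun _ => (1 : ℝ≥0∞)) := measurable_const.indicator hs
    have h1t : Measurable (t.indicator fun _ => (1 : ℝ≥0∞)) := measurable_const.indicator ht
    have hI : (s ×ˢ t).indicator (1 : (∀ l, 𝒳 l) × (∀ l, 𝒳 l) → ℝ≥0∞)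
        = fun x => s.indicator (fun _ => 1) x.1 * t.indicator (fun _ => 1) x.2 := by
      funext x
      by_cases h1 : x.1 ∈ s <;> by_cases h2 : x.2 ∈ t <;> simp [Set.indicator, h1, h2]
    have hIm : Measurable fun x : (∀ l, 𝒳 l) × (∀ l, 𝒳 l) =>
        s.indicator (fun _ => (1 : ℝ≥0∞)) x.1 * t.indicator (fun _ => (1 : ℝ≥0∞)) x.2 :=
      (h1s.comp measurable_fst).fun_mul (h1t.comp measurable_snd)
    rw [← lintegral_indicator_one (hs.prod ht), ← lintegral_indicator_one (hs.prod ht), hI,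
      e1 hIm, e2 hIm]
    exact h.lintegral_pairs_mul hαβ h1s h1t
  rw [← e1 hH, hμ, e2 hH]

end leaves

/-! ### Passage from `[0, ∞]` to real weights -/

section final

variable {Ω : Type*} [MeasurableSpace Ω] {P : Measure Ω} [IsProbabilityMeasure P]
  {k : ℕ} {𝒳 : Fin k → Type*} [∀ l, MeasurableSpace (𝒳 l)] {m : Fin (k + 1) → ℝ}
  {ν : (l : Fin k) → Kernel ((i : Set.Iio l) → 𝒳 i) (𝒳 l)} [∀ l, IsMarkovKernel (ν l)]
  {X : (∀ l, 𝒳 l) → ℝ}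
  {u : (l : Fin k) → (Set.Iio l → ℕ) → ℕ → Ω → ℝ}
  {z : (l : Fin k) → (Set.Iio l → ℕ) → ℕ → Ω → 𝒳 l}

/-- The intensity does not charge `(-∞, 0]`, so the number of points there is Poisson with mean `0`.
-/
lemma IsDecreasingPoisson.ae_pos {s : ℝ} {v : ℕ → Ω → ℝ}
    (h : IsDecreasingPoisson P (stableIntensity s) v) : ∀ᵐ ω ∂P, ∀ n, 0 < v n ω := by
  have h0 : stableIntensity s (Set.Iic 0) = 0 := by
    rw [stableIntensity, withDensity_apply _ measurableSet_Iic,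
      Measure.restrict_restrict measurableSet_Iic, Set.Iic_inter_Ioi, Set.Ioc_self,
      Measure.restrict_empty, lintegral_zero_measure]
  have h1 := h.law_of_finite (Set.Iic 0) measurableSet_Iic (by simp [h0]) 0
  rw [h0] at h1
  have h2 : P {ω | pointCount v (Set.Iic 0) ω = ((0 : ℕ) : ℕ∞)} = 1 := by
    rw [h1, poissonMeasure_singleton]; simp
  have hset : {ω | pointCount v (Set.Iic 0) ω = ((0 : ℕ) : ℕ∞)} = ⋂ n, v n ⁻¹' Set.Ioi 0 := by
    ext ω
    simp [pointCount, Set.eq_empty_iff_forall_notMem]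
  have hm : MeasurableSet (⋂ n, v n ⁻¹' Set.Ioi 0) :=
    MeasurableSet.iInter fun n => h.measurable n measurableSet_Ioi
  rw [hset] at h2
  filter_upwards [(mem_ae_iff_prob_eq_one hm).2 h2] with ω hω n
  exact Set.mem_iInter.1 hω n

/-- The real Gibbs weights `v_γ exp X_γ`. -/
noncomputable def realWeight (u : (l : Fin k) → (Set.Iio l → ℕ) → ℕ → Ω → ℝ)
    (z : (l : Fin k) → (Set.Iio l → ℕ) → ℕ → Ω → 𝒳 l) (X : (∀ l, 𝒳 l) → ℝ) (γ : Fin k → ℕ)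
    (ω : Ω) : ℝ := leafPoint u γ ω * Real.exp (X (leafPath z γ ω))

lemma densProd_mul_densProd (r : Fin k) (x y : ∀ l, 𝒳 l) :
    densProd m ν X 0 (Fin.last k) x * densProd m ν X r (Fin.last k) y
      = ENNReal.ofReal (pairDensity m ν X r x y) := by
  have hd : ∀ l x, 0 ≤ density m ν X l x := fun l x => (Real.exp_pos _).le
  have e1 : ∀ (a : ℕ) x, densProd m ν X a (Fin.last k) x
      = ENNReal.ofReal (∏ l : Fin k, if a ≤ (l : ℕ) then density m ν X l x else 1) := by
    intro a x
    rw [densProd, Finset.filter_true_of_mem fun i _ => Fin.castSucc_lt_last i,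
      ENNReal.ofReal_prod_of_nonneg fun l _ => by split_ifs; exacts [hd l x, zero_le_one]]
    refine Finset.prod_congr rfl fun i _ => ?_
    split_ifs <;> simp [eDensity]
  rw [e1, e1, ← ENNReal.ofReal_mul (Finset.prod_nonneg fun l _ => by
    split_ifs; exacts [hd l x, zero_le_one]), ← Finset.prod_mul_distrib, pairDensity,
    Finset.prod_filter, Finset.prod_filter, ← Finset.prod_mul_distrib]
  congr 1
  refine Finset.prod_congr rfl fun l _ => ?_
  rcases lt_or_ge l r with hl | hl
  · have : ¬ (r : ℕ) ≤ l := not_le.2 hl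
    simp [hl, not_le.2 hl, this]
  · have : (r : ℕ) ≤ l := hl
    simp [hl, not_lt.2 hl]

lemma pairDensity_nonneg (r : Fin k) (x y : ∀ l, 𝒳 l) : 0 ≤ pairDensity m ν X r x y :=
  mul_nonneg (Finset.prod_nonneg fun _ _ => (Real.exp_pos _).le)
    (Finset.prod_nonneg fun _ _ => mul_nonneg (Real.exp_pos _).le (Real.exp_pos _).le)

variable (h : IsMarkedCascade P m ν X u z)
include h

/-- Almost surely, all weights are positive and their sum is positive and finite. -/
lemma IsMarkedCascade.ae_good : ∀ᵐ ω ∂P,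
    (∀ γ, 0 < realWeight u z X γ ω) ∧
    (∀ γ, gibbsWeight u z X γ ω = ENNReal.ofReal (realWeight u z X γ ω)) ∧
    Summable (fun γ => realWeight u z X γ ω) ∧ 0 < ∑' γ, realWeight u z X γ ω ∧
    ∑' γ, gibbsWeight u z X γ ω = ENNReal.ofReal (∑' γ, realWeight u z X γ ω) := by
  have h1 : ∀ᵐ ω ∂P, ∀ l p n, 0 < u l p n ω :=
    ae_all_iff.2 fun l => ae_all_iff.2 fun p => (h.cascade.poisson l p).ae_pos
  filter_upwards [h1, h.ae_tsum_gibbsWeight] with ω hu hS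
  have hpos : ∀ γ, 0 < leafPoint u γ ω := fun γ => Finset.prod_pos fun l _ => hu l _ _
  have hw : ∀ γ, gibbsWeight u z X γ ω = ENNReal.ofReal (realWeight u z X γ ω) := by
    intro γ
    rw [realWeight, ENNReal.ofReal_mul (hpos γ).le, leafPoint,
      ENNReal.ofReal_prod_of_nonneg fun l _ => (hu l _ _).le]
    rfl
  have hpos' : ∀ γ, 0 < realWeight u z X γ ω := fun γ => mul_pos (hpos γ) (Real.exp_pos _)
  have hsum : Summable fun γ => realWeight u z X γ ω := by
    have := ENNReal.summable_toReal hS.2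
    simpa only [hw, ENNReal.toReal_ofReal (hpos' _).le] using this
  exact ⟨hpos', hw, hsum, hsum.tsum_pos (fun γ => (hpos' γ).le) 0 (hpos' 0),
    by simp only [hw]; exact (ENNReal.ofReal_tsum_of_nonneg (fun γ => (hpos' γ).le) hsum).symm⟩

/-- The average of the positive part of `Y`, with real weights inside. -/
lemma IsMarkedCascade.lintegral_ofReal_pairs {r : Fin k} {α β : Fin k → ℕ} (hαβ : Separate r α β)
    {Y : (∀ l, 𝒳 l) × (∀ l, 𝒳 l) → ℝ} (hY : Measurable Y) :
    ∫⁻ ω, (∑' q : PairsAt r, ENNReal.ofReal (realWeight u z X q.1.1 ω * realWeight u z X q.1.2 ω *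
        Y (leafPath z q.1.1 ω, leafPath z q.1.2 ω))) /
          (∑' γ, ENNReal.ofReal (realWeight u z X γ ω)) ^ 2 ∂P
      = ENNReal.ofReal (m r.succ - m r.castSucc) *
        ∫⁻ ω, ENNReal.ofReal (pairDensity m ν X r (leafPath z α ω) (leafPath z β ω) *
          Y (leafPath z α ω, leafPath z β ω)) ∂P := by
  have key := h.lintegral_pairs hαβ hY.ennreal_ofReal
  simp only [densProd_mul_densProd, ← ENNReal.ofReal_mul (pairDensity_nonneg r _ _)] at key
  rw [← key]
  refine lintegral_congr_ae ?_
  filter_upwards [h.ae_good] with ω ⟨hpos, hw, _⟩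
  simp only [hw]
  congr 1
  refine tsum_congr fun q => ?_
  rw [ENNReal.ofReal_mul (mul_nonneg (hpos _).le (hpos _).le), ENNReal.ofReal_mul (hpos _).le]

end final

/-- A sum of reals whose absolute values have a finite sum in `[0, ∞]`. -/
lemma summable_and_tsum_eq_toReal_sub {Q : Type*} {b : Q → ℝ}
    (hb : ∑' q, ENNReal.ofReal |b q| ≠ ⊤) :
    Summable b ∧ ∑' q, b q
      = (∑' q, ENNReal.ofReal (b q)).toReal - (∑' q, ENNReal.ofReal (-b q)).toReal := by
  have hp : ∑' q, ENNReal.ofReal (b q) ≠ ⊤ := ne_top_of_le_ne_top hb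
    (ENNReal.tsum_le_tsum fun q => ENNReal.ofReal_le_ofReal (le_abs_self _))
  have hn : ∑' q, ENNReal.ofReal (-b q) ≠ ⊤ := ne_top_of_le_ne_top hb
    (ENNReal.tsum_le_tsum fun q => ENNReal.ofReal_le_ofReal (neg_le_abs _))
  have e : ∀ q, b q = (ENNReal.ofReal (b q)).toReal - (ENNReal.ofReal (-b q)).toReal := by
    intro q
    rw [ENNReal.toReal_ofReal', ENNReal.toReal_ofReal']
    rcases le_total (b q) 0 with h | h
    · rw [max_eq_right h, max_eq_left (by linarith)]; ring
    · rw [max_eq_left h, max_eq_right (by linarith)]; ring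
  have hs := (ENNReal.summable_toReal hp).sub (ENNReal.summable_toReal hn)
  refine ⟨hs.congr fun q => (e q).symm, ?_⟩
  rw [ENNReal.tsum_toReal_eq fun q => ENNReal.ofReal_ne_top,
    ENNReal.tsum_toReal_eq fun q => ENNReal.ofReal_ne_top,
    ← (ENNReal.summable_toReal hp).tsum_sub (ENNReal.summable_toReal hn)]
  exact tsum_congr e

/-! ### Signed functions of pairs and the case `X = 0` -/

section final

variable {Ω : Type*} [MeasurableSpace Ω] {P : Measure Ω} [IsProbabilityMeasure P]
  {k : ℕ} {𝒳 : Fin k → Type*} [∀ l, MeasurableSpace (𝒳 l)] {m : Fin (k + 1) → ℝ}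
  {ν : (l : Fin k) → Kernel ((i : Set.Iio l) → 𝒳 i) (𝒳 l)} [∀ l, IsMarkovKernel (ν l)]
  {X : (∀ l, 𝒳 l) → ℝ}
  {u : (l : Fin k) → (Set.Iio l → ℕ) → ℕ → Ω → ℝ}
  {z : (l : Fin k) → (Set.Iio l → ℕ) → ℕ → Ω → 𝒳 l}

/-- The average of an integrable `Y` over pairs of leaves that separate at level `r`. -/
theorem IsMarkedCascade.integral_pairs (h : IsMarkedCascade P m ν X u z) {r : Fin k}
    {α β : Fin k → ℕ} (hαβ : Separate r α β)
    {Y : (∀ l, 𝒳 l) × (∀ l, 𝒳 l) → ℝ} (hY : Measurable Y)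
    (hint : Integrable (fun ω => pairDensity m ν X r (leafPath z α ω) (leafPath z β ω) *
      Y (leafPath z α ω, leafPath z β ω)) P) :
    (∀ᵐ ω ∂P, Summable fun q : PairsAt r => realWeight u z X q.1.1 ω * realWeight u z X q.1.2 ω *
      Y (leafPath z q.1.1 ω, leafPath z q.1.2 ω)) ∧
    Integrable (fun ω => (∑' q : PairsAt r, realWeight u z X q.1.1 ω * realWeight u z X q.1.2 ω *
      Y (leafPath z q.1.1 ω, leafPath z q.1.2 ω)) / (∑' γ, realWeight u z X γ ω) ^ 2) P ∧
    ∫ ω, (∑' q : PairsAt r, realWeight u z X q.1.1 ω * realWeight u z X q.1.2 ω *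
      Y (leafPath z q.1.1 ω, leafPath z q.1.2 ω)) / (∑' γ, realWeight u z X γ ω) ^ 2 ∂P
      = (m r.succ - m r.castSucc) *
        ∫ ω, pairDensity m ν X r (leafPath z α ω) (leafPath z β ω) *
          Y (leafPath z α ω, leafPath z β ω) ∂P := by
  have hc : 0 ≤ m r.succ - m r.castSucc :=
    sub_nonneg.2 (h.strictMono.monotone (Fin.castSucc_lt_succ).le)
  have hZ := h.tree.measurable_leafPath
  set b : PairsAt r → Ω → ℝ := fun q ω => realWeight u z X q.1.1 ω * realWeight u z X q.1.2 ω *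
    Y (leafPath z q.1.1 ω, leafPath z q.1.2 ω) with hb
  set S : Ω → ℝ := fun ω => ∑' γ, realWeight u z X γ ω with hS
  set d : Ω → ℝ := fun ω => pairDensity m ν X r (leafPath z α ω) (leafPath z β ω) *
    Y (leafPath z α ω, leafPath z β ω) with hd
  have hwm : ∀ γ, Measurable (realWeight u z X γ) := fun γ =>
    Measurable.fun_mul (Finset.measurable_prod _ fun l _ => h.cascade.measurable l _ _)
      (h.measurable.comp (hZ γ)).exp
  have hbm : ∀ q, Measurable (b q) := fun q =>
    ((hwm _).fun_mul (hwm _)).fun_mul (hY.comp ((hZ _).prodMk (hZ _)))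
  -- With `g = id`, `Neg.neg` and `abs` these are the quotients for the positive part, the negative
  -- part and the absolute value, since `ENNReal.ofReal` truncates at `0`.
  set A : (ℝ → ℝ) → Ω → ℝ≥0∞ := fun g ω => (∑' q, ENNReal.ofReal (g (b q ω))) /
    (∑' γ, ENNReal.ofReal (realWeight u z X γ ω)) ^ 2 with hA
  have hAm : ∀ g, Measurable g → Measurable (A g) := fun g hg =>
    (Measurable.tsum fun q => (hg.comp (hbm q)).ennreal_ofReal).div
      ((Measurable.tsum fun γ => (hwm γ).ennreal_ofReal).pow_const 2)
  have hpos : ∫⁻ ω, A id ω ∂P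
      = ENNReal.ofReal (m r.succ - m r.castSucc) * ∫⁻ ω, ENNReal.ofReal (d ω) ∂P :=
    h.lintegral_ofReal_pairs hαβ hY
  have hneg : ∫⁻ ω, A Neg.neg ω ∂P
      = ENNReal.ofReal (m r.succ - m r.castSucc) * ∫⁻ ω, ENNReal.ofReal (-d ω) ∂P := by
    have := h.lintegral_ofReal_pairs hαβ (Y := fun x => -Y x) hY.fun_neg
    simpa only [mul_neg] using this
  have habs : ∫⁻ ω, A abs ω ∂P
      = ENNReal.ofReal (m r.succ - m r.castSucc) * ∫⁻ ω, ENNReal.ofReal |d ω| ∂P := by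
    have := h.lintegral_ofReal_pairs hαβ (Y := fun x => |Y x|) hY.abs
    simp only [hd, abs_mul, abs_of_nonneg (pairDensity_nonneg r _ _)]
    rw [← this]
    refine lintegral_congr_ae ?_
    filter_upwards [h.ae_good] with ω ⟨hpos, _⟩
    simp only [hA, hb, abs_mul, abs_of_nonneg (hpos _).le]
  have hdabs : ∫⁻ ω, ENNReal.ofReal |d ω| ∂P ≠ ⊤ := hint.abs.lintegral_lt_top.ne
  have hApos : ∫⁻ ω, A id ω ∂P ≠ ⊤ := by
    rw [hpos]
    exact ENNReal.mul_ne_top ENNReal.ofReal_ne_top hint.lintegral_lt_top.ne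
  have hAneg : ∫⁻ ω, A Neg.neg ω ∂P ≠ ⊤ := by
    rw [hneg]
    exact ENNReal.mul_ne_top ENNReal.ofReal_ne_top hint.neg.lintegral_lt_top.ne
  have hfin : ∀ᵐ ω ∂P, A abs ω < ⊤ := by
    refine ae_lt_top (hAm _ measurable_norm) ?_
    rw [habs]
    exact ENNReal.mul_ne_top ENNReal.ofReal_ne_top hdabs
  have hmain : ∀ᵐ ω ∂P, Summable (fun q => b q ω) ∧
      (∑' q, b q ω) / S ω ^ 2 = (A id ω).toReal - (A Neg.neg ω).toReal := by
    filter_upwards [hfin, h.ae_good] with ω hω ⟨_, hw, _, hS0, hS1⟩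
    simp only [hw] at hS1
    -- The denominator is finite, so an infinite numerator would make the quotient infinite.
    have hne : ∑' q, ENNReal.ofReal |b q ω| ≠ ⊤ := by
      intro htop
      simp only [hA, htop, hS1, ENNReal.top_div_of_ne_top
        (ENNReal.pow_ne_top ENNReal.ofReal_ne_top), lt_self_iff_false] at hω
    obtain ⟨h1, h2⟩ := summable_and_tsum_eq_toReal_sub hne
    refine ⟨h1, ?_⟩
    simp only [hA, hS1, ENNReal.toReal_div, ENNReal.toReal_pow, ENNReal.toReal_ofReal hS0.le, id]
    rw [h2, sub_div]
  have hcongr := hmain.mono fun ω hω => hω.2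
  have hi1 := integrable_toReal_of_lintegral_ne_top (hAm id measurable_id).aemeasurable hApos
  have hi2 := integrable_toReal_of_lintegral_ne_top (hAm _ measurable_neg).aemeasurable hAneg
  refine ⟨hmain.mono fun ω hω => hω.1, (hi1.sub hi2).congr (hcongr.mono fun ω hω => hω.symm), ?_⟩
  rw [integral_congr_ae hcongr, integral_sub hi1 hi2,
    integral_toReal (hAm id measurable_id).aemeasurable
      (ae_lt_top (hAm id measurable_id) hApos),
    integral_toReal (hAm _ measurable_neg).aemeasurable (ae_lt_top (hAm _ measurable_neg) hAneg),
    hpos, hneg, integral_eq_lintegral_pos_part_sub_lintegral_neg_part hint, ENNReal.toReal_mul,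
    ENNReal.toReal_mul, ENNReal.toReal_ofReal hc, mul_sub]

lemma levelFun_zero (j : Fin (k + 1)) (x : ∀ l, 𝒳 l) : levelFun m ν (fun _ => 0) j x = 0 := by
  induction j using Fin.reverseInduction generalizing x with
  | last => rw [levelFun_last]
  | cast l ih => simp [levelFun_castSucc, ih]

lemma pairDensity_zero (r : Fin k) (x y : ∀ l, 𝒳 l) : pairDensity m ν (fun _ => 0) r x y = 1 := by
  simp [pairDensity, density, levelFun_zero]

end final

end Cascade

/-! ### Assembly of the theorem -/

theorem mainTheorem7 {Ω : Type*} [MeasurableSpace Ω] (P : Measure Ω) [IsProbabilityMeasure P]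
    {k : ℕ} (m : Fin (k + 1) → ℝ) (hm_zero : m 0 = 0) (hm_mono : StrictMono m)
    (hm_last : m (Fin.last k) < 1)
    (u : (l : Fin k) → (Set.Iio l → ℕ) → ℕ → Ω → ℝ) (hu : Cascade.IsCascade P m u)
    {𝒳 : Fin k → Type*} [∀ l, TopologicalSpace (𝒳 l)] [∀ l, PolishSpace (𝒳 l)]
    [∀ l, MeasurableSpace (𝒳 l)] [∀ l, BorelSpace (𝒳 l)]
    (ν : (l : Fin k) → Kernel ((i : Set.Iio l) → 𝒳 i) (𝒳 l)) [∀ l, IsMarkovKernel (ν l)]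
    (z : (l : Fin k) → (Set.Iio l → ℕ) → ℕ → Ω → 𝒳 l) (hz : Cascade.IsTreeProcess P ν z)
    (huz : IndepFun (fun ω l p n => u l p n ω) (fun ω l p n => z l p n ω) P)
    (X : (∀ l, 𝒳 l) → ℝ) (hX_meas : Measurable X)
    (hX_exp : ∀ γ, Integrable (fun ω => Real.exp (X (Cascade.leafPath z γ ω))) P)
    (Y : (∀ l, 𝒳 l) × (∀ l, 𝒳 l) → ℝ) (hY_meas : Measurable Y)
    (hY_sq : ∀ γ δ, Integrable
      (fun ω => Y (Cascade.leafPath z γ ω, Cascade.leafPath z δ ω) ^ 2) P)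
    (r : Fin k) (α β : Fin k → ℕ) (hαβ : Cascade.wedge α β = (r : ℕ) + 1) :
    -- the weights are a.s. well defined, and the mean weight of the pairs at level `r`
    (∀ᵐ ω ∂P, Summable (fun γ => Cascade.leafPoint u γ ω) ∧
      0 < ∑' γ, Cascade.leafPoint u γ ω) ∧
    (∫ ω, (∑' q : Cascade.PairsAt r,
        Cascade.leafWeight u q.1.1 ω * Cascade.leafWeight u q.1.2 ω) ∂P
      = m r.succ - m r.castSucc) ∧
    -- the Gibbs weights are a.s. well defined
    (∀ᵐ ω ∂P,
      Summable (fun γ => Cascade.leafPoint u γ ω * Real.exp (X (Cascade.leafPath z γ ω))) ∧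
      0 < ∑' γ, Cascade.leafPoint u γ ω * Real.exp (X (Cascade.leafPath z γ ω))) ∧
    -- the identity for `|Y|`, with values in `[0, ∞]`
    (∫⁻ ω, (∑' q : Cascade.PairsAt r, ENNReal.ofReal
          (Cascade.leafPoint u q.1.1 ω * Cascade.leafPoint u q.1.2 ω *
            Real.exp (X (Cascade.leafPath z q.1.1 ω) + X (Cascade.leafPath z q.1.2 ω)) *
            |Y (Cascade.leafPath z q.1.1 ω, Cascade.leafPath z q.1.2 ω)|)) /
        (∑' γ, ENNReal.ofReal
          (Cascade.leafPoint u γ ω * Real.exp (X (Cascade.leafPath z γ ω)))) ^ 2 ∂P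
      = ENNReal.ofReal (m r.succ - m r.castSucc) *
        ∫⁻ ω, ENNReal.ofReal
          (Cascade.pairDensity m ν X r (Cascade.leafPath z α ω) (Cascade.leafPath z β ω) *
            |Y (Cascade.leafPath z α ω, Cascade.leafPath z β ω)|) ∂P) ∧
    -- the identity for `Y`, whenever the expectation `M_r` exists
    (Integrable (fun ω =>
        Cascade.pairDensity m ν X r (Cascade.leafPath z α ω) (Cascade.leafPath z β ω) *
          Y (Cascade.leafPath z α ω, Cascade.leafPath z β ω)) P →
      (∀ᵐ ω ∂P, Summable (fun q : Cascade.PairsAt r =>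
        Cascade.leafPoint u q.1.1 ω * Cascade.leafPoint u q.1.2 ω *
          Real.exp (X (Cascade.leafPath z q.1.1 ω) + X (Cascade.leafPath z q.1.2 ω)) *
          Y (Cascade.leafPath z q.1.1 ω, Cascade.leafPath z q.1.2 ω))) ∧
      Integrable (fun ω => (∑' q : Cascade.PairsAt r,
          Cascade.leafPoint u q.1.1 ω * Cascade.leafPoint u q.1.2 ω *
            Real.exp (X (Cascade.leafPath z q.1.1 ω) + X (Cascade.leafPath z q.1.2 ω)) *
            Y (Cascade.leafPath z q.1.1 ω, Cascade.leafPath z q.1.2 ω)) /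
        (∑' γ, Cascade.leafPoint u γ ω * Real.exp (X (Cascade.leafPath z γ ω))) ^ 2) P ∧
      ∫ ω, (∑' q : Cascade.PairsAt r,
          Cascade.leafPoint u q.1.1 ω * Cascade.leafPoint u q.1.2 ω *
            Real.exp (X (Cascade.leafPath z q.1.1 ω) + X (Cascade.leafPath z q.1.2 ω)) *
            Y (Cascade.leafPath z q.1.1 ω, Cascade.leafPath z q.1.2 ω)) /
        (∑' γ, Cascade.leafPoint u γ ω * Real.exp (X (Cascade.leafPath z γ ω))) ^ 2 ∂P
      = (m r.succ - m r.castSucc) *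
        ∫ ω, Cascade.pairDensity m ν X r (Cascade.leafPath z α ω) (Cascade.leafPath z β ω) *
          Y (Cascade.leafPath z α ω, Cascade.leafPath z β ω) ∂P) := by
  classical
  have hsep : Cascade.Separate r α β := Cascade.wedge_eq_iff.1 hαβ
  have hcascade : ∀ X : (∀ l, 𝒳 l) → ℝ, Measurable X →
      (∀ γ, Integrable (fun ω => Real.exp (X (Cascade.leafPath z γ ω))) P) →
      Cascade.IsMarkedCascade P m ν X u z := fun X hX hX_exp =>
    ⟨hm_zero, hm_mono, hm_last, hu, hz, huz, hX,
      hz.levelOp_eDensity hm_zero hm_mono hm_last hX hX_exp⟩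
  have h := hcascade X hX_meas hX_exp
  -- For `X = 0` all densities are `1` and the Gibbs weights are the `v_γ`; this case gives the
  -- claims about `v` and `w`.
  have h0 := hcascade (fun _ => 0) measurable_const (by simp)
  have e : ∀ γ δ ω, Cascade.leafPoint u γ ω * Cascade.leafPoint u δ ω *
      Real.exp (X (Cascade.leafPath z γ ω) + X (Cascade.leafPath z δ ω))
      = Cascade.realWeight u z X γ ω * Cascade.realWeight u z X δ ω := by
    intro γ δ ω
    rw [Real.exp_add, Cascade.realWeight, Cascade.realWeight]
    ring
  have e0 : ∀ γ ω, Cascade.realWeight u z (fun _ => (0 : ℝ)) γ ω = Cascade.leafPoint u γ ω := by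
    intro γ ω
    rw [Cascade.realWeight, Real.exp_zero, mul_one]
  simp only [e]
  refine ⟨?_, ?_, ?_, ?_, ?_⟩
  · filter_upwards [h0.ae_good] with ω ⟨_, _, h1, h2, _⟩
    simp only [e0] at h1 h2
    exact ⟨h1, h2⟩
  · have h1 := (h0.integral_pairs hsep (Y := fun _ => 1) measurable_const
      (by simp [Cascade.pairDensity_zero])).2.2
    simp only [e0, Cascade.pairDensity_zero, mul_one, integral_const, probReal_univ,
      smul_eq_mul] at h1
    rw [← h1]
    refine integral_congr_ae (Filter.Eventually.of_forall fun ω => ?_)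
    simp only [Cascade.leafWeight, div_mul_div_comm, ← pow_two (tsum _), tsum_div_const]
  · filter_upwards [h.ae_good] with ω ⟨_, _, h1, h2, _⟩
    exact ⟨h1, h2⟩
  · exact h.lintegral_ofReal_pairs hsep hY_meas.abs
  · exact fun hint => h.integral_pairs hsep hY_meas hint
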